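/- Let $(X,\mathcal B,m)$ be a probability space, let $F$ be the set of all measurable $f:X\to\mathbb R$ with $|f|\le 1$, and let $I(f)=\int_X f\,dm$ for $f\in F$. A randomized quantum algorithm draws $n$ independent random points $x_1,\dots,x_n\in X$ with distribution $m$ (the random generator is free of cost) and then performs a quantum computation: on a number of quantum bits, starting in a classical state, it applies finitely many steps, each of which is either a unitary transformation of at most two quantum bits or an application of an oracle for the numbers $\tilde f(x_1),\dots,\tilde f(x_n)$, where $\tilde f:X\to\mathbb R$ is an approximation with $|f(x)-\tilde f(x)|\le\varepsilon/3$ for all $x$, of which nothing else is known. The final state is measured, and certain bits of the result, read as a sign and binary digits, form the output $A(f,\varepsilon)$. The number $n$ and the circuit may depend on $(X,\mathcal B,m)$ and $\varepsilon$, but not on $f$ and $\tilde f$. It is required that for every $f\in F$ and every such $\tilde f$ $$|A(f,\varepsilon)-I(f)|\le\varepsilon\quad\text{with probability at least }3/4,$$ where the probability is joint over the random points and the measurement. In the quantum bit number model the oracle is the Boolean oracle $|i\rangle|j\rangle|c\rangle\mapsto|i\rangle|j\rangle|c\oplus(j\text{th bit of }\tilde f(x_i))\rangle$ (digit $0$ is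 the sign bit, and the others are the binary digits of the absolute value, from the units digit on), each unitary transformation of at most two quantum bits and each application of the oracle has cost one, and $\mathrm{comp}^{\rm random}_{\rm quant}(F,\varepsilon)$ is the minimal cost of such an algorithm. In the quantum query model $\tilde f$ also has values in $[-1,1]$, the oracle is the real valued oracle $|i\rangle|0\rangle\mapsto|i\rangle(\sqrt{t_i}\,|0\rangle+\sqrt{1-t_i}\,|1\rangle)$, $|i\rangle|1\rangle\mapsto|i\rangle(\sqrt{1-t_i}\,|0\rangle-\sqrt{t_i}\,|1\rangle)$ with $t_i=(1+\tilde f(x_i))/2$, and the complexity $\mathrm{comp}^{\rm random}_{\rm quant,\,query}(F,\varepsilon)$ is the minimal number of applications of the oracle. Then there is a constant $C>0$, independent of the space $(X,\mathcal B,m)$ and of $\varepsilon$, such that for all $(X,\mathcal B,m)$ and all $0<\varepsilon\le 1/2$ $$\mathrm{comp}^{\rm random}_{\rm quant}(F,\varepsilon)\le C\,\varepsilon^{-1}\log\varepsilon^{-1} \qquad\text{and}\qquad \mathrm{comp}^{\rm random}_{\rm quant,\,query}(F,\varepsilon)\le C\,\varepsilon^{-1}.$$ -/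

import Mathlib

open MeasureTheory
open scoped ENNReal

universe u

noncomputable section

namespace QuantumIntegration

/-! ### Quantum circuits with an oracle -/

/-- A classical state of a family of (quantum) bits indexed by `ι`. -/
abbrev Bits (ι : Type) : Type := ι → Bool

/-- Vectors of the tensor product `H_m` of `m` copies of `ℂ²`, given by their coefficients in the
orthonormal basis of classical states. -/
abbrev State (m : ℕ) : Type := Bits (Fin m) → ℂ

/-- The classical state `b`, as a vector of `H_m`. -/
def basisState {m : ℕ} (b : Bits (Fin m)) : State m := fun a => if a = b then 1 else 0

/-- The operator on `H_m` that acts by the matrix `U` on the tensor factors (qubits) `w i`, `i : ι`,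
and as the identity on the other ones. Here `Function.extend w c a` is the classical state `a` with
the bits on the wires `w` replaced by `c`. -/
def applyOn {ι : Type} [Fintype ι] [DecidableEq ι] {m : ℕ} (w : ι ↪ Fin m)
    (U : Matrix (Bits ι) (Bits ι) ℂ) (ψ : State m) : State m :=
  fun a => ∑ c : Bits ι, U (a ∘ w) c * ψ (Function.extend w c a)

/-- One step of a quantum computation on `m` qubits: a unitary transformation of at most two qubits,
or an application of the oracle, which acts on qubits labelled by `ι`, to the wires `w`. -/
inductive Step (m : ℕ) (ι : Type) : Type
  | gate (r : ℕ) (hr : r ≤ 2) (w : Fin r ↪ Fin m) (U : Matrix.unitaryGroup (Fin r → Bool) ℂ) :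
      Step m ι
  | query (w : ι ↪ Fin m) : Step m ι

/-- The action of one step on `H_m`, when the oracle is the matrix `Q`. -/
def Step.apply {m : ℕ} {ι : Type} [Fintype ι] [DecidableEq ι]
    (Q : Matrix (Bits ι) (Bits ι) ℂ) : Step m ι → State m → State m
  | .gate _ _ w U, ψ => applyOn w (U : Matrix _ _ ℂ) ψ
  | .query w, ψ => applyOn w Q ψ

/-- Whether a step is an application of the oracle. -/
def Step.isQuery {m : ℕ} {ι : Type} : Step m ι → Bool
  | .gate _ _ _ _ => false
  | .query _ => true

/-- A quantum algorithm with an oracle acting on qubits labelled by `ι`: a number of qubits, a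
classical initial state, a list of steps (the first one is applied first), and the bits of the
measured classical state that form the output, which is a real number written in binary with
a sign bit and `precision` digits. -/
structure QuantumAlgorithm (ι : Type) where
  qubits : ℕ
  init : Bits (Fin qubits)
  steps : List (Step qubits ι)
  precision : ℕ
  signWire : Fin qubits
  digitWire : Fin precision → Fin qubits

namespace QuantumAlgorithm

variable {ι : Type}

/-- The quantum state before the final measurement. -/
def finalState [Fintype ι] [DecidableEq ι] (A : QuantumAlgorithm ι)
    (Q : Matrix (Bits ι) (Bits ι) ℂ) : State A.qubits :=
  A.steps.foldl (fun ψ s => s.apply Q ψ) (basisState A.init)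

/-- The real number `± d₀.d₁d₂d₃…` (binary) that is output if the classical state `a` is measured. -/
def output (A : QuantumAlgorithm ι) (a : Bits (Fin A.qubits)) : ℝ :=
  (if a A.signWire then -1 else 1) *
    ∑ j : Fin A.precision, (if a (A.digitWire j) then 1 else 0) / (2 : ℝ) ^ (j : ℕ)

open Classical in
/-- The probability that the output has the property `P`, when the oracle is `Q`: the classical
state `a` is measured with probability `|β_a|²`, with `β_a` the coefficient of `a` in the
final state. -/
def prob [Fintype ι] [DecidableEq ι] (A : QuantumAlgorithm ι)
    (Q : Matrix (Bits ι) (Bits ι) ℂ) (P : ℝ → Prop) : ℝ≥0∞ :=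
  ∑ a : Bits (Fin A.qubits), if P (A.output a) then ENNReal.ofReal (‖A.finalState Q a‖ ^ 2) else 0

/-- The cost in the quantum bit number model: every unitary transformation of at most two qubits
and every application of the oracle has cost one. -/
def cost (A : QuantumAlgorithm ι) : ℕ := A.steps.length

/-- The cost in the quantum query model: the number of applications of the oracle. -/
def queryCost (A : QuantumAlgorithm ι) : ℕ := A.steps.countP Step.isQuery

end QuantumAlgorithm

/-! ### The oracles -/

/-- The number with the binary expansion `a 0, a 1, …, a (k - 1)`, most significant bit first. -/
def bitsToNat {k : ℕ} (a : Bits (Fin k)) : ℕ :=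
  ∑ j : Fin k, (a j).toNat * 2 ^ (j.rev : ℕ)

/-- The digits of a real number `y` with `|y| < 2` in binary: digit `0` is the sign bit, and
digit `j + 1` is the coefficient of `2 ^ (-j)` in the binary expansion of `|y|`. -/
def digit (y : ℝ) : ℕ → Bool
  | 0 => decide (y < 0)
  | j + 1 => decide (⌊|y| * 2 ^ j⌋₊ % 2 = 1)

/-- The qubits on which the Boolean oracle acts: `k` qubits for the index `i` of a number,
`l` qubits for the index `j` of a digit, and one target qubit. -/
abbrev BitPort (k l : ℕ) : Type := (Fin k ⊕ Fin l) ⊕ Unit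

/-- The bit asked for by the classical input `b` of the Boolean oracle: digit `j` of `v i`
(and `0` if there is no number with index `i`). -/
def requestedBit {n k l : ℕ} (v : Fin n → ℝ) (b : Bits (BitPort k l)) : Bool :=
  if h : bitsToNat (fun p => b (.inl (.inl p))) < n then
    digit (v ⟨_, h⟩) (bitsToNat fun p => b (.inl (.inr p)))
  else false

/-- The Boolean oracle for the numbers `v 0, …, v (n - 1)`:
`|i⟩ |j⟩ |c⟩ ↦ |i⟩ |j⟩ |c ⊕ (digit j of v i)⟩`. -/
def bitOracle {n : ℕ} (k l : ℕ) (v : Fin n → ℝ) :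
    Matrix (Bits (BitPort k l)) (Bits (BitPort k l)) ℂ :=
  fun a b => if a = Function.update b (.inr ()) (xor (b (.inr ())) (requestedBit v b))
    then 1 else 0

/-- The qubits on which the real valued oracle acts: `k` qubits for the index `i` of a number
and one target qubit. -/
abbrev RealPort (k : ℕ) : Type := Fin k ⊕ Unit

/-- The unitary matrix with `e₀ ↦ √t e₀ + √(1-t) e₁` and `e₁ ↦ √(1-t) e₀ - √t e₁`,
for `0 ≤ t ≤ 1`. -/
def amplitudeMatrix (t : ℝ) : Matrix Bool Bool ℂ
  | false, false => (Real.sqrt t : ℂ)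
  | true, false => (Real.sqrt (1 - t) : ℂ)
  | false, true => (Real.sqrt (1 - t) : ℂ)
  | true, true => -(Real.sqrt t : ℂ)

/-- The real valued oracle for the numbers `v 0, …, v (n - 1)` from `[-1, 1]`, which are rescaled
to `t i = (1 + v i) / 2` in `[0, 1]`: `|i⟩ |0⟩ ↦ |i⟩ (√(t i) |0⟩ + √(1 - t i) |1⟩)`. It acts as
the identity if there is no number with index `i`. -/
def realOracle {n : ℕ} (k : ℕ) (v : Fin n → ℝ) :
    Matrix (Bits (RealPort k)) (Bits (RealPort k)) ℂ :=
  fun a b =>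
    if (fun p => a (.inl p)) = fun p => b (.inl p) then
      if h : bitsToNat (fun p => b (.inl p)) < n then
        amplitudeMatrix ((1 + v ⟨_, h⟩) / 2) (a (.inr ())) (b (.inr ()))
      else if a (.inr ()) = b (.inr ()) then 1 else 0
    else 0

/-! ### Integration with a free random generator -/

variable {X : Type u} [MeasurableSpace X]

/-- The randomized quantum algorithm that draws `n` independent random points `x` from `(X, μ)` and
then runs `A` with the Boolean oracle for the numbers `f' (x i)` computes, to error `ε` with
probability at least `3/4`, the integral of every measurable `f` with `|f| ≤ 1`. The oracle
is only assumed to give the values up to an error of `ε / 3`. The integral over the random points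
is a lower integral, so no measurability of `f'` is needed. -/
def BitSolves (μ : Measure X) (ε : ℝ) (n : ℕ) {k l : ℕ} (A : QuantumAlgorithm (BitPort k l)) :
    Prop :=
  ∀ f : X → ℝ, Measurable f → (∀ x, |f x| ≤ 1) →
    ∀ f' : X → ℝ, (∀ x, |f x - f' x| ≤ ε / 3) →
      3 / 4 ≤ ∫⁻ x : Fin n → X, A.prob (bitOracle k l fun i => f' (x i))
        (fun y => |y - ∫ z, f z ∂μ| ≤ ε) ∂(Measure.pi fun _ => μ)

/-- The same with the real valued oracle; here the approximate values are in `[-1, 1]`. -/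
def QuerySolves (μ : Measure X) (ε : ℝ) (n : ℕ) {k : ℕ} (A : QuantumAlgorithm (RealPort k)) :
    Prop :=
  ∀ f : X → ℝ, Measurable f → (∀ x, |f x| ≤ 1) →
    ∀ f' : X → ℝ, (∀ x, |f x - f' x| ≤ ε / 3) → (∀ x, |f' x| ≤ 1) →
      3 / 4 ≤ ∫⁻ x : Fin n → X, A.prob (realOracle k fun i => f' (x i))
        (fun y => |y - ∫ z, f z ∂μ| ≤ ε) ∂(Measure.pi fun _ => μ)

/-- The complexity of integration in the quantum bit number model with a free random generator:
the minimal cost of an algorithm with error `ε` (`⊤` if there is none). -/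
def compRandomQuant (μ : Measure X) (ε : ℝ) : ℕ∞ :=
  ⨅ (n : ℕ) (k : ℕ) (l : ℕ) (A : QuantumAlgorithm (BitPort k l)) (_ : BitSolves μ ε n A),
    (A.cost : ℕ∞)

/-- The complexity of integration in the quantum query model with a free random generator. -/
def compRandomQuantQuery (μ : Measure X) (ε : ℝ) : ℕ∞ :=
  ⨅ (n : ℕ) (k : ℕ) (A : QuantumAlgorithm (RealPort k)) (_ : QuerySolves μ ε n A),
    (A.queryCost : ℕ∞)

end QuantumIntegration

end

/-! Let `N = 2 ^ q` be of order `ε⁻¹` and draw `N ^ 2` random points. By Chebyshev's inequality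
(`measure_sample_mean_le`) the sample mean of `f` is within `ε / 6` of the integral with probability
at least `9/10`, and passing to the approximate values moves it by at most `ε / 3`. It remains to
find the mean of `N ^ 2` numbers up to `O(1 / N)`, and amplitude estimation does this with `O(N)`
oracle calls. Since it succeeds with probability `9/10` for every good sample, the joint probability
is at least `81/100 ≥ 3/4`.

Amplitude estimation is phase estimation for a walk. A product state `ψ` is prepared by one-qubit
rotations, and the oracle yields an involution `U` for which `lam = ⟨ψ, Uψ⟩` is an affine function
of the mean. With `R = 2ψψᵀ - 1`, the walk `RU` maps the span of `ψ` and `φ = Uψ` to itself and has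
there the eigenvalues `e^{±iθ}`, `cos θ = lam`; the vector `ψ` is a sum of two orthogonal
eigenvectors (`IsReflection.exists_eigen`). Phase estimation uses `N - 1` steps of the walk. Its
outcome distribution is a squared Dirichlet kernel, whose tails give the cosine of the phase up to
`44 / N` with probability `9/10` (`phase_tail`). The sign of the phase does not matter, because the
cosine is even. A table with `N` entries turns the outcome into output digits (`fullCirc_prob`).

For the real valued oracle `O`, take `U = OZO` with `Z` the sign flip of the target. For a uniform
index and target `false`, `lam` is exactly the mean (`isReflection_query`), at two queries per step.

For the Boolean oracle, the digit index `j` is put in superposition with weights proportional to `2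
^ (-j)`. Flipping the sign according to digit `j` then has an expectation that is affine in the
number itself, so one digit query replaces reading the whole expansion. A further wire mixes this
with the sign bit (`isReflection_bit`). The weights factor over the bits of `j`, so `ψ` is still a
product state. Thus `U` has constant cost, `R` costs `O(q)`, and the walk and the table together
cost `O(N q)`. -/

set_option linter.unusedSectionVars false

noncomputable section

namespace QuantumIntegration

/-! ### Circuits on an arbitrary finite family of wires -/

section Circuits

variable {V ι : Type} [DecidableEq V] [Fintype ι] [DecidableEq ι]

/-- Complex amplitudes on the classical states of the wires `V`. -/
abbrev Amp (V : Type) : Type := Bits V → ℂ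

/-- The matrix `U` on the wires `w`, for wires labelled by an arbitrary type. -/
def act {κ : Type} [Fintype κ] [DecidableEq κ] (w : κ ↪ V) (U : Matrix (Bits κ) (Bits κ) ℂ)
    (ψ : Amp V) : Amp V :=
  fun a => ∑ c : Bits κ, U (a ∘ w) c * ψ (Function.extend w c a)

/-- One step of a computation on the wires `V`. -/
inductive WStep (V ι : Type) : Type
  | gate (r : ℕ) (hr : r ≤ 2) (w : Fin r ↪ V) (U : Matrix.unitaryGroup (Fin r → Bool) ℂ) :
      WStep V ι
  | query (w : ι ↪ V) : WStep V ι

/-- The action of a step when the oracle is `Q`. -/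
def WStep.apply (Q : Matrix (Bits ι) (Bits ι) ℂ) : WStep V ι → Amp V → Amp V
  | .gate _ _ w U, ψ => act w (U : Matrix _ _ ℂ) ψ
  | .query w, ψ => act w Q ψ

/-- Whether a step is an application of the oracle. -/
def WStep.isQuery : WStep V ι → Bool
  | .gate _ _ _ _ => false
  | .query _ => true

/-- A circuit is a list of steps; the first one is applied first. -/
abbrev Circ (V ι : Type) : Type := List (WStep V ι)

/-- The action of a circuit when the oracle is `Q`. -/
def run (Q : Matrix (Bits ι) (Bits ι) ℂ) (c : Circ V ι) (ψ : Amp V) : Amp V :=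
  c.foldl (fun ψ s => s.apply Q ψ) ψ

/-- The number of applications of the oracle. -/
def queries (c : Circ V ι) : ℕ := c.countP WStep.isQuery

variable (Q : Matrix (Bits ι) (Bits ι) ℂ)

@[simp] theorem run_nil (ψ : Amp V) : run Q [] ψ = ψ := rfl

theorem run_append (c d : Circ V ι) (ψ : Amp V) : run Q (c ++ d) ψ = run Q d (run Q c ψ) := by
  simp [run]

theorem queries_append (c d : Circ V ι) : queries (c ++ d) = queries c + queries d := by
  simp [queries]

theorem act_add_smul {κ : Type} [Fintype κ] [DecidableEq κ] (w : κ ↪ V)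
    (U : Matrix (Bits κ) (Bits κ) ℂ) (a : ℂ) (ψ φ : Amp V) :
    act w U (a • ψ + φ) = a • act w U ψ + act w U φ := by
  funext x
  simp only [act, Pi.add_apply, Pi.smul_apply, smul_eq_mul, Finset.mul_sum,
    ← Finset.sum_add_distrib]
  exact Finset.sum_congr rfl fun c _ => by ring

theorem run_add_smul (c : Circ V ι) (a : ℂ) (ψ φ : Amp V) :
    run Q c (a • ψ + φ) = a • run Q c ψ + run Q c φ := by
  induction c generalizing ψ φ with
  | nil => rfl
  | cons s c ih =>
    have h : s.apply Q (a • ψ + φ) = a • s.apply Q ψ + s.apply Q φ := by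
      cases s <;> exact act_add_smul ..
    change run Q c (s.apply Q (a • ψ + φ)) = _
    rw [h, ih]
    rfl

theorem run_zero (c : Circ V ι) : run Q c (0 : Amp V) = 0 := by
  have h := run_add_smul Q c (-1) (0 : Amp V) 0
  simpa using h

theorem run_add (c : Circ V ι) (ψ φ : Amp V) : run Q c (ψ + φ) = run Q c ψ + run Q c φ := by
  simpa using run_add_smul Q c 1 ψ φ

theorem run_smul (c : Circ V ι) (a : ℂ) (ψ : Amp V) : run Q c (a • ψ) = a • run Q c ψ := by
  simpa [run_zero] using run_add_smul Q c a ψ 0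

/-! #### One-qubit gates -/

/-- The matrix is a real reflection. Preparation gates and oracle are therefore their own inverses,
and no adjoint operation is ever required. -/
theorem amplitudeMatrix_mul_self {t : ℝ} (h0 : 0 ≤ t) (h1 : t ≤ 1) :
    amplitudeMatrix t * amplitudeMatrix t = 1 := by
  have e0 : (Real.sqrt t : ℂ) * Real.sqrt t = t := by
    rw [← Complex.ofReal_mul, Real.mul_self_sqrt h0]
  have e1 : (Real.sqrt (1 - t) : ℂ) * Real.sqrt (1 - t) = 1 - t := by
    rw [← Complex.ofReal_mul, Real.mul_self_sqrt (by linarith)]; push_cast; rfl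
  ext a b
  cases a <;> cases b <;>
    simp only [Matrix.mul_apply, Fintype.sum_bool, amplitudeMatrix, Matrix.one_apply] <;>
    simp [e0, e1] <;> ring

theorem amplitudeMatrix_symm (t : ℝ) (a b : Bool) : amplitudeMatrix t a b = amplitudeMatrix t b a := by
  cases a <;> cases b <;> rfl

theorem star_amplitudeMatrix (t : ℝ) (a b : Bool) :
    (starRingEnd ℂ) (amplitudeMatrix t a b) = amplitudeMatrix t a b := by
  cases a <;> cases b <;> simp [amplitudeMatrix]

theorem amplitudeMatrix_mem_unitary (t : unitInterval) :
    amplitudeMatrix t ∈ Matrix.unitaryGroup Bool ℂ := by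
  rw [Matrix.mem_unitaryGroup_iff]
  have : star (amplitudeMatrix (t : ℝ)) = amplitudeMatrix t := by
    ext a b
    rw [Matrix.star_apply, amplitudeMatrix_symm]
    exact star_amplitudeMatrix _ _ _
  rw [this, amplitudeMatrix_mul_self t.2.1 t.2.2]

/-- The embedding of a single wire. -/
def wire1 (v : V) : Fin 1 ↪ V := ⟨fun _ => v, fun _ _ _ => Subsingleton.elim _ _⟩

/-- The one-qubit gate `amplitudeMatrix t` on the wire `v`. -/
def rot (v : V) (t : unitInterval) : Circ V ι :=
  [.gate 1 (by norm_num) (wire1 v)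
    ⟨(amplitudeMatrix t).submatrix (Equiv.funUnique (Fin 1) Bool) (Equiv.funUnique (Fin 1) Bool), by
      have h := (Matrix.mem_unitaryGroup_iff).1 (amplitudeMatrix_mem_unitary t)
      rw [Matrix.mem_unitaryGroup_iff, Matrix.star_eq_conjTranspose, Matrix.conjTranspose_submatrix,
        Matrix.submatrix_mul_equiv, ← Matrix.star_eq_conjTranspose, h, Matrix.submatrix_one_equiv]⟩]

/-- The action of `amplitudeMatrix t` on the wire `v`. -/
def rotate (v : V) (t : ℝ) (ψ : Amp V) : Amp V :=
  fun x => ∑ b : Bool, amplitudeMatrix t (x v) b * ψ (Function.update x v b)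

theorem run_rot (v : V) (t : unitInterval) (ψ : Amp V) :
    run Q (rot v t) ψ = rotate v t ψ := by
  funext x
  change act (wire1 v) _ ψ x = _
  unfold act rotate
  refine Fintype.sum_equiv (Equiv.funUnique (Fin 1) Bool) _ _ fun c => ?_
  have : Function.extend (wire1 v) c x = Function.update x v (c 0) := by
    funext u
    by_cases hu : u = v
    · subst hu
      rw [Function.update_self]
      exact (wire1 u).injective.extend_apply c x 0
    · rw [Function.update_of_ne hu, Function.extend_apply']
      rintro ⟨_, h⟩
      exact hu h.symm
  rw [this]
  rfl

theorem rotate_rotate (v : V) {t : ℝ} (h0 : 0 ≤ t) (h1 : t ≤ 1) (ψ : Amp V) :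
    rotate v t (rotate v t ψ) = ψ := by
  funext x
  have h := amplitudeMatrix_mul_self h0 h1
  have h' : ∀ a b, ∑ c, amplitudeMatrix t a c * amplitudeMatrix t c b = if a = b then 1 else 0 :=
    fun a b => by rw [← Matrix.mul_apply, h, Matrix.one_apply]
  simp only [Fintype.sum_bool] at h'
  have e1 : ψ x = ψ (Function.update x v (x v)) := by rw [Function.update_eq_self]
  rw [e1]
  simp only [rotate, Fintype.sum_bool, Function.update_self, Function.update_idem]
  have ht := h' (x v) true
  have hf := h' (x v) false
  cases hx : x v <;> simp only [hx] at ht hf <;> simp at ht hf <;>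
    linear_combination (ψ (Function.update x v true)) * ht + (ψ (Function.update x v false)) * hf

/-- The rotation of the wire `v` by an amount that may depend on the other wires. -/
def rotateBy (v : V) (τ : Bits V → ℝ) (ψ : Amp V) : Amp V := fun x => rotate v (τ x) ψ x

/-- The operator is block diagonal with symmetric `2 × 2` blocks, because `hτ` makes the angle
independent of the wire `v`. The product `⬝ᵥ` is bilinear; on the real vectors `psi` and `φ` it is
the inner product. -/
theorem rotateBy_dot [Fintype V] (v : V) {τ : Bits V → ℝ}
    (hτ : ∀ x b, τ (Function.update x v b) = τ x) (ψ φ : Amp V) :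
    rotateBy v τ ψ ⬝ᵥ φ = ψ ⬝ᵥ rotateBy v τ φ := by
  let e : Bits V ≃ Bool × Bits {u // u ≠ v} := Equiv.piSplitAt v fun _ => Bool
  have key : ∀ (y : Bits {u // u ≠ v}) (a b : Bool),
      Function.update (e.symm (a, y)) v b = e.symm (b, y) := by
    intro y a b
    funext u
    by_cases hu : u = v
    · subst hu; simp [e, Equiv.piSplitAt]
    · simp [e, Equiv.piSplitAt, hu]
  have kv : ∀ (y : Bits {u // u ≠ v}) (a : Bool), e.symm (a, y) v = a := by
    intro y a; simp [e, Equiv.piSplitAt]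
  have kτ : ∀ (y : Bits {u // u ≠ v}), τ (e.symm (true, y)) = τ (e.symm (false, y)) := by
    intro y; rw [← key y true false, hτ]
  unfold dotProduct
  rw [← e.symm.sum_comp, ← e.symm.sum_comp, Fintype.sum_prod_type_right, Fintype.sum_prod_type_right]
  refine Finset.sum_congr rfl fun y _ => ?_
  simp only [rotateBy, rotate, Fintype.sum_bool, key, kv, kτ]
  rw [amplitudeMatrix_symm _ false true]
  ring

theorem rotate_dot [Fintype V] (v : V) (t : ℝ) (ψ φ : Amp V) :
    rotate v t ψ ⬝ᵥ φ = ψ ⬝ᵥ rotate v t φ :=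
  rotateBy_dot v (τ := fun _ => t) (fun _ _ => rfl) ψ φ

theorem rotateBy_rotateBy (v : V) {τ : Bits V → ℝ}
    (hτ : ∀ x b, τ (Function.update x v b) = τ x) (h0 : ∀ x, 0 ≤ τ x) (h1 : ∀ x, τ x ≤ 1)
    (ψ : Amp V) : rotateBy v τ (rotateBy v τ ψ) = ψ := by
  funext x
  have h : rotateBy v τ (rotateBy v τ ψ) x = rotate v (τ x) (rotate v (τ x) ψ) x := by
    simp only [rotateBy, rotate, hτ]
  rw [h, rotate_rotate v (h0 x) (h1 x)]

/-! #### Two-qubit gates -/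

/-- The embedding of two different wires. -/
def wire2 {u v : V} (h : u ≠ v) : Fin 2 ↪ V :=
  ⟨![u, v], by
    intro i j hij
    fin_cases i <;> fin_cases j <;> simp_all [eq_comm]⟩

theorem extend_self {κ : Type} (w : κ ↪ V) (x : Bits V) : Function.extend w (x ∘ w) x = x := by
  funext u
  by_cases h : ∃ i, w i = u
  · obtain ⟨i, rfl⟩ := h
    exact w.injective.extend_apply _ _ i
  · exact Function.extend_apply' _ _ _ h

theorem act_diagonal {κ : Type} [Fintype κ] [DecidableEq κ] (w : κ ↪ V) (d : Bits κ → ℂ)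
    (ψ : Amp V) (x : Bits V) : act w (Matrix.diagonal d) ψ x = d (x ∘ w) * ψ x := by
  unfold act
  rw [Finset.sum_eq_single (x ∘ w)]
  · rw [extend_self, Matrix.diagonal_apply_eq]
  · intro c _ hc
    rw [Matrix.diagonal_apply_ne _ (Ne.symm hc), zero_mul]
  · simp

/-- Each row has a single nonzero entry, so amplitudes are pulled back along `σ`. Successive gates
thus compose in reverse order on classical states. -/
theorem act_ite {κ : Type} [Fintype κ] [DecidableEq κ] (w : κ ↪ V) (σ : Bits κ → Bits κ)
    (ψ : Amp V) (x : Bits V) :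
    act w (Matrix.of fun a b => if b = σ a then (1 : ℂ) else 0) ψ x =
      ψ (Function.extend w (σ (x ∘ w)) x) := by
  unfold act
  rw [Finset.sum_eq_single (σ (x ∘ w))]
  · rw [Matrix.of_apply, if_pos rfl, one_mul]
  · intro c _ hc
    rw [Matrix.of_apply, if_neg hc, zero_mul]
  · simp

/-- The diagonal gate that multiplies by `z` if the wire `u` has the value `pol` and the wire `v`
has the value `true`. -/
def ph (u v : V) (pol : Bool) (z : Circle) : Circ V ι :=
  if h : u ≠ v then
    [.gate 2 le_rfl (wire2 h)
      ⟨Matrix.diagonal fun a => if a 0 = pol ∧ a 1 = true then (z : ℂ) else 1, by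
        rw [Matrix.mem_unitaryGroup_iff, Matrix.star_eq_conjTranspose,
          Matrix.diagonal_conjTranspose, Matrix.diagonal_mul_diagonal, ← Matrix.diagonal_one]
        congr 1
        funext a
        have : (z : ℂ) * (starRingEnd ℂ) z = 1 := by
          rw [Complex.mul_conj, Complex.normSq_eq_norm_sq, Circle.norm_coe]; norm_num
        by_cases ha : a 0 = pol ∧ a 1 = true <;> simp [ha, this]⟩]
  else []

theorem run_ph {u v : V} (h : u ≠ v) (pol : Bool) (z : Circle) (ψ : Amp V) (x : Bits V) :
    run Q (ph u v pol z) ψ x = (if x u = pol ∧ x v = true then (z : ℂ) else 1) * ψ x := by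
  rw [ph, dif_pos h]
  exact act_diagonal (wire2 h) (fun a => if a 0 = pol ∧ a 1 = true then (z : ℂ) else 1) ψ x

/-- The classical map of the controlled negation. -/
def cxMap (a : Fin 2 → Bool) : Fin 2 → Bool := ![a 0, xor (a 0) (a 1)]

theorem cxMap_cxMap (a : Fin 2 → Bool) : cxMap (cxMap a) = a := by
  funext i
  fin_cases i
  · rfl
  · cases h0 : a 0 <;> cases h1 : a 1 <;> simp [cxMap, h0, h1]

/-- The controlled negation with control `u` and target `v`. -/
def cx (u v : V) : Circ V ι :=
  if h : u ≠ v then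
    [.gate 2 le_rfl (wire2 h)
      ⟨Matrix.of fun a b => if b = cxMap a then (1 : ℂ) else 0, by
        rw [Matrix.mem_unitaryGroup_iff]
        ext a b
        rw [Matrix.mul_apply, Finset.sum_eq_single (cxMap a)]
        · by_cases hab : a = b
          · subst hab
            rw [Matrix.one_apply_eq, Matrix.star_apply, Matrix.of_apply, if_pos rfl, star_one,
              mul_one]
          · have : cxMap a ≠ cxMap b := fun h => hab <| by
              rw [← cxMap_cxMap a, h, cxMap_cxMap]
            simp [hab, this, Matrix.star_apply, Matrix.of_apply]
        · intro c _ hc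
          rw [Matrix.of_apply, if_neg hc, zero_mul]
        · simp⟩]
  else []

theorem run_cx {u v : V} (h : u ≠ v) (ψ : Amp V) (x : Bits V) :
    run Q (cx u v) ψ x = ψ (Function.update x v (xor (x u) (x v))) := by
  rw [cx, dif_pos h]
  refine (act_ite (wire2 h) cxMap ψ x).trans ?_
  congr 1
  funext s
  by_cases hv : s = v
  · subst hv
    rw [Function.update_self]
    exact (wire2 h).injective.extend_apply _ x 1
  · rw [Function.update_of_ne hv]
    by_cases hu : s = u
    · subst hu
      exact (wire2 h).injective.extend_apply _ x 0
    · rw [Function.extend_apply']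
      rintro ⟨i, hi⟩
      fin_cases i
      · exact hu hi.symm
      · exact hv hi.symm

/-- The number `1/2` as a point of the unit interval. -/
def halfI : unitInterval := ⟨1 / 2, by norm_num, by norm_num⟩

/-- The unit complex number `i`. -/
def circleI : Circle := ⟨Complex.I, by simp [Submonoid.unitSphere]⟩

/-- The unit complex number `-1`. -/
def circleNeg : Circle := ⟨-1, by simp [Submonoid.unitSphere]⟩

/-- The negation of the wire `t` controlled by `u` having the value `true` and `v` having the
value `pol`, by gates on at most two wires. -/
def tof (u v : V) (pol : Bool) (t : V) : Circ V ι :=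
  rot t halfI ++ ph v t pol circleI ++ cx u v ++ ph v t pol circleI⁻¹ ++ cx u v ++
    ph u t true circleI ++ rot t halfI

/-- The classical map of `tof`. -/
def tofMap (u v : V) (pol : Bool) (t : V) (x : Bits V) : Bits V :=
  Function.update x t (xor (x u && (x v == pol)) (x t))

theorem tofMap_tofMap {u v t : V} (hut : u ≠ t) (hvt : v ≠ t) (pol : Bool) (x : Bits V) :
    tofMap u v pol t (tofMap u v pol t x) = x := by
  simp only [tofMap, Function.update_self, Function.update_of_ne hut, Function.update_of_ne hvt,
    Function.update_idem]
  rw [← Bool.xor_assoc, Bool.xor_self, Bool.false_xor, Function.update_eq_self]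

theorem length_rot (v : V) (t : unitInterval) : (rot v t : Circ V ι).length = 1 := rfl

theorem length_ph_le (u v : V) (pol : Bool) (z : Circle) : (ph u v pol z : Circ V ι).length ≤ 1 := by
  unfold ph; split <;> simp

theorem length_cx_le (u v : V) : (cx u v : Circ V ι).length ≤ 1 := by
  unfold cx; split <;> simp

theorem length_tof_le (u v : V) (pol : Bool) (t : V) : (tof u v pol t : Circ V ι).length ≤ 7 := by
  have h1 := length_ph_le (ι := ι) v t pol circleI
  have h2 := length_ph_le (ι := ι) v t pol circleI⁻¹
  have h3 := length_ph_le (ι := ι) u t true circleI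
  have h4 := length_cx_le (ι := ι) u v
  simp only [tof, List.length_append, length_rot]
  omega

theorem queries_rot (v : V) (t : unitInterval) : queries (rot v t : Circ V ι) = 0 := rfl

theorem queries_ph (u v : V) (pol : Bool) (z : Circle) : queries (ph u v pol z : Circ V ι) = 0 := by
  unfold ph; split <;> rfl

theorem queries_cx (u v : V) : queries (cx u v : Circ V ι) = 0 := by
  unfold cx; split <;> rfl

theorem queries_tof (u v : V) (pol : Bool) (t : V) : queries (tof u v pol t : Circ V ι) = 0 := by
  simp only [tof, queries_append, queries_rot, queries_ph, queries_cx]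

theorem amplitudeMatrix_half (a b : Bool) :
    amplitudeMatrix (halfI : ℝ) a b = (if a && b then -1 else 1) * (Real.sqrt (1 / 2) : ℂ) := by
  have : (1 : ℝ) - 1 / 2 = 1 / 2 := by norm_num
  cases a <;> cases b <;> simp only [amplitudeMatrix, halfI, this] <;> simp

theorem sqrt_half_mul_self : (Real.sqrt (1 / 2) : ℂ) * Real.sqrt (1 / 2) = 1 / 2 := by
  rw [← Complex.ofReal_mul, Real.mul_self_sqrt (by norm_num)]; norm_num

theorem run_tof {u v t : V} (huv : u ≠ v) (hut : u ≠ t) (hvt : v ≠ t) (pol : Bool) (ψ : Amp V) :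
    run Q (tof u v pol t) ψ = ψ ∘ tofMap u v pol t := by
  -- Between the Hadamard gates the operator is diagonal. For `t` true the phases are `i` if `v`
  -- equals `pol`, `i⁻¹` if `u ⊕ v` equals `pol`, and `i` if `u` is true. For `u` false the first
  -- two cancel; for `u` true the product is `i * i = -1` or `i⁻¹ * i = 1`. The Hadamard gates turn
  -- the sign flip into a negation.
  have mid : ∀ (χ : Amp V) (x : Bits V),
      run Q (ph v t pol circleI ++ cx u v ++ ph v t pol circleI⁻¹ ++ cx u v ++
        ph u t true circleI) χ x =
      (if x u && (x v == pol) && x t then -1 else 1) * χ x := by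
    intro χ x
    simp only [run_append, run_ph Q hut, run_ph Q hvt, run_cx Q huv,
      Function.update_self, Function.update_of_ne hvt.symm,
      Function.update_of_ne huv, Function.update_idem]
    rw [← Bool.xor_assoc, Bool.xor_self, Bool.false_xor, Function.update_eq_self]
    have hI : ((circleI : Circle) : ℂ) = Complex.I := rfl
    have hI' : ((circleI⁻¹ : Circle) : ℂ) = -Complex.I := by
      rw [Circle.coe_inv, hI, Complex.inv_I]
    cases x u <;> cases x v <;> cases x t <;> cases pol <;> simp [hI, hI', ← mul_assoc]
  have : (tof u v pol t : Circ V ι) = rot t halfI ++ ((ph v t pol circleI ++ cx u v ++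
      ph v t pol circleI⁻¹ ++ cx u v ++ ph u t true circleI) ++ rot t halfI) := by
    simp [tof]
  rw [this, run_append, run_append]
  funext x
  rw [run_rot, rotate]
  simp only [mid, Fintype.sum_bool, run_rot, rotate, Function.update_self,
    Function.update_of_ne hut, Function.update_of_ne hvt, Function.update_idem, Function.comp,
    tofMap]
  simp only [amplitudeMatrix_half]
  have hs := sqrt_half_mul_self
  generalize (Real.sqrt (1 / 2) : ℂ) = r at hs
  cases hu : x u <;> cases hv : x v <;> cases hp : pol <;> cases ht : x t <;> simp <;>
    first
      | linear_combination (2 * ψ (Function.update x t true)) * hs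
      | linear_combination (2 * ψ (Function.update x t false)) * hs
end Circuits

/-! ### Multiply controlled operations -/

section Controlled

variable {V ι : Type} [DecidableEq V] [Fintype ι] [DecidableEq ι]
variable (Q : Matrix (Bits ι) (Bits ι) ℂ)

/-- The operation `K` with additional controls: for every `(c, pol, a)` in the list, the wire `c`
has to have the value `pol`, and `a` is an auxiliary wire. The circuit `K v` is the operation
controlled by the single wire `v`. -/
def mc (u : V) : List (V × Bool × V) → (V → Circ V ι) → Circ V ι
  | [], K => K u
  | (c, pol, a) :: l, K => tof u c pol a ++ mc a l K ++ tof u c pol a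

/-- The value of the last auxiliary wire in `mc`. -/
def mcCond (u : V) : List (V × Bool × V) → Bits V → Bool
  | [], x => x u
  | (c, pol, a) :: l, x => mcCond a l (tofMap u c pol a x)

/-- The wires used in one step of `mc` are different. -/
def ChainOK (u : V) : List (V × Bool × V) → Prop
  | [] => True
  | (c, _, a) :: l => u ≠ c ∧ u ≠ a ∧ c ≠ a ∧ ChainOK a l

/-- By `hG` the operation `G` commutes with the Toffoli maps, so conjugating by them changes only
the condition. Nothing is assumed here about the values of the auxiliary wires. -/
theorem run_mc (safe : V → Prop) (K : V → Circ V ι) (G : Amp V → Amp V)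
    (hK : ∀ v, safe v → ∀ ψ x, run Q (K v) ψ x = if x v then G ψ x else ψ x)
    (hG : ∀ u c pol a, safe u → safe c → safe a → ∀ ψ x,
      G (ψ ∘ tofMap u c pol a) (tofMap u c pol a x) = G (ψ ∘ tofMap u c pol a ∘ tofMap u c pol a) x)
    (l : List (V × Bool × V)) (u : V) (hu : safe u) (hs : ∀ p ∈ l, safe p.1 ∧ safe p.2.2)
    (hl : ChainOK u l) (ψ : Amp V) (x : Bits V) :
    run Q (mc u l K) ψ x = if mcCond u l x then G ψ x else ψ x := by
  induction l generalizing u ψ x with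
  | nil => exact hK u hu ψ x
  | cons p l ih =>
    obtain ⟨c, pol, a⟩ := p
    obtain ⟨h1, h2, h3, h4⟩ := hl
    have hp := hs (c, pol, a) (by simp)
    have hid : tofMap u c pol a ∘ tofMap u c pol a = id :=
      funext fun y => tofMap_tofMap h2 h3 pol y
    rw [mc, run_append, run_append, run_tof Q h1 h2 h3, run_tof Q h1 h2 h3]
    simp only [Function.comp_apply]
    rw [ih a hp.2 (fun p hp => hs p (List.mem_cons_of_mem _ hp)) h4, mcCond,
      hG u c pol a hu hp.1 hp.2]
    simp [hid, Function.comp_apply, tofMap_tofMap h2 h3]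

/-- A Toffoli gate with target `false` stores exactly a conjunction. By `hd` and `hnd`, writing one
auxiliary wire disturbs neither the controls nor the other auxiliary wires. -/
theorem mcCond_eq (l : List (V × Bool × V)) (u : V) (x : Bits V)
    (hx : ∀ p ∈ l, x p.2.2 = false) (hnd : (l.map fun p => p.2.2).Nodup)
    (hd : ∀ p ∈ l, ∀ p' ∈ l, p.1 ≠ p'.2.2) :
    mcCond u l x = (x u && l.all fun p => x p.1 == p.2.1) := by
  induction l generalizing u x with
  | nil => simp [mcCond]
  | cons p l ih =>
    obtain ⟨c, pol, a⟩ := p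
    simp only [List.map_cons, List.nodup_cons, List.mem_map, not_exists, not_and] at hnd
    have hca : ∀ p ∈ l, p.1 ≠ a := fun p hp =>
      hd p (List.mem_cons_of_mem _ hp) (c, pol, a) (by simp)
    rw [mcCond, ih]
    · have h0 : x a = false := hx (c, pol, a) (by simp)
      have hall : (l.all fun p => tofMap u c pol a x p.1 == p.2.1) =
          l.all fun p => x p.1 == p.2.1 := by
        rw [Bool.eq_iff_iff, List.all_eq_true, List.all_eq_true]
        refine forall₂_congr fun p hp => ?_
        rw [tofMap, Function.update_of_ne (hca p hp)]
      rw [hall]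
      simp [tofMap, h0, Bool.and_assoc]
    · intro p hp
      rw [tofMap, Function.update_of_ne (fun h => hnd.1 p hp h)]
      exact hx p (List.mem_cons_of_mem _ hp)
    · exact hnd.2
    · exact fun p hp p' hp' => hd p (List.mem_cons_of_mem _ hp) p' (List.mem_cons_of_mem _ hp')

theorem length_mc_le (K : V → Circ V ι) (k : ℕ) (hK : ∀ v, (K v).length ≤ k)
    (l : List (V × Bool × V)) (u : V) : (mc u l K).length ≤ 14 * l.length + k := by
  induction l generalizing u with
  | nil => simpa [mc] using hK u
  | cons p l ih =>
    obtain ⟨c, pol, a⟩ := p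
    have h := ih a
    have h7 := length_tof_le (ι := ι) u c pol a
    simp only [mc, List.length_append, List.length_cons]
    omega

theorem queries_mc (K : V → Circ V ι) (hK : ∀ v, queries (K v) = 0)
    (l : List (V × Bool × V)) (u : V) : queries (mc u l K) = 0 := by
  induction l generalizing u with
  | nil => exact hK u
  | cons p l ih =>
    obtain ⟨c, pol, a⟩ := p
    simp only [mc, queries_append, queries_tof, ih a]

theorem chainOK_map {α : Type} (l : List α) (hl : l.Nodup) (c : α → V) (pol : α → Bool) (a : α → V)
    (u : V) (hu : ∀ i, u ≠ c i ∧ u ≠ a i) (hca : ∀ i j, c i ≠ a j)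
    (ha : Function.Injective a) : ChainOK u (l.map fun i => (c i, pol i, a i)) := by
  suffices h : ∀ (l : List α) (u : V), l.Nodup → (∀ i, u ≠ c i) → (∀ i ∈ l, u ≠ a i) →
      ChainOK u (l.map fun i => (c i, pol i, a i)) from
    h l u hl (fun i => (hu i).1) fun i _ => (hu i).2
  intro l
  induction l with
  | nil => exact fun _ _ _ _ => trivial
  | cons i l ih =>
    intro u hnd hc hua
    rw [List.nodup_cons] at hnd
    refine ⟨hc i, hua i (by simp), hca i i, ih _ hnd.2 (fun j => (hca j i).symm) ?_⟩
    intro j hj h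
    exact hnd.1 (ha h ▸ hj)

theorem mcCond_map {α : Type} (l : List α) (hl : l.Nodup) (c : α → V) (pol : α → Bool) (a : α → V)
    (u : V) (hca : ∀ i j, c i ≠ a j) (ha : Function.Injective a) (x : Bits V)
    (hx : ∀ i, x (a i) = false) :
    mcCond u (l.map fun i => (c i, pol i, a i)) x = (x u && l.all fun i => x (c i) == pol i) := by
  rw [mcCond_eq]
  · simp [List.all_map, Function.comp_def]
  · simp only [List.mem_map, forall_exists_index, and_imp]
    rintro p i _ rfl
    exact hx i
  · rw [List.map_map]
    exact hl.map ha
  · simp only [List.mem_map, forall_exists_index, and_imp]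
    rintro p i _ rfl p' j _ rfl
    exact hca i j

/-- `amplitudeMatrix 1` is `diag(1, -1)`, so the same gate family contains the Hadamard gate (`1/2`)
and the phase flip (`1`). -/
theorem run_rot_one (v : V) (ψ : Amp V) (x : Bits V) :
    run Q (rot v 1) ψ x = if x v then -ψ x else ψ x := by
  rw [run_rot, rotate]
  have h : ψ x = ψ (Function.update x v (x v)) := by rw [Function.update_eq_self]
  rw [h]
  cases hx : x v <;> simp [amplitudeMatrix]

/-- A multiply controlled phase flip is diagonal. -/
theorem run_mc_rot_one (l : List (V × Bool × V)) (u : V) (hl : ChainOK u l) (ψ : Amp V)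
    (x : Bits V) :
    run Q (mc u l fun v => rot v 1) ψ x = if mcCond u l x then -ψ x else ψ x := by
  refine run_mc Q (fun _ => True) _ (fun ψ => -ψ) (fun v _ ψ x => ?_) ?_ l u trivial
    (fun _ _ => ⟨trivial, trivial⟩) hl ψ x
  · rw [run_rot_one]; rfl
  · intros; rfl

end Controlled

/-! ### The quantum walk -/

section Walk

variable {P S B ι : Type} [DecidableEq P] [DecidableEq S] [DecidableEq B] [Fintype S] [Fintype B]
  [Fintype ι] [DecidableEq ι]

/-- The product of a state of the phase register `P` and a state of the other wires. -/
def tens {P R : Type} (α : Amp P) (e : Amp R) : Amp (P ⊕ R) :=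
  fun x => α (x ∘ Sum.inl) * e (x ∘ Sum.inr)

theorem tens_add {P R : Type} (α : Amp P) (e f : Amp R) : tens α (e + f) = tens α e + tens α f :=
  funext fun _ => mul_add ..

theorem tens_smul {P R : Type} (a : ℂ) (α : Amp P) (e : Amp R) :
    tens α (a • e) = a • tens α e := by
  funext x; simp only [tens, Pi.smul_apply, smul_eq_mul]; ring

theorem update_inl_comp_inl {P R : Type} [DecidableEq P] [DecidableEq R] (x : Bits (P ⊕ R)) (p : P)
    (b : Bool) : Function.update x (Sum.inl p) b ∘ Sum.inl = Function.update (x ∘ Sum.inl) p b :=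
  Function.update_comp_eq_of_injective x Sum.inl_injective p b

theorem update_inr_comp_inr {P R : Type} [DecidableEq P] [DecidableEq R] (x : Bits (P ⊕ R)) (r : R)
    (b : Bool) : Function.update x (Sum.inr r) b ∘ Sum.inr = Function.update (x ∘ Sum.inr) r b :=
  Function.update_comp_eq_of_injective x Sum.inr_injective r b

theorem update_inl_comp_inr {P R : Type} [DecidableEq P] [DecidableEq R] (x : Bits (P ⊕ R)) (p : P)
    (b : Bool) : Function.update x (Sum.inl p) b ∘ Sum.inr = x ∘ Sum.inr := by
  funext r; simp

theorem update_inr_comp_inl {P R : Type} [DecidableEq P] [DecidableEq R] (x : Bits (P ⊕ R)) (r : R)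
    (b : Bool) : Function.update x (Sum.inr r) b ∘ Sum.inl = x ∘ Sum.inl := by
  funext r; simp

theorem rotate_inr_tens {P R : Type} [DecidableEq P] [DecidableEq R] (r : R) (t : ℝ) (α : Amp P)
    (e : Amp R) : rotate (Sum.inr r) t (tens α e) = tens α (rotate r t e) := by
  funext x
  simp only [rotate, tens, update_inr_comp_inr, update_inr_comp_inl, Finset.mul_sum]
  exact Finset.sum_congr rfl fun b _ => by rw [Function.comp_apply]; ring

theorem rotate_inl_tens {P R : Type} [DecidableEq P] [DecidableEq R] (p : P) (t : ℝ) (α : Amp P)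
    (e : Amp R) : rotate (Sum.inl p) t (tens α e) = tens (rotate p t α) e := by
  funext x
  simp only [rotate, tens, update_inl_comp_inr, update_inl_comp_inl, Finset.sum_mul]
  exact Finset.sum_congr rfl fun b _ => by rw [Function.comp_apply]; ring

theorem rotate_add_smul {V : Type} [DecidableEq V] (v : V) (t : ℝ) (a : ℂ) (ψ φ : Amp V) :
    rotate v t (a • ψ + φ) = a • rotate v t ψ + rotate v t φ := by
  funext x
  simp only [rotate, Fintype.sum_bool, Pi.add_apply, Pi.smul_apply, smul_eq_mul]
  ring

/-- The states that are supported on the classical states with values `β` on the wires `B`. -/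
def Clean (β : Bits B) (e : Amp (S ⊕ B)) : Prop := ∀ x, x ∘ Sum.inr ≠ β → e x = 0

/-- One-qubit rotations of the wires in the list. -/
def prepFun (t : S → unitInterval) (L : List S) (e : Amp (S ⊕ B)) : Amp (S ⊕ B) :=
  L.foldl (fun e s => rotate (Sum.inl s) (t s) e) e

/-- One-qubit rotations of the wires in the list, as a circuit. -/
def prep (t : S → unitInterval) (L : List S) : Circ (P ⊕ (S ⊕ B)) ι :=
  L.flatMap fun s => rot (Sum.inr (Sum.inl s)) (t s)

theorem length_prep (t : S → unitInterval) (L : List S) :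
    (prep t L : Circ (P ⊕ (S ⊕ B)) ι).length = L.length := by
  simp [prep, List.length_flatMap, length_rot]

theorem queries_prep (t : S → unitInterval) (L : List S) :
    queries (prep t L : Circ (P ⊕ (S ⊕ B)) ι) = 0 := by
  induction L with
  | nil => rfl
  | cons s L ih =>
    have : (prep t (s :: L) : Circ (P ⊕ (S ⊕ B)) ι) =
      rot (Sum.inr (Sum.inl s)) (t s) ++ prep t L := rfl
    rw [this, queries_append, ih, queries_rot]

variable (Q : Matrix (Bits ι) (Bits ι) ℂ)

theorem run_prep (t : S → unitInterval) (L : List S) (α : Amp P) (e : Amp (S ⊕ B)) :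
    run Q (prep t L) (tens α e) = tens α (prepFun t L e) := by
  induction L generalizing e with
  | nil => rfl
  | cons s L ih =>
    have : (prep t (s :: L) : Circ (P ⊕ (S ⊕ B)) ι) =
      rot (Sum.inr (Sum.inl s)) (t s) ++ prep t L := rfl
    rw [this, run_append, run_rot, rotate_inr_tens, ih]
    rfl

theorem prepFun_append (t : S → unitInterval) (L M : List S) (e : Amp (S ⊕ B)) :
    prepFun t (L ++ M) e = prepFun t M (prepFun t L e) := by simp [prepFun]

/-- Every rotation is an involution, so reversing the list inverts the preparation. -/
theorem prepFun_prepFun_reverse (t : S → unitInterval) (L : List S) (e : Amp (S ⊕ B)) :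
    prepFun t L (prepFun t L.reverse e) = e := by
  induction L generalizing e with
  | nil => rfl
  | cons s L ih =>
    rw [List.reverse_cons, prepFun_append]
    change prepFun t L (rotate _ _ (rotate _ _ (prepFun t L.reverse e))) = e
    rw [rotate_rotate _ (t s).2.1 (t s).2.2, ih]

theorem prepFun_dot (t : S → unitInterval) (L : List S) (e f : Amp (S ⊕ B)) :
    prepFun t L e ⬝ᵥ f = e ⬝ᵥ prepFun t L.reverse f := by
  induction L generalizing e with
  | nil => rfl
  | cons s L ih =>
    rw [List.reverse_cons, prepFun_append]
    change prepFun t L (rotate _ _ e) ⬝ᵥ f = e ⬝ᵥ rotate _ _ (prepFun t L.reverse f)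
    rw [ih, rotate_dot]

theorem prepFun_add_smul (t : S → unitInterval) (L : List S) (a : ℂ) (e f : Amp (S ⊕ B)) :
    prepFun t L (a • e + f) = a • prepFun t L e + prepFun t L f := by
  induction L generalizing e f with
  | nil => rfl
  | cons s L ih =>
    change prepFun t L (rotate _ _ (a • e + f)) = _
    rw [rotate_add_smul, ih]
    rfl

theorem Clean.prepFun {β : Bits B} (t : S → unitInterval) (L : List S) {e : Amp (S ⊕ B)}
    (he : Clean β e) : Clean β (prepFun t L e) := by
  induction L generalizing e with
  | nil => exact he
  | cons s L ih =>
    refine ih fun x hx => ?_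
    simp only [rotate]
    refine Finset.sum_eq_zero fun b _ => ?_
    rw [he _ (by rwa [update_inl_comp_inr]), mul_zero]

/-- The initial classical state: all wires in `S` are `true`. -/
def startBits (S : Type) {B : Type} (β : Bits B) : Bits (S ⊕ B) := Sum.elim (fun _ => true) β

/-- The classical state `b` as a vector. -/
def delta {V : Type} [Fintype V] (b : Bits V) : Amp V := by
  classical exact fun a => if a = b then 1 else 0

/-- The product state prepared by rotations from the initial classical state. -/
def psi (t : S → unitInterval) (β : Bits B) : Amp (S ⊕ B) :=
  prepFun t Finset.univ.toList (delta (startBits S β))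

theorem clean_delta (β : Bits B) : Clean β (delta (startBits S β)) := by
  intro x hx
  unfold delta
  rw [if_neg]
  rintro rfl
  exact hx rfl

theorem clean_psi (t : S → unitInterval) (β : Bits B) : Clean β (psi t β) :=
  (clean_delta β).prepFun t _

theorem delta_dot {V : Type} [Fintype V] [DecidableEq V] (b : Bits V) (f : Amp V) :
    delta b ⬝ᵥ f = f b := by
  simp [dotProduct, delta]

theorem psi_dot (t : S → unitInterval) (β : Bits B) (e : Amp (S ⊕ B)) :
    psi t β ⬝ᵥ e = prepFun t Finset.univ.toList.reverse e (startBits S β) := by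
  rw [psi, prepFun_dot, delta_dot]

theorem psi_dot_psi (t : S → unitInterval) (β : Bits B) : psi t β ⬝ᵥ psi t β = 1 := by
  have h := prepFun_prepFun_reverse t (Finset.univ : Finset S).toList.reverse
    (delta (startBits S β))
  rw [List.reverse_reverse] at h
  rw [psi_dot, psi, h]
  simp [delta]

/-- All wires start as `true`, so the `true` columns of the matrices appear, and wire `s` is `true`
with probability `t s`. -/
theorem psi_apply (t : S → unitInterval) (β : Bits B) (x : Bits (S ⊕ B)) :
    psi t β x = if x ∘ Sum.inr = β then ∏ s, amplitudeMatrix (t s) (x (Sum.inl s)) true else 0 := by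
  -- The state after the wires in `D` have been rotated; the other wires are still `true`.
  let F : Finset S → Amp (S ⊕ B) := fun D x => if x ∘ Sum.inr = β then
    ∏ s, (if s ∈ D then amplitudeMatrix (t s) (x (Sum.inl s)) true else
      if x (Sum.inl s) = true then 1 else 0) else 0
  have step : ∀ D s, s ∉ D → rotate (Sum.inl s) (t s) (F D) = F (insert s D) := by
    intro D s hs
    funext x
    by_cases hx : x ∘ Sum.inr = β
    · simp only [rotate, F, update_inl_comp_inr, hx, if_true]
      have hrest : ∀ b, ∏ s' ∈ ({s}ᶜ : Finset S), (if s' ∈ D then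
          amplitudeMatrix (t s') (Function.update x (Sum.inl s) b (Sum.inl s')) true else
          if Function.update x (Sum.inl s) b (Sum.inl s') = true then 1 else 0) =
          ∏ s' ∈ ({s}ᶜ : Finset S), (if s' ∈ insert s D then
          amplitudeMatrix (t s') (x (Sum.inl s')) true else
          if x (Sum.inl s') = true then 1 else 0) := by
        intro b
        refine Finset.prod_congr rfl fun s' hs' => ?_
        have hne : s' ≠ s := by simpa using hs'
        rw [Function.update_of_ne (by simpa using hne)]
        simp [hne]
      simp only [Fintype.sum_bool]
      rw [Fintype.prod_eq_mul_prod_compl s, Fintype.prod_eq_mul_prod_compl s,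
        Fintype.prod_eq_mul_prod_compl s, hrest, hrest]
      simp [hs]
    · simp only [rotate, F, update_inl_comp_inr, hx, if_false, mul_zero, Finset.sum_const_zero]
  have main : ∀ (L : List S) (D : Finset S), L.Nodup → (∀ s ∈ L, s ∉ D) →
      prepFun t L (F D) = F (D ∪ L.toFinset) := by
    intro L
    induction L with
    | nil => intro D _ _; simp [prepFun]
    | cons s L ih =>
      intro D hnd hD
      rw [List.nodup_cons] at hnd
      change prepFun t L (rotate _ _ (F D)) = _
      rw [step D s (hD s (by simp)), ih _ hnd.2]
      · congr 1
        ext; simp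
      · intro s' hs' h
        rcases Finset.mem_insert.1 h with h | h
        · exact hnd.1 (h ▸ hs')
        · exact hD s' (List.mem_cons_of_mem _ hs') h
  have h0 : delta (startBits S β) = F ∅ := by
    funext x
    simp only [delta, F, Finset.notMem_empty, if_false]
    by_cases hx : x ∘ Sum.inr = β
    · rw [if_pos hx]
      by_cases h1 : ∀ s, x (Sum.inl s) = true
      · rw [if_pos, Finset.prod_eq_one fun s _ => if_pos (h1 s)]
        funext v
        rcases v with s | b
        · exact h1 s
        · exact congrFun hx b
      · rw [if_neg fun h => h1 fun s => by rw [h]; rfl]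
        push Not at h1
        obtain ⟨s, hs⟩ := h1
        exact (Finset.prod_eq_zero (Finset.mem_univ s) (if_neg hs)).symm
    · rw [if_neg hx, if_neg]
      rintro rfl
      exact hx rfl
  rw [psi, h0, main _ _ (Finset.nodup_toList _) (by simp)]
  simp [F]

theorem star_psi (t : S → unitInterval) (β : Bits B) (x : Bits (S ⊕ B)) :
    (starRingEnd ℂ) (psi t β x) = psi t β x := by
  rw [psi_apply]
  split
  · rw [map_prod]
    exact Finset.prod_congr rfl fun s _ => star_amplitudeMatrix _ _ _
  · exact map_zero _

/-- The part of the state `α` on which the wire `p` has the value `b`. -/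
def sel (p : P) (b : Bool) (α : Amp P) : Amp P := fun y => if y p = b then α y else 0

theorem sel_sel (p : P) (b c : Bool) (α : Amp P) :
    sel p b (sel p c α) = if b = c then sel p b α else 0 := by
  funext y
  by_cases h : b = c
  · subst h; by_cases hy : y p = b <;> simp [sel, hy]
  · by_cases hy : y p = b
    · simp [sel, hy, h]
    · simp [sel, hy, h]

/-- The reflection about `psi t β`, controlled by the wire `p` of the phase register. -/
def cR (t : S → unitInterval) (anc : S → B) (p : P) : Circ (P ⊕ (S ⊕ B)) ι :=
  prep t Finset.univ.toList.reverse ++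
    mc (Sum.inl p) (Finset.univ.toList.map fun s =>
      (Sum.inr (Sum.inl s), true, Sum.inr (Sum.inr (anc s)))) (fun v => rot v 1) ++
    rot (Sum.inl p) 1 ++ prep t Finset.univ.toList

theorem length_cR_le (t : S → unitInterval) (anc : S → B) (p : P) :
    (cR t anc p : Circ (P ⊕ (S ⊕ B)) ι).length ≤ 16 * Fintype.card S + 2 := by
  have h := length_mc_le (ι := ι) (fun v => rot v 1) 1 (fun v => le_rfl)
    ((Finset.univ : Finset S).toList.map fun s =>
      (Sum.inr (Sum.inl s), true, Sum.inr (Sum.inr (anc s)))) (Sum.inl p : P ⊕ (S ⊕ B))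
  simp only [cR, List.length_append, length_prep, length_rot, List.length_reverse,
    List.length_map, Finset.length_toList, Finset.card_univ] at h ⊢
  omega

theorem queries_cR (t : S → unitInterval) (anc : S → B) (p : P) :
    queries (cR t anc p : Circ (P ⊕ (S ⊕ B)) ι) = 0 := by
  simp only [cR, queries_append, queries_prep, queries_rot]
  rw [queries_mc _ fun v => queries_rot _ _]

/-- The sign flip of the start state, conjugated by the preparation, is `1 - 2ψψᵀ`; the extra flip
of `p` supplies the factor `-1`. The preparation needs no control, since it cancels with its inverse
when `p` is `false`. `Clean` keeps the auxiliary wires `false`. -/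
theorem run_cR (t : S → unitInterval) (anc : S → B) (hanc : Function.Injective anc) (β : Bits B)
    (hβ : ∀ s, β (anc s) = false) (p : P) (α : Amp P) (e : Amp (S ⊕ B)) (he : Clean β e) :
    run Q (cR t anc p) (tens α e) =
      tens (sel p true α) ((2 * (psi t β ⬝ᵥ e)) • psi t β + (-1 : ℂ) • e) +
        tens (sel p false α) e := by
  set f := prepFun t Finset.univ.toList.reverse e with hf
  have hfc : Clean β f := he.prepFun t _
  have mid : run Q (mc (Sum.inl p) (Finset.univ.toList.map fun s =>
      (Sum.inr (Sum.inl s), true, Sum.inr (Sum.inr (anc s)))) (fun v => rot v 1) ++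
      rot (Sum.inl p) 1) (tens α f) =
      tens (sel p true α) ((2 * (psi t β ⬝ᵥ e)) • delta (startBits S β) + (-1 : ℂ) • f) +
        tens (sel p false α) f := by
    funext x
    rw [run_append, run_rot_one, run_mc_rot_one Q _ _ (chainOK_map _ (Finset.nodup_toList _) _ _ _ _
      (by simp) (by simp) (by intro a b h; simpa [hanc.eq_iff] using h))]
    rw [psi_dot, ← hf]
    by_cases hx : (x ∘ Sum.inr) ∘ Sum.inr = β
    · rw [mcCond_map _ (Finset.nodup_toList _) _ _ _ _ (by simp)
        (by intro a b h; simpa [hanc.eq_iff] using h) _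
        (fun s => by rw [← hβ s, ← hx]; rfl)]
      by_cases hp : x (Sum.inl p) = true
      · by_cases hs : ∀ s, x (Sum.inr (Sum.inl s)) = true
        · have hxs : x ∘ Sum.inr = startBits S β := by
            funext v
            rcases v with s | b
            · exact hs s
            · exact congrFun hx b
          simp [hp, hs, tens, sel, hxs, delta]
          left
          ring
        · have hxs : x ∘ Sum.inr ≠ startBits S β := fun h => hs fun s => by
            have := congrFun h (Sum.inl s)
            simpa [startBits] using this
          have hs' := hs
          push Not at hs'
          simp [hp, hs, tens, sel, hxs, delta]
      · simp [hp, tens, sel]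
    · have h0 : f (x ∘ Sum.inr) = 0 := hfc _ hx
      have h1 : delta (startBits S β) (x ∘ Sum.inr) = 0 := clean_delta β _ hx
      simp [tens, h0, h1]
  rw [cR, List.append_assoc (prep t _), run_append, run_append, run_prep, ← hf, mid, run_add,
    run_prep, run_prep, prepFun_add_smul, hf]
  have hneg : prepFun t Finset.univ.toList ((-1 : ℂ) • prepFun t Finset.univ.toList.reverse e) =
      (-1 : ℂ) • e := by
    have h := prepFun_add_smul t Finset.univ.toList (-1 : ℂ)
      (prepFun t Finset.univ.toList.reverse e) ((0 : ℂ) • prepFun t Finset.univ.toList.reverse e)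
    have h0 := prepFun_add_smul t Finset.univ.toList (-1 : ℂ)
      (prepFun t Finset.univ.toList.reverse e) (prepFun t Finset.univ.toList.reverse e)
    rw [zero_smul, add_zero] at h
    rw [h, prepFun_prepFun_reverse]
    have hz : prepFun t Finset.univ.toList (0 : Amp (S ⊕ B)) = 0 := by
      have e0 : (-1 : ℂ) • prepFun t Finset.univ.toList.reverse e +
        prepFun t Finset.univ.toList.reverse e = 0 := by simp
      rw [e0] at h0
      rw [h0]; simp
    rw [hz, add_zero]
  rw [hneg, prepFun_prepFun_reverse]
  rfl

end Walk

/-! ### Eigenvectors of the walk -/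

section Eigen

variable {P S B ι : Type} [DecidableEq P] [DecidableEq S] [DecidableEq B] [Fintype S] [Fintype B]
  [Fintype ι] [DecidableEq ι]

/-- The circuits `cU p` implement, controlled by the wire `p`, a reflection which exchanges
`psi t β` and the real vector `φ`, and `lam` is the inner product of these two unit vectors. -/
structure IsReflection (Q : Matrix (Bits ι) (Bits ι) ℂ) (t : S → unitInterval) (β : Bits B)
    (cU : P → Circ (P ⊕ (S ⊕ B)) ι) (φ : Amp (S ⊕ B)) (lam : ℝ) : Prop where
  clean : Clean β φ
  star : ∀ x, (starRingEnd ℂ) (φ x) = φ x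
  dot_self : φ ⬝ᵥ φ = 1
  dot : psi t β ⬝ᵥ φ = lam
  run_psi : ∀ p α, run Q (cU p) (tens α (psi t β)) =
    tens (sel p true α) φ + tens (sel p false α) (psi t β)
  run_phi : ∀ p α, run Q (cU p) (tens α φ) =
    tens (sel p true α) (psi t β) + tens (sel p false α) φ

/-- One step of the walk, controlled by the wire `p`. -/
def cW (t : S → unitInterval) (anc : S → B) (cU : P → Circ (P ⊕ (S ⊕ B)) ι) (p : P) :
    Circ (P ⊕ (S ⊕ B)) ι :=
  cU p ++ cR t anc p

/-- The circuits `cV p` multiply by `μ` on the vector `e`, controlled by the wire `p`. -/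
def IsEigen {P R : Type} (Q : Matrix (Bits ι) (Bits ι) ℂ)
    (cV : P → Circ (P ⊕ R) ι) (μ : ℂ) (e : Amp R) : Prop :=
  ∀ p α, run Q (cV p) (tens α e) = tens (fun y => (if y p then μ else 1) * α y) e

theorem tens_zero {P R : Type} (e : Amp R) : tens (0 : Amp P) e = 0 := by
  funext x; simp [tens]

variable {Q : Matrix (Bits ι) (Bits ι) ℂ} {t : S → unitInterval} {β : Bits B}
  {cU : P → Circ (P ⊕ (S ⊕ B)) ι} {φ : Amp (S ⊕ B)} {lam : ℝ} {anc : S → B}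

/-- In the plane of `ψ` and `φ` the walk is `ψ ↦ 2λψ - φ`, `φ ↦ ψ`, with trace `2λ` and determinant
`1`. -/
theorem IsReflection.run_cW (h : IsReflection Q t β cU φ lam) (hanc : Function.Injective anc)
    (hβ : ∀ s, β (anc s) = false) (p : P) (α : Amp P) (a b : ℂ) :
    run Q (cW t anc cU p) (tens α (a • psi t β + b • φ)) =
      tens (sel p true α) (a • ((2 * (lam : ℂ)) • psi t β + (-1 : ℂ) • φ) + b • psi t β) +
        tens (sel p false α) (a • psi t β + b • φ) := by
  have e1 : (2 * (1 : ℂ)) • psi t β + (-1 : ℂ) • psi t β = psi t β := by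
    module
  have key1 : run Q (cW t anc cU p) (tens α (psi t β)) =
      tens (sel p true α) ((2 * (lam : ℂ)) • psi t β + (-1 : ℂ) • φ) +
        tens (sel p false α) (psi t β) := by
    rw [cW, run_append, h.run_psi, run_add, run_cR Q t anc hanc β hβ p _ _ h.clean,
      run_cR Q t anc hanc β hβ p _ _ (clean_psi t β), h.dot]
    simp only [sel_sel, psi_dot_psi, e1]
    simp [tens_zero]
  have key2 : run Q (cW t anc cU p) (tens α φ) =
      tens (sel p true α) (psi t β) + tens (sel p false α) φ := by
    rw [cW, run_append, h.run_phi, run_add, run_cR Q t anc hanc β hβ p _ _ h.clean,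
      run_cR Q t anc hanc β hβ p _ _ (clean_psi t β), h.dot]
    simp only [sel_sel, psi_dot_psi, e1]
    simp [tens_zero]
  rw [tens_add, tens_smul, tens_smul, run_add, run_smul, run_smul, key1, key2]
  simp only [tens_add, tens_smul]
  module

theorem IsReflection.isEigen (h : IsReflection Q t β cU φ lam) (hanc : Function.Injective anc)
    (hβ : ∀ s, β (anc s) = false) {a b μ : ℂ}
    (hμ : a • ((2 * (lam : ℂ)) • psi t β + (-1 : ℂ) • φ) + b • psi t β =
      μ • (a • psi t β + b • φ)) :
    IsEigen Q (cW t anc cU) μ (a • psi t β + b • φ) := by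
  intro p α
  rw [h.run_cW hanc hβ, hμ, tens_smul]
  funext x
  simp only [tens, sel, Pi.add_apply, Pi.smul_apply, smul_eq_mul, Function.comp_apply]
  by_cases hx : x (Sum.inl p) = true
  · simp only [hx, if_true, reduceCtorEq, if_false, zero_mul, add_zero]
    ring
  · simp [hx]

theorem IsReflection.sq_le_one (h : IsReflection Q t β cU φ lam) : lam ^ 2 ≤ 1 := by
  have hre : ∀ z : ℂ, (starRingEnd ℂ) z = z → ((z.re : ℝ) : ℂ) = z := fun z hz =>
    Complex.conj_eq_iff_re.1 hz
  have h1 : (∑ x, (psi t β x).re ^ 2) = 1 := by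
    have := psi_dot_psi t β
    simp only [dotProduct] at this
    apply Complex.ofReal_injective
    push_cast
    rw [← this]
    exact Finset.sum_congr rfl fun x _ => by rw [hre _ (star_psi t β x), sq]
  have h2 : (∑ x, (φ x).re ^ 2) = 1 := by
    have := h.dot_self
    simp only [dotProduct] at this
    apply Complex.ofReal_injective
    push_cast
    rw [← this]
    exact Finset.sum_congr rfl fun x _ => by rw [hre _ (h.star x), sq]
  have h3 : (∑ x, (psi t β x).re * (φ x).re) = lam := by
    have := h.dot
    simp only [dotProduct] at this
    apply Complex.ofReal_injective
    push_cast
    rw [← this]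
    exact Finset.sum_congr rfl fun x _ => by rw [hre _ (star_psi t β x), hre _ (h.star x)]
  have := Finset.sum_mul_sq_le_sq_mul_sq Finset.univ (fun x => (psi t β x).re) fun x => (φ x).re
  rwa [h1, h2, h3, one_mul] at this

/-- Equality in the Cauchy–Schwarz inequality: `‖φ - λψ‖² = 1 - λ²`. -/
theorem IsReflection.eq_smul (h : IsReflection Q t β cU φ lam) (hl : lam ^ 2 = 1) :
    φ = (lam : ℂ) • psi t β := by
  have hl' : (lam : ℂ) ^ 2 = 1 := by exact_mod_cast hl
  have hz : ∑ x, (φ x - lam * psi t β x) * (φ x - lam * psi t β x) = 0 := by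
    have e : ∀ x, (φ x - lam * psi t β x) * (φ x - lam * psi t β x) =
        φ x * φ x - 2 * lam * (psi t β x * φ x) + lam ^ 2 * (psi t β x * psi t β x) := fun x => by
      ring
    simp only [e, Finset.sum_add_distrib, Finset.sum_sub_distrib, ← Finset.mul_sum]
    have h1 := h.dot_self
    have h2 := psi_dot_psi t β
    have h3 := h.dot
    simp only [dotProduct] at h1 h2 h3
    rw [h1, h2, h3]
    linear_combination -hl'
  have hn : ∑ x, ‖φ x - lam * psi t β x‖ ^ 2 = 0 := by
    apply Complex.ofReal_injective
    push_cast
    rw [← hz]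
    refine Finset.sum_congr rfl fun x _ => ?_
    rw [← Complex.mul_conj', map_sub, map_mul, h.star, star_psi, Complex.conj_ofReal]
  funext x
  have := (Finset.sum_eq_zero_iff_of_nonneg fun x _ => by positivity).1 hn x (Finset.mem_univ x)
  have h0 : φ x - lam * psi t β x = 0 := by simpa using this
  simpa using sub_eq_zero.1 h0

/-- The eigenvalues `μ`, `ν` are the roots of `z² - 2λz + 1`. The eigenvectors `μψ - φ` and `φ - νψ`
add up to `(μ - ν)ψ`, and their orthogonality reduces to the equation satisfied by `ν`. -/
theorem IsReflection.exists_eigen (h : IsReflection Q t β cU φ lam) (hanc : Function.Injective anc)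
    (hβ : ∀ s, β (anc s) = false) :
    ∃ θ : ℝ, Real.cos θ = lam ∧ ∃ e f : Amp (S ⊕ B), psi t β = e + f ∧
      ∑ x, (starRingEnd ℂ) (e x) * f x = 0 ∧ Clean β e ∧ Clean β f ∧
      IsEigen Q (cW t anc cU) (Complex.exp (θ * Complex.I)) e ∧
      IsEigen Q (cW t anc cU) (Complex.exp ((-θ : ℝ) * Complex.I)) f := by
  have hl := h.sq_le_one
  have hcos : Real.cos (Real.arccos lam) = lam :=
    Real.cos_arccos (by nlinarith) (by nlinarith)
  refine ⟨Real.arccos lam, hcos, ?_⟩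
  set θ := Real.arccos lam
  set μ := Complex.exp (θ * Complex.I) with hμ
  set ν := Complex.exp ((-θ : ℝ) * Complex.I) with hν
  have hμν : μ * ν = 1 := by
    rw [hμ, hν, ← Complex.exp_add]; simp
  have hsum : μ + ν = 2 * lam := by
    rw [hμ, hν, ← hcos, Complex.ofReal_cos, Complex.two_cos]; simp
  have hconj : (starRingEnd ℂ) μ = ν := by
    rw [hμ, hν, ← Complex.exp_conj]; simp
  -- A double root means `λ = ±1`. The plane is then a line, `ψ` is itself an eigenvector, and the
  -- second part is zero.
  by_cases hd : μ = ν
  · have hl1 : lam ^ 2 = 1 := by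
      have : (lam : ℂ) ^ 2 = 1 := by
        rw [← hd] at hsum hμν
        have h2 : (lam : ℂ) = μ := by linear_combination -hsum / 2
        rw [h2, sq, hμν]
      exact_mod_cast this
    have hphi := h.eq_smul hl1
    have hlm : (lam : ℂ) = μ := by rw [← hd] at hsum; linear_combination -hsum / 2
    refine ⟨psi t β, 0, by simp, by simp, clean_psi t β, fun _ _ => rfl, ?_, ?_⟩
    · have := h.isEigen (anc := anc) hanc hβ (a := 1) (b := 0) (μ := μ) (by
        rw [hphi, ← hlm]; module)
      simpa using this
    · have := h.isEigen (anc := anc) hanc hβ (a := 0) (b := 0) (μ := ν) (by simp)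
      simpa using this
  · have hne : μ - ν ≠ 0 := sub_ne_zero.2 hd
    have hc : ∀ a b : ℂ, Clean β (a • psi t β + b • φ) := fun a b x hx => by
      simp [clean_psi t β x hx, h.clean x hx]
    refine ⟨(μ / (μ - ν)) • psi t β + (-1 / (μ - ν)) • φ,
      (-ν / (μ - ν)) • psi t β + (1 / (μ - ν)) • φ, ?_, ?_, hc _ _, hc _ _, ?_, ?_⟩
    · have : psi t β = ((μ / (μ - ν)) + (-ν / (μ - ν))) • psi t β := by
        rw [← add_div, ← sub_eq_add_neg, div_self hne, one_smul]
      conv_lhs => rw [this]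
      module
    · have h1 := h.dot_self
      have h2 := psi_dot_psi t β
      have h3 := h.dot
      simp only [dotProduct] at h1 h2 h3
      have hcν : (starRingEnd ℂ) ν = μ := by rw [← hconj, Complex.conj_conj]
      have e : ∀ x, (starRingEnd ℂ) (((μ / (μ - ν)) • psi t β + (-1 / (μ - ν)) • φ) x) *
          ((-ν / (μ - ν)) • psi t β + (1 / (μ - ν)) • φ) x =
          (1 / ((ν - μ) * (μ - ν))) * (-ν * ν * (psi t β x * psi t β x) +
            (2 * ν) * (psi t β x * φ x) - φ x * φ x) := by
        intro x
        have hne' : ν - μ ≠ 0 := sub_ne_zero.2 (Ne.symm hd)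
        simp only [Pi.add_apply, Pi.smul_apply, smul_eq_mul, map_add, map_mul, map_div₀, map_sub,
          map_neg, map_one, h.star, star_psi, hconj, hcν]
        field_simp
        ring
      simp only [e, ← Finset.mul_sum, Finset.sum_sub_distrib, Finset.sum_add_distrib, h1, h2, h3]
      have : -ν * ν * 1 + 2 * ν * (lam : ℂ) - 1 = 0 := by
        linear_combination (-ν) * hsum + hμν
      rw [this, mul_zero]
    · apply h.isEigen hanc hβ
      have e1 : μ / (μ - ν) * (2 * lam) + -1 / (μ - ν) = μ * (μ / (μ - ν)) := by
        field_simp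
        linear_combination (-μ) * hsum + hμν
      have e2 : μ / (μ - ν) * (-1) = μ * (-1 / (μ - ν)) := by ring
      rw [smul_add, smul_smul, smul_smul, smul_add, smul_smul, smul_smul, ← e1, ← e2]
      module
    · apply h.isEigen hanc hβ
      have e1 : -ν / (μ - ν) * (2 * lam) + 1 / (μ - ν) = ν * (-ν / (μ - ν)) := by
        field_simp
        linear_combination (ν) * hsum - hμν
      have e2 : -ν / (μ - ν) * (-1) = ν * (1 / (μ - ν)) := by ring
      rw [smul_add, smul_smul, smul_smul, smul_add, smul_smul, smul_smul, ← e1, ← e2]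
      module

end Eigen

/-! ### Phase estimation -/

section PhaseEstimation

variable {q : ℕ}

/-- The number with the binary expansion `0.y₀y₁y₂…`. -/
def zhat (y : Bits (Fin q)) : ℝ := ∑ p : Fin q, (if y p then 1 else 0) / (2 : ℝ) ^ ((p : ℕ) + 1)

/-- The factor of the qubit `p` in the amplitude of the outcome `y` of phase estimation. -/
def fac (θ : ℝ) (p : Fin q) (y : Bits (Fin q)) : ℂ :=
  (1 + Complex.exp ((2 ^ (p : ℕ) * (θ - 2 * Real.pi * zhat y) : ℝ) * Complex.I)) / 2

/-- The amplitudes of the phase register when the qubits from `j` on have been processed. -/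
def phaseAmp (θ : ℝ) (j : ℕ) (y : Bits (Fin q)) : ℂ :=
  if ∀ p : Fin q, (p : ℕ) < j → y p = false then
    ∏ p ∈ Finset.univ.filter fun p : Fin q => j ≤ p, fac θ p y else 0

/-- The phase by which the qubit `p'` acts on the qubit `p` in the inverse Fourier transform. -/
def fourierPhase (p p' : Fin q) : Circle :=
  Circle.exp (-(2 * Real.pi * 2 ^ (p : ℕ) / 2 ^ ((p' : ℕ) + 1)))

/-- The action on the phase register of one stage of phase estimation. -/
def stageFun (θ : ℝ) (p : Fin q) (α : Amp (Fin q)) : Amp (Fin q) :=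
  rotate p (1 / 2) fun y =>
    (if y p then Complex.exp (θ * Complex.I) ^ 2 ^ (p : ℕ) *
      ∏ p' ∈ Finset.univ.erase p, (if y p' then (fourierPhase p p' : ℂ) else 1) else 1) *
        rotate p (1 / 2) α y

theorem zhat_update (p : Fin q) (y : Bits (Fin q)) :
    zhat y = zhat (Function.update y p false) + (if y p then 1 else 0) / (2 : ℝ) ^ ((p : ℕ) + 1) := by
  unfold zhat
  rw [Fintype.sum_eq_add_sum_compl p, Fintype.sum_eq_add_sum_compl p]
  have : ∑ p' ∈ ({p}ᶜ : Finset (Fin q)),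
      (if Function.update y p false p' then (1 : ℝ) else 0) / 2 ^ ((p' : ℕ) + 1) =
      ∑ p' ∈ ({p}ᶜ : Finset (Fin q)), (if y p' then (1 : ℝ) else 0) / 2 ^ ((p' : ℕ) + 1) := by
    refine Finset.sum_congr rfl fun p' hp' => ?_
    rw [Function.update_of_ne (by simpa using hp')]
  rw [this]
  simp
  ring

/-- Bit `p` contributes an integer to `2 ^ p' * zhat y` when `p < p'`. Hence the factors of qubits
already processed are unaffected by later ones. -/
theorem fac_update {θ : ℝ} {p p' : Fin q} (h : p < p') (y : Bits (Fin q)) (b : Bool) :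
    fac θ p' (Function.update y p b) = fac θ p' y := by
  have key : ∀ z : Bits (Fin q), fac θ p' z = fac θ p' (Function.update z p false) := by
    intro z
    unfold fac
    rw [zhat_update p z]
    obtain ⟨d, hd⟩ : ∃ d, (p' : ℕ) = p + 1 + d := ⟨p' - (p + 1), by have := Fin.lt_def.1 h; omega⟩
    congr 2
    rw [Complex.exp_eq_exp_iff_exists_int]
    refine ⟨-(if z p then 2 ^ d else 0), ?_⟩
    rw [hd, pow_add (2 : ℝ) (p + 1)]
    by_cases hz : z p = true
    · simp only [hz, if_true]
      push_cast
      field_simp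
      ring
    · simp [hz]
  rw [key, key y, Function.update_idem]

/-- The first Hadamard gate splits `p` evenly, and the relative phase `E` combines the walk with the
bits of the other qubits. The second one gives `(1 ± E) / 2`; the sign is absorbed into `zhat`,
since bit `p` changes the angle by `2 ^ p * 2π / 2 ^ (p + 1) = π`. -/
theorem stageFun_apply (θ : ℝ) (p : Fin q) (α : Amp (Fin q)) (hα : ∀ y, y p = true → α y = 0)
    (y : Bits (Fin q)) :
    stageFun θ p α y = α (Function.update y p false) * fac θ p y := by
  have hprod : ∀ b, ∏ p' ∈ Finset.univ.erase p,
      (if Function.update y p b p' then (fourierPhase p p' : ℂ) else 1) =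
      ∏ p' ∈ Finset.univ.erase p, (if y p' then (fourierPhase p p' : ℂ) else 1) := fun b =>
    Finset.prod_congr rfl fun p' hp' => by
      rw [Function.update_of_ne (Finset.ne_of_mem_erase hp')]
  have hexp : ∏ p' ∈ Finset.univ.erase p, (if y p' then (fourierPhase p p' : ℂ) else 1) =
      Complex.exp ((-(2 * Real.pi * 2 ^ (p : ℕ)) * zhat (Function.update y p false) : ℝ) *
        Complex.I) := by
    rw [zhat, ← Finset.add_sum_erase _ _ (Finset.mem_univ p)]
    rw [Function.update_self]
    simp only [Bool.false_eq_true, if_false, zero_div, zero_add]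
    push_cast
    rw [Finset.mul_sum, Finset.sum_mul, Complex.exp_sum]
    refine Finset.prod_congr rfl fun p' hp' => ?_
    rw [Function.update_of_ne (Finset.ne_of_mem_erase hp')]
    by_cases hy : y p' = true
    · simp only [hy, if_true, fourierPhase, Circle.coe_exp]
      push_cast
      congr 1
      ring
    · simp [hy]
  have hrot : ∀ b, rotate p (1 / 2) α (Function.update y p b) =
      (Real.sqrt (1 / 2) : ℂ) * α (Function.update y p false) := by
    intro b
    have h := amplitudeMatrix_half b false
    simp only [halfI] at h
    simp only [rotate, Fintype.sum_bool, Function.update_self, Function.update_idem, h,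
      hα (Function.update y p true) (Function.update_self ..)]
    simp
  have h1 : Complex.exp (θ * Complex.I) ^ 2 ^ (p : ℕ) * Complex.exp ((-(2 * Real.pi * 2 ^ (p : ℕ)) *
      zhat (Function.update y p false) : ℝ) * Complex.I) =
      Complex.exp ((2 ^ (p : ℕ) * (θ - 2 * Real.pi * zhat (Function.update y p false)) : ℝ) *
        Complex.I) := by
    rw [← Complex.exp_nat_mul, ← Complex.exp_add]
    congr 1
    push_cast
    ring
  have h2 : Complex.exp ((2 ^ (p : ℕ) * (θ - 2 * Real.pi * zhat y) : ℝ) * Complex.I) =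
      (if y p then -1 else 1) * Complex.exp ((2 ^ (p : ℕ) *
        (θ - 2 * Real.pi * zhat (Function.update y p false)) : ℝ) * Complex.I) := by
    rw [zhat_update p y]
    by_cases hy : y p = true
    · simp only [hy, if_true]
      rw [← Complex.exp_pi_mul_I, ← Complex.exp_add, Complex.exp_eq_exp_iff_exists_int]
      refine ⟨-1, ?_⟩
      push_cast
      field_simp
      ring
    · simp [hy]
  unfold stageFun
  have hb := fun b => amplitudeMatrix_half (y p) b
  simp only [halfI] at hb
  rw [rotate]
  simp only [Fintype.sum_bool, Function.update_self, hrot, hprod, hexp, h1, hb, fac, h2,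
    if_true, Bool.false_eq_true, if_false]
  have hs := sqrt_half_mul_self
  generalize (Real.sqrt (1 / 2) : ℂ) = r at hs
  generalize Complex.exp _ = E
  cases y p <;> simp
  · linear_combination (α (Function.update y p false) * (1 + E)) * hs
  · linear_combination (α (Function.update y p false) * (1 - E)) * hs

/-- Stages run downwards, so the qubits below `p` are still `false` and contribute no Fourier phase,
although the stage includes all qubits other than `p`. -/
theorem stageFun_phaseAmp (θ : ℝ) (p : Fin q) :
    stageFun θ p (phaseAmp θ (p + 1)) = phaseAmp θ p := by
  funext y
  rw [stageFun_apply]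
  · have hc : (∀ p' : Fin q, (p' : ℕ) < p + 1 → Function.update y p false p' = false) ↔
        ∀ p' : Fin q, (p' : ℕ) < p → y p' = false := by
      constructor
      · intro h p' hp'
        have := h p' (by omega)
        rwa [Function.update_of_ne (by rintro rfl; omega)] at this
      · intro h p' hp'
        by_cases hpp : p' = p
        · subst hpp; simp
        · rw [Function.update_of_ne hpp]
          exact h p' (by have : (p' : ℕ) ≠ p := fun h => hpp (Fin.ext h); omega)
    simp only [phaseAmp, hc]
    split
    · have hset : (Finset.univ.filter fun p' : Fin q => (p : ℕ) ≤ p') =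
          insert p (Finset.univ.filter fun p' : Fin q => (p : ℕ) + 1 ≤ p') := by
        ext p'
        simp only [Finset.mem_filter, Finset.mem_univ, true_and, Finset.mem_insert, Fin.ext_iff]
        omega
      rw [hset, Finset.prod_insert (by simp), mul_comm]
      congr 1
      refine Finset.prod_congr rfl fun p' hp' => ?_
      exact fac_update (Fin.lt_def.2 (by simpa using hp')) y false
    · simp
  · intro y hy
    rw [phaseAmp, if_neg]
    intro h
    have := h p (by omega)
    simp [hy] at this

theorem rotate_norm {V : Type} [Fintype V] [DecidableEq V] (v : V) {t : ℝ} (h0 : 0 ≤ t)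
    (h1 : t ≤ 1) (ψ : Amp V) : ∑ x, ‖rotate v t ψ x‖ ^ 2 = ∑ x, ‖ψ x‖ ^ 2 := by
  have hstar : ∀ χ : Amp V, (fun x => (starRingEnd ℂ) (rotate v t χ x)) =
      rotate v t fun x => (starRingEnd ℂ) (χ x) := by
    intro χ
    funext x
    simp [rotate, star_amplitudeMatrix]
  have key : ∀ χ : Amp V, ((∑ x, ‖χ x‖ ^ 2 : ℝ) : ℂ) =
      (fun x => (starRingEnd ℂ) (χ x)) ⬝ᵥ χ := by
    intro χ
    push_cast
    exact Finset.sum_congr rfl fun x _ => (Complex.conj_mul' _).symm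
  apply Complex.ofReal_injective
  rw [key, key, hstar, rotate_dot, rotate_rotate v h0 h1]

theorem stageFun_norm (θ : ℝ) (p : Fin q) (α : Amp (Fin q)) :
    ∑ y, ‖stageFun θ p α y‖ ^ 2 = ∑ y, ‖α y‖ ^ 2 := by
  rw [stageFun, rotate_norm _ (by norm_num) (by norm_num),
    ← rotate_norm p (t := 1 / 2) (by norm_num) (by norm_num) α]
  refine Finset.sum_congr rfl fun y _ => ?_
  rw [norm_mul]
  have : ‖(if y p then Complex.exp (θ * Complex.I) ^ 2 ^ (p : ℕ) *
      ∏ p' ∈ Finset.univ.erase p, (if y p' then (fourierPhase p p' : ℂ) else 1) else 1)‖ = 1 := by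
    split
    · rw [norm_mul, norm_pow, Complex.norm_exp_ofReal_mul_I, one_pow, norm_prod, one_mul]
      refine Finset.prod_eq_one fun p' _ => ?_
      split
      · exact Circle.norm_coe _
      · exact norm_one
    · exact norm_one
  rw [this, one_mul]

/-- The stages preserve the norm and begin with a classical state, so the Dirichlet kernel need not
be summed. -/
theorem phaseAmp_norm (θ : ℝ) (j : ℕ) (hj : j ≤ q) :
    ∑ y : Bits (Fin q), ‖phaseAmp θ j y‖ ^ 2 = 1 := by
  induction hd : q - j generalizing j with
  | zero =>
    obtain rfl : j = q := by omega
    rw [Finset.sum_eq_single fun _ => false]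
    · rw [phaseAmp, if_pos fun _ _ => rfl, Finset.prod_eq_one]
      · simp
      · intro p hp
        have := p.2
        simp at hp
        omega
    · intro y _ hy
      rw [phaseAmp, if_neg]
      · simp
      · intro h
        exact hy (funext fun p => h p p.2)
    · simp
  | succ d ih =>
    have h := stageFun_phaseAmp θ (⟨j, by omega⟩ : Fin q)
    rw [← h, stageFun_norm]
    exact ih (j + 1) (by omega) (by omega)

theorem phaseAmp_zero (θ : ℝ) (y : Bits (Fin q)) : phaseAmp θ 0 y = ∏ p, fac θ p y := by
  simp [phaseAmp]

theorem norm_fac_sq (θ : ℝ) (p : Fin q) (y : Bits (Fin q)) :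
    ‖fac θ p y‖ ^ 2 = Real.cos (2 ^ (p : ℕ) * (θ / 2 - Real.pi * zhat y)) ^ 2 := by
  have h : ∀ u : ℝ, ‖(1 + Complex.exp (((2 * u : ℝ) : ℂ) * Complex.I)) / 2‖ = |Real.cos u| := by
    intro u
    have : (1 + Complex.exp (((2 * u : ℝ) : ℂ) * Complex.I)) / 2 =
        Complex.exp ((u : ℂ) * Complex.I) * (Real.cos u : ℂ) := by
      rw [Complex.ofReal_cos, Complex.cos]
      have e1 : Complex.exp (((2 * u : ℝ) : ℂ) * Complex.I) =
          Complex.exp ((u : ℂ) * Complex.I) * Complex.exp ((u : ℂ) * Complex.I) := by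
        rw [← Complex.exp_add]; push_cast; ring_nf
      have e2 : Complex.exp ((u : ℂ) * Complex.I) * Complex.exp (-(u : ℂ) * Complex.I) = 1 := by
        rw [← Complex.exp_add]; simp
      rw [e1]
      linear_combination -e2 / 2
    rw [this, norm_mul, Complex.norm_exp_ofReal_mul_I, one_mul, Complex.norm_real, Real.norm_eq_abs]
  rw [fac, ← sq_abs (Real.cos _), ← h]
  congr 6
  ring_nf

/-- The matrix-free form of the product formula for the Dirichlet kernel. -/
theorem prod_cos_mul_sin (n : ℕ) (u : ℝ) :
    (∏ p ∈ Finset.range n, Real.cos (2 ^ p * u)) * (2 ^ n * Real.sin u) = Real.sin (2 ^ n * u) := by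
  induction n with
  | zero => simp
  | succ n ih =>
    rw [Finset.prod_range_succ, pow_succ', mul_assoc 2 _ u, Real.sin_two_mul, ← ih]
    ring

/-- The cosines multiply to `sin (2 ^ q * u) / (2 ^ q * sin u)`. The form without division also
covers `sin u = 0`. -/
theorem norm_phaseAmp_sq_le (θ : ℝ) (y : Bits (Fin q)) :
    ‖phaseAmp θ 0 y‖ ^ 2 * (4 ^ q * Real.sin (θ / 2 - Real.pi * zhat y) ^ 2) ≤ 1 := by
  rw [phaseAmp_zero, norm_prod, ← Finset.prod_pow]
  simp only [norm_fac_sq]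
  rw [Fin.prod_univ_eq_prod_range
    (fun p => Real.cos (2 ^ p * (θ / 2 - Real.pi * zhat y)) ^ 2) q, Finset.prod_pow]
  have h := prod_cos_mul_sin q (θ / 2 - Real.pi * zhat y)
  have h4 : (4 : ℝ) ^ q = (2 ^ q) ^ 2 := by rw [← pow_mul, mul_comm, pow_mul]; norm_num
  rw [h4, ← mul_pow, ← mul_pow, h]
  exact Real.sin_sq_le_one _

end PhaseEstimation

/-! ### Phase estimation as a circuit -/

section PhaseEstimationCircuit

variable {q : ℕ} {R ι : Type} [DecidableEq R] [Fintype ι] [DecidableEq ι]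

/-- One stage of phase estimation. -/
def stage (cV : Fin q → Circ (Fin q ⊕ R) ι) (p : Fin q) : Circ (Fin q ⊕ R) ι :=
  rot (Sum.inl p) halfI ++ (List.replicate (2 ^ (p : ℕ)) (cV p)).flatten ++
    (Finset.univ.erase p).toList.flatMap
      (fun p' => ph (Sum.inl p') (Sum.inl p) true (fourierPhase p p')) ++
    rot (Sum.inl p) halfI

/-- The stages of phase estimation for the qubits below `j`, in descending order. -/
def phaseEst (cV : Fin q → Circ (Fin q ⊕ R) ι) : ℕ → Circ (Fin q ⊕ R) ι
  | 0 => []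
  | j + 1 => (if h : j < q then stage cV ⟨j, h⟩ else []) ++ phaseEst cV j

variable (Q : Matrix (Bits ι) (Bits ι) ℂ)

theorem run_replicate {cV : Fin q → Circ (Fin q ⊕ R) ι} {μ : ℂ} {e : Amp R}
    (he : IsEigen Q cV μ e) (p : Fin q) (n : ℕ) (α : Amp (Fin q)) :
    run Q (List.replicate n (cV p)).flatten (tens α e) =
      tens (fun y => (if y p then μ ^ n else 1) * α y) e := by
  induction n generalizing α with
  | zero => simp
  | succ n ih =>
    rw [List.replicate_succ, List.flatten_cons, run_append, he, ih]
    congr 1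
    funext y
    by_cases hy : y p = true
    · simp only [hy, if_true]; ring
    · simp [hy]

theorem run_fourier (p : Fin q) (L : List (Fin q)) (hL : p ∉ L) (ψ : Amp (Fin q ⊕ R))
    (x : Bits (Fin q ⊕ R)) :
    run Q (L.flatMap fun p' => ph (Sum.inl p') (Sum.inl p) true (fourierPhase p p')) ψ x =
      (if x (Sum.inl p) then
        (L.map fun p' => if x (Sum.inl p') then (fourierPhase p p' : ℂ) else 1).prod else 1) *
        ψ x := by
  induction L generalizing ψ with
  | nil => simp
  | cons a L ih =>
    simp only [List.mem_cons, not_or] at hL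
    rw [List.flatMap_cons, run_append, ih hL.2,
      run_ph Q (by simpa using Ne.symm hL.1)]
    by_cases hx : x (Sum.inl p) = true
    · simp only [hx, if_true, and_true, List.map_cons, List.prod_cons]
      ring
    · simp [hx]

theorem run_stage {cV : Fin q → Circ (Fin q ⊕ R) ι} {θ : ℝ} {e : Amp R}
    (he : IsEigen Q cV (Complex.exp (θ * Complex.I)) e) (p : Fin q) (α : Amp (Fin q)) :
    run Q (stage cV p) (tens α e) = tens (stageFun θ p α) e := by
  rw [stage, run_append, run_append, run_append, run_rot, run_rot, rotate_inl_tens,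
    run_replicate Q he]
  have hF : ∀ α' : Amp (Fin q), run Q ((Finset.univ.erase p).toList.flatMap
      fun p' => ph (Sum.inl p') (Sum.inl p) true (fourierPhase p p')) (tens α' e) =
      tens (fun y => (if y p then
        ∏ p' ∈ Finset.univ.erase p, (if y p' then (fourierPhase p p' : ℂ) else 1) else 1) * α' y)
        e := by
    intro α'
    funext x
    rw [run_fourier Q p _ (by simp)]
    simp only [Finset.prod_map_toList, tens, Function.comp_apply]
    ring
  rw [hF, rotate_inl_tens, stageFun]
  congr 2
  funext y
  by_cases hy : y p = true
  · simp only [hy, if_true, halfI]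
    ring
  · simp [hy, halfI]

theorem run_phaseEst {cV : Fin q → Circ (Fin q ⊕ R) ι} {θ : ℝ} {e : Amp R}
    (he : IsEigen Q cV (Complex.exp (θ * Complex.I)) e) (j : ℕ) (hj : j ≤ q) :
    run Q (phaseEst cV j) (tens (phaseAmp θ j) e) = tens (phaseAmp θ 0) e := by
  induction j with
  | zero => rfl
  | succ j ih =>
    rw [phaseEst, dif_pos (by omega), run_append, run_stage Q he]
    have h := stageFun_phaseAmp θ (⟨j, by omega⟩ : Fin q)
    simp only at h
    rw [h, ih (by omega)]

/-- Qubit `p` takes `2 ^ p` walk steps, a geometric sum; each stage adds at most `q` phases and two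
Hadamard gates. -/
theorem length_phaseEst_le (cV : Fin q → Circ (Fin q ⊕ R) ι) (w : ℕ)
    (hw : ∀ p, (cV p).length ≤ w) (j : ℕ) :
    (phaseEst cV j).length ≤ 2 ^ j * w + j * (q + 2) := by
  induction j with
  | zero => simp [phaseEst]
  | succ j ih =>
    rw [phaseEst, List.length_append]
    split
    · rename_i h
      have h1 : (stage cV ⟨j, h⟩).length ≤ 2 ^ j * w + (q + 2) := by
        simp only [stage, List.length_append, length_rot, List.length_flatten, List.map_replicate,
          List.sum_replicate, smul_eq_mul, List.length_flatMap]
        have h2 : (((Finset.univ.erase (⟨j, h⟩ : Fin q)).toList.map fun p' =>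
            (ph (Sum.inl p') (Sum.inl ⟨j, h⟩) true (fourierPhase ⟨j, h⟩ p') :
              Circ (Fin q ⊕ R) ι).length)).sum ≤ q := by
          refine (List.sum_le_card_nsmul _ 1 ?_).trans ?_
          · simp only [List.mem_map, forall_exists_index, and_imp]
            rintro _ p' _ rfl
            exact length_ph_le ..
          · simp
        have h3 : 2 ^ j * (cV ⟨j, h⟩).length ≤ 2 ^ j * w := Nat.mul_le_mul_left _ (hw _)
        omega
      rw [pow_succ]
      nlinarith
    · simp only [List.length_nil, zero_add]
      refine ih.trans (Nat.add_le_add (Nat.mul_le_mul_right _ ?_) (Nat.mul_le_mul_right _ ?_))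
      · exact Nat.pow_le_pow_right (by norm_num) (by omega)
      · omega

theorem queries_flatMap_ph {V : Type} [DecidableEq V] {α : Type} (L : List α) (u v : α → V)
    (pol : α → Bool) (z : α → Circle) :
    queries (L.flatMap fun a => ph (u a) (v a) (pol a) (z a) : Circ V ι) = 0 := by
  induction L with
  | nil => rfl
  | cons a L ih => rw [List.flatMap_cons, queries_append, queries_ph, ih]

theorem queries_phaseEst_le (cV : Fin q → Circ (Fin q ⊕ R) ι) (w : ℕ)
    (hw : ∀ p, queries (cV p) ≤ w) (j : ℕ) :
    queries (phaseEst cV j) ≤ 2 ^ j * w := by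
  have hrep : ∀ n p, queries (List.replicate n (cV p)).flatten ≤ n * w := by
    intro n p
    induction n with
    | zero => simp [queries]
    | succ n ih =>
      rw [List.replicate_succ, List.flatten_cons, queries_append, Nat.succ_mul]
      have := hw p
      omega
  induction j with
  | zero => simp [phaseEst, queries]
  | succ j ih =>
    rw [phaseEst, queries_append]
    split
    · rename_i h
      have h1 : queries (stage cV ⟨j, h⟩) ≤ 2 ^ j * w := by
        simp only [stage, queries_append, queries_rot, queries_flatMap_ph]
        simpa using hrep (2 ^ j) ⟨j, h⟩
      rw [pow_succ]
      nlinarith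
    · refine le_trans ?_ (Nat.mul_le_mul_right w
        (Nat.pow_le_pow_right (by norm_num : 0 < 2) (Nat.le_succ j)))
      simpa [queries] using ih

end PhaseEstimationCircuit

/-! ### The tail of the outcome distribution of phase estimation -/

section Tail

/-- The bijection between bit strings of length `k` and the numbers below `2 ^ k`. -/
def bitsEquiv (k : ℕ) : Bits (Fin k) ≃ Fin (2 ^ k) :=
  (Equiv.arrowCongr Fin.revPerm finTwoEquiv.symm).trans finFunctionFinEquiv

theorem bitsEquiv_val {k : ℕ} (a : Bits (Fin k)) : (bitsEquiv k a : ℕ) = bitsToNat a := by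
  rw [bitsEquiv, Equiv.trans_apply, finFunctionFinEquiv_apply, bitsToNat]
  refine Fintype.sum_equiv Fin.revPerm _ _ fun i => ?_
  simp only [Equiv.arrowCongr_apply, Function.comp_apply, Fin.revPerm_symm, Fin.revPerm_apply,
    Fin.rev_rev]
  cases a i.rev <;> rfl

theorem bitsToNat_lt {k : ℕ} (a : Bits (Fin k)) : bitsToNat a < 2 ^ k := by
  rw [← bitsEquiv_val]; exact (bitsEquiv k a).2

theorem zhat_eq {q : ℕ} (y : Bits (Fin q)) : zhat y = bitsToNat y / 2 ^ q := by
  rw [zhat, bitsToNat, eq_div_iff (by positivity), Finset.sum_mul]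
  push_cast
  refine Finset.sum_congr rfl fun p _ => ?_
  have : (2 : ℝ) ^ q = 2 ^ ((p : ℕ) + 1) * 2 ^ (p.rev : ℕ) := by
    rw [← pow_add]; congr 1; rw [Fin.val_rev]; omega
  rw [this]
  cases y p <;> simp

theorem abs_cos_sub_cos_le (θ v : ℝ) :
    |Real.cos v - Real.cos θ| ≤ 2 * |Real.sin (θ / 2 - v / 2)| := by
  rw [Real.cos_sub_cos, abs_mul, abs_mul, abs_neg, abs_two,
    show (v - θ) / 2 = -(θ / 2 - v / 2) by ring, Real.sin_neg, abs_neg]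
  have h1 := Real.abs_sin_le_one ((v + θ) / 2)
  have h2 := abs_nonneg (Real.sin (θ / 2 - v / 2))
  nlinarith

/-- Telescoping. The threshold `7` belongs to the constant `22 > 7π` of `weight_bound`. -/
theorem sum_inv_sq_tail_le (N : ℕ) :
    ∑ j ∈ Finset.range N, (if 7 ≤ j then ((j : ℝ) ^ 2)⁻¹ else 0) ≤ 1 / 6 := by
  rw [← Finset.sum_filter]
  have hsub : (Finset.range N).filter (fun j => 7 ≤ j) ⊆ Finset.Ioc 6 (max 6 N) := by
    intro j hj
    simp only [Finset.mem_filter, Finset.mem_range] at hj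
    simp only [Finset.mem_Ioc]
    omega
  refine (Finset.sum_le_sum_of_subset_of_nonneg hsub fun _ _ _ => by positivity).trans ?_
  refine (sum_Ioc_inv_sq_le_sub (α := ℝ) (by norm_num : (6 : ℕ) ≠ 0) (le_max_left 6 N)).trans ?_
  have : (0 : ℝ) ≤ ((max 6 N : ℕ) : ℝ)⁻¹ := by positivity
  norm_num at this ⊢

/-- Here `r` is the cyclic offset of an outcome from the true phase, in units of `1 / N`. The
inequality `sin x ≥ 2x / π`, applied from the nearer of the ends `0` and `N`, turns the kernel bound
into an inverse square; the other term is simply added. -/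
theorem weight_bound {N : ℕ} (hN : 0 < N) {r : ℝ} {j : ℕ} (hj : j < N) (h0 : (j : ℝ) ≤ r)
    (h1 : r < j + 1) (hs : 22 / (N : ℝ) < |Real.sin (Real.pi * r / N)|) {w : ℝ}
    (hw : w * (N ^ 2 * Real.sin (Real.pi * r / N) ^ 2) ≤ 1) :
    w ≤ (if 7 ≤ j then ((j : ℝ) ^ 2)⁻¹ else 0) / 4 +
      (if 7 ≤ N - 1 - j then (((N - 1 - j : ℕ) : ℝ) ^ 2)⁻¹ else 0) / 4 := by
  have hNr : (0 : ℝ) < N := by exact_mod_cast hN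
  have hpi := Real.pi_pos
  have hpi' := Real.pi_lt_d4
  have hjN : (j : ℝ) + 1 ≤ N := by exact_mod_cast hj
  have hcast : ((N - 1 - j : ℕ) : ℝ) = N - 1 - j := by
    rw [Nat.sub_sub, Nat.cast_sub (by omega)]; push_cast; ring
  have hr0 : 0 ≤ r := le_trans (by positivity) h0
  have e1 : Real.sin (Real.pi * r / N) = Real.sin (Real.pi * (N - r) / N) := by
    rw [← Real.sin_pi_sub]; congr 1; field_simp
  have up : ∀ a : ℝ, 0 ≤ a → |Real.sin (Real.pi * a / N)| ≤ Real.pi * a / N := fun a ha => by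
    have := Real.abs_sin_le_abs (x := Real.pi * a / N)
    rwa [abs_of_nonneg (by positivity : 0 ≤ Real.pi * a / N)] at this
  have low : ∀ a : ℝ, 0 ≤ a → a ≤ N / 2 → 2 * a / N ≤ |Real.sin (Real.pi * a / N)| := by
    intro a ha hb
    have := Real.mul_le_sin (x := Real.pi * a / N) (by positivity) (by
      rw [div_le_div_iff₀ hNr (by norm_num)]; nlinarith)
    refine le_trans (le_of_eq ?_) (this.trans (le_abs_self _))
    field_simp
  -- For `j ≤ 6` one has `π r < 7π < 22`, against `22 / N < |sin (π r / N)| ≤ π r / N`.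
  have hj7 : 7 ≤ j := by
    by_contra hlt
    have : (j : ℝ) ≤ 6 := by exact_mod_cast (by omega : j ≤ 6)
    have h2 := hs.trans_le (up r hr0)
    rw [div_lt_div_iff_of_pos_right hNr] at h2
    nlinarith
  have hN7 : 7 ≤ N - 1 - j := by
    by_contra hlt
    have : (N : ℝ) - 1 - j ≤ 6 := by rw [← hcast]; exact_mod_cast (by omega : N - 1 - j ≤ 6)
    rw [e1] at hs
    have h2 := hs.trans_le (up (N - r) (by linarith))
    rw [div_lt_div_iff_of_pos_right hNr] at h2
    nlinarith
  rw [if_pos hj7, if_pos hN7]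
  have gen : ∀ a b : ℝ, 0 < b → b ≤ a → 2 * a / N ≤ |Real.sin (Real.pi * r / N)| →
      w ≤ (b ^ 2)⁻¹ / 4 := by
    intro a b hb hab h
    have hb' : 2 * b ≤ N * |Real.sin (Real.pi * r / N)| := by
      rw [div_le_iff₀ hNr] at h; linarith
    have hsq : 4 * b ^ 2 ≤ N ^ 2 * Real.sin (Real.pi * r / N) ^ 2 := by
      rw [← sq_abs (Real.sin _), ← mul_pow]
      nlinarith
    rw [← one_div, div_div, le_div_iff₀ (by positivity)]
    by_cases hw0 : 0 ≤ w
    · nlinarith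
    · nlinarith [sq_nonneg b]
  have hj0 : (0 : ℝ) < j := by exact_mod_cast (by omega : 0 < j)
  have hn0 : (0 : ℝ) < ((N - 1 - j : ℕ) : ℝ) := by exact_mod_cast (by omega : 0 < N - 1 - j)
  have p1 : 0 ≤ ((j : ℝ) ^ 2)⁻¹ / 4 := by positivity
  have p2 : 0 ≤ (((N - 1 - j : ℕ) : ℝ) ^ 2)⁻¹ / 4 := by positivity
  rcases le_total r (N / 2) with hr | hr
  · have := gen r j hj0 h0 (low r hr0 hr)
    linarith
  · have := gen (N - r) ((N - 1 - j : ℕ) : ℝ) hn0 (by rw [hcast]; linarith)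
      (by rw [e1]; exact low (N - r) (by linarith) (by linarith))
    linarith

-- Outcomes correspond injectively to their rounded cyclic offsets from `N θ / (2π)`. The bad ones
-- carry at most two tails, `2 * (1/4) * (1/6) = 1/12`.
open Classical in
theorem phase_tail {q : ℕ} (θ : ℝ) :
    ∑ y : Bits (Fin q), (if |Real.cos (2 * Real.pi * zhat y) - Real.cos θ| ≤ 44 / 2 ^ q then 0
      else ‖phaseAmp θ 0 y‖ ^ 2) ≤ 1 / 10 := by
  set N : ℕ := 2 ^ q with hN
  have hN0 : 0 < N := by positivity
  have hNr : (0 : ℝ) < N := by exact_mod_cast hN0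
  have hNc : ((N : ℕ) : ℝ) = 2 ^ q := by rw [hN]; push_cast; rfl
  set c : ℝ := N * θ / (2 * Real.pi) with hc
  let J : Bits (Fin q) → ℕ := fun y => ((⌊c⌋ - (bitsToNat y : ℤ)) % (N : ℤ)).toNat
  have hJ : ∀ y, ((J y : ℕ) : ℤ) = (⌊c⌋ - (bitsToNat y : ℤ)) % (N : ℤ) := fun y =>
    Int.toNat_of_nonneg (Int.emod_nonneg _ (by exact_mod_cast hN0.ne'))
  have hJlt : ∀ y, J y < N := fun y => by
    have := Int.emod_lt_of_pos (⌊c⌋ - (bitsToNat y : ℤ)) (by exact_mod_cast hN0 : (0 : ℤ) < N)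
    rw [← hJ] at this
    exact_mod_cast this
  have hJinj : Function.Injective J := by
    intro y y' h
    have h1 : (⌊c⌋ - (bitsToNat y : ℤ)) % (N : ℤ) = (⌊c⌋ - (bitsToNat y' : ℤ)) % (N : ℤ) := by
      rw [← hJ, ← hJ, h]
    have h2 : (bitsToNat y : ℤ) ≡ bitsToNat y' [ZMOD N] := by
      simpa using (Int.ModEq.refl (n := (N : ℤ)) ⌊c⌋).sub h1
    have h3 : bitsToNat y % N = bitsToNat y' % N := by
      have : ((bitsToNat y : ℤ)) % (N : ℤ) = (bitsToNat y' : ℤ) % (N : ℤ) := h2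
      exact_mod_cast this
    rw [Nat.mod_eq_of_lt (bitsToNat_lt y), Nat.mod_eq_of_lt (bitsToNat_lt y')] at h3
    apply (bitsEquiv q).injective
    apply Fin.ext
    rw [bitsEquiv_val, bitsEquiv_val, h3]
  let g : ℕ → ℝ := fun j => (if 7 ≤ j then ((j : ℝ) ^ 2)⁻¹ else 0) / 4 +
      (if 7 ≤ N - 1 - j then (((N - 1 - j : ℕ) : ℝ) ^ 2)⁻¹ else 0) / 4
  have hg0 : ∀ j, 0 ≤ g j := fun j => by
    simp only [g]
    split_ifs <;> positivity
  have hbound : ∀ y : Bits (Fin q),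
      (if |Real.cos (2 * Real.pi * zhat y) - Real.cos θ| ≤ 44 / 2 ^ q then 0
        else ‖phaseAmp θ 0 y‖ ^ 2) ≤ g (J y) := by
    intro y
    split_ifs with hy
    · exact hg0 _
    · have hy' := (not_le.1 hy).trans_le (abs_cos_sub_cos_le θ (2 * Real.pi * zhat y))
      set m : ℤ := (⌊c⌋ - (bitsToNat y : ℤ)) / (N : ℤ)
      have hdiv : (⌊c⌋ : ℝ) - bitsToNat y = J y + N * m := by
        have := Int.emod_add_mul_ediv (⌊c⌋ - (bitsToNat y : ℤ)) (N : ℤ)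
        rw [← hJ] at this
        exact_mod_cast this.symm
      have hu : θ / 2 - Real.pi * zhat y =
          Real.pi * (J y + Int.fract c) / N + m * Real.pi := by
        have hcf : c = ⌊c⌋ + Int.fract c := (Int.floor_add_fract c).symm
        have hθ : θ / 2 = Real.pi * c / N := by rw [hc]; field_simp
        have e : (J y : ℝ) + Int.fract c = c - bitsToNat y - N * m := by linarith
        rw [hθ, zhat_eq, ← hNc, e]
        field_simp
        ring
      have habs : |Real.sin (θ / 2 - Real.pi * zhat y)| =
          |Real.sin (Real.pi * (J y + Int.fract c) / N)| := by
        rw [hu, Real.sin_add_int_mul_pi, abs_mul]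
        rw [abs_zpow, abs_neg, abs_one, one_zpow, one_mul]
      have hsq : Real.sin (θ / 2 - Real.pi * zhat y) ^ 2 =
          Real.sin (Real.pi * (J y + Int.fract c) / N) ^ 2 := by
        rw [← sq_abs, habs, sq_abs]
      have hw := norm_phaseAmp_sq_le θ y
      refine weight_bound hN0 (hJlt y) (r := J y + Int.fract c) (by linarith [Int.fract_nonneg c])
        (by linarith [Int.fract_lt_one c]) ?_ ?_
      · rw [← habs, hNc]
        rw [show 2 * Real.pi * zhat y / 2 = Real.pi * zhat y by ring] at hy'
        have : (44 : ℝ) / 2 ^ q = 2 * (22 / 2 ^ q) := by ring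
        linarith
      · rw [← hsq, hNc, ← pow_mul, mul_comm q 2, pow_mul]
        norm_num at hw ⊢
        exact hw
  calc _ ≤ ∑ y : Bits (Fin q), g (J y) := Finset.sum_le_sum fun y _ => hbound y
    _ = ∑ j ∈ Finset.univ.image J, g j := by
        rw [Finset.sum_image fun a _ b _ h => hJinj h]
    _ ≤ ∑ j ∈ Finset.range N, g j := by
        refine Finset.sum_le_sum_of_subset_of_nonneg ?_ fun _ _ _ => hg0 _
        intro j hj
        obtain ⟨y, _, rfl⟩ := Finset.mem_image.1 hj
        exact Finset.mem_range.2 (hJlt y)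
    _ ≤ 1 / 10 := by
        simp only [g, Finset.sum_add_distrib, ← Finset.sum_div]
        rw [Finset.sum_range_reflect (fun j : ℕ => if 7 ≤ j then ((j : ℝ) ^ 2)⁻¹ else 0) N]
        have := sum_inv_sq_tail_le N
        linarith

end Tail

/-! ### Table lookup -/

section Lookup

variable {V O A ι : Type} [DecidableEq V] [Fintype ι] [DecidableEq ι] [DecidableEq O] [Fintype O]
  [Fintype A] [DecidableEq A]
variable (Q : Matrix (Bits ι) (Bits ι) ℂ)

/-- The classical state `x` with `g` added to the wires `out`. -/
def toggle (out : O ↪ V) (g : Bits O) (x : Bits V) : Bits V :=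
  Function.extend out (fun o => xor (g o) (x (out o))) x

theorem toggle_out (out : O ↪ V) (g : Bits O) (x : Bits V) (o : O) :
    toggle out g x (out o) = xor (g o) (x (out o)) := out.injective.extend_apply _ _ o

theorem toggle_of_ne (out : O ↪ V) (g : Bits O) (x : Bits V) {v : V} (hv : ∀ o, v ≠ out o) :
    toggle out g x v = x v := Function.extend_apply' _ _ _ fun ⟨o, ho⟩ => hv o ho.symm

theorem toggle_zero (out : O ↪ V) (x : Bits V) : toggle out (fun _ => false) x = x := by
  funext v
  by_cases h : ∃ o, v = out o
  · obtain ⟨o, rfl⟩ := h; rw [toggle_out, Bool.false_xor]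
  · exact toggle_of_ne _ _ _ (not_exists.1 h)

theorem toggle_toggle (out : O ↪ V) (g : Bits O) (x : Bits V) :
    toggle out g (toggle out g x) = x := by
  funext v
  by_cases h : ∃ o, v = out o
  · obtain ⟨o, rfl⟩ := h
    rw [toggle_out, toggle_out, ← Bool.xor_assoc, Bool.xor_self, Bool.false_xor]
  · rw [toggle_of_ne _ _ _ (not_exists.1 h), toggle_of_ne _ _ _ (not_exists.1 h)]

theorem toggle_update (out : O ↪ V) (g : Bits O) (x : Bits V) {v : V} (hv : ∀ o, v ≠ out o)
    (b : Bool) : toggle out g (Function.update x v b) = Function.update (toggle out g x) v b := by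
  funext w
  by_cases h : ∃ o, w = out o
  · obtain ⟨o, rfl⟩ := h
    rw [toggle_out, Function.update_of_ne (hv o).symm, Function.update_of_ne (hv o).symm,
      toggle_out]
  · rw [toggle_of_ne _ _ _ (not_exists.1 h)]
    by_cases hw : w = v
    · subst hw; simp
    · rw [Function.update_of_ne hw, Function.update_of_ne hw, toggle_of_ne _ _ _ (not_exists.1 h)]

/-- Adding `g` to the wires `out`, controlled by the wire `v`. -/
def writeOut (out : O ↪ V) (g : Bits O) (L : List O) (v : V) : Circ V ι :=
  L.flatMap fun o => if g o then cx v (out o) else []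

theorem run_writeOut (out : O ↪ V) (g : Bits O) (L : List O) (hL : L.Nodup) (v : V)
    (hv : ∀ o, v ≠ out o) (ψ : Amp V) (x : Bits V) :
    run Q (writeOut out g L v) ψ x =
      if x v then ψ (toggle out (fun o => decide (o ∈ L) && g o) x) else ψ x := by
  induction L generalizing ψ with
  | nil =>
    simp [writeOut, toggle_zero]
  | cons o L ih =>
    rw [List.nodup_cons] at hL
    have hd : (writeOut out g (o :: L) v : Circ V ι) =
        (if g o then cx v (out o) else []) ++ writeOut out g L v := rfl
    rw [hd, run_append, ih hL.2]
    by_cases hg : g o = true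
    · simp only [hg, if_true, run_cx Q (hv o)]
      by_cases hx : x v = true
      · simp only [hx, if_true]
        congr 1
        funext w
        by_cases hw : ∃ o', w = out o'
        · obtain ⟨o', rfl⟩ := hw
          rw [toggle_out]
          by_cases ho : o' = o
          · subst ho
            rw [Function.update_self, toggle_of_ne _ _ _ hv, toggle_out]
            simp [hx, hL.1, hg]
          · rw [Function.update_of_ne (by simpa using ho), toggle_out, toggle_out]
            simp [ho]
        · have hne : w ≠ out o := not_exists.1 hw o
          rw [Function.update_of_ne hne, toggle_of_ne _ _ _ (not_exists.1 hw),
            toggle_of_ne _ _ _ (not_exists.1 hw)]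
      · simp only [hx, if_false, Bool.false_xor, Function.update_eq_self, Bool.false_eq_true]
    · simp only [hg, if_false, run_nil, Bool.false_eq_true]
      congr 3
      funext o'
      by_cases ho : o' = o
      · subst ho; simp [hg]
      · simp [ho]

theorem length_writeOut_le (out : O ↪ V) (g : Bits O) (L : List O) (v : V) :
    (writeOut out g L v : Circ V ι).length ≤ L.length := by
  rw [writeOut, List.length_flatMap]
  refine (List.sum_le_card_nsmul _ 1 ?_).trans ?_
  · simp only [List.mem_map, forall_exists_index, and_imp]
    rintro _ o _ rfl
    split
    · exact length_cx_le ..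
    · simp
  · simp

theorem queries_writeOut (out : O ↪ V) (g : Bits O) (L : List O) (v : V) :
    queries (writeOut out g L v : Circ V ι) = 0 := by
  induction L with
  | nil => rfl
  | cons o L ih =>
    have hd : (writeOut out g (o :: L) v : Circ V ι) =
        (if g o then cx v (out o) else []) ++ writeOut out g L v := rfl
    rw [hd, queries_append, ih]
    split
    · exact queries_cx ..
    · rfl

/-- Writing `tbl y` to the wires `out`, where `y` is the content of the wires `inp`, for the `y`
in the list. -/
def lookup (inp anc : A → V) (one : V) (out : O ↪ V) (tbl : Bits A → Bits O)
    (L : List (Bits A)) : Circ V ι :=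
  L.flatMap fun y => mc one (Finset.univ.toList.map fun j => (inp j, y j, anc j))
    (writeOut out (tbl y) Finset.univ.toList)

/-- The conditions of different entries exclude each other, and writing leaves inputs, auxiliary
wires and `one` unchanged, so at most one entry takes effect. -/
theorem run_lookup (inp anc : A → V) (one : V) (out : O ↪ V) (tbl : Bits A → Bits O)
    (h1 : ∀ o, one ≠ out o) (h2 : ∀ j o, inp j ≠ out o) (h3 : ∀ j o, anc j ≠ out o)
    (h4 : ∀ j, one ≠ inp j ∧ one ≠ anc j) (h5 : ∀ i j, inp i ≠ anc j)
    (h6 : Function.Injective anc) (L : List (Bits A)) (hL : L.Nodup) (ψ : Amp V) (x : Bits V)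
    (hx1 : x one = true) (hxa : ∀ j, x (anc j) = false) :
    run Q (lookup inp anc one out tbl L) ψ x =
      ψ (toggle out (fun o => decide (x ∘ inp ∈ L) && tbl (x ∘ inp) o) x) := by
  induction L generalizing ψ with
  | nil => simp [lookup, toggle_zero]
  | cons y L ih =>
    rw [List.nodup_cons] at hL
    have hd : (lookup inp anc one out tbl (y :: L) : Circ V ι) =
        mc one (Finset.univ.toList.map fun j => (inp j, y j, anc j))
          (writeOut out (tbl y) Finset.univ.toList) ++ lookup inp anc one out tbl L := rfl
    rw [hd, run_append, ih hL.2]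
    -- In the pullback picture the later entries act on `x` first, and the entry `y` then sees `x'`.
    set x' := toggle out (fun o => decide (x ∘ inp ∈ L) && tbl (x ∘ inp) o) x with hx'
    rw [run_mc Q (fun v => ∀ o, v ≠ out o) _ (fun χ z => χ (toggle out (tbl y) z))
      (fun v hv χ z => by
        rw [run_writeOut Q _ _ _ (Finset.nodup_toList _) v hv]; simp)
      (fun u c pol a hu hc ha χ z => by
        simp only [Function.comp_apply, tofMap]
        rw [toggle_update _ _ _ ha, toggle_of_ne _ _ _ hu, toggle_of_ne _ _ _ hc,
          toggle_of_ne _ _ _ ha])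
      _ one h1
      (by
        simp only [List.mem_map, forall_exists_index, and_imp]
        rintro _ j _ rfl
        exact ⟨h2 j, h3 j⟩)
      (chainOK_map _ (Finset.nodup_toList _) _ _ _ _ h4 h5 h6)]
    have hx'1 : x' one = true := by rw [hx', toggle_of_ne _ _ _ h1, hx1]
    have hx'a : ∀ j, x' (anc j) = false := fun j => by rw [hx', toggle_of_ne _ _ _ (h3 j), hxa]
    have hx'i : ∀ j, x' (inp j) = x (inp j) := fun j => by rw [hx', toggle_of_ne _ _ _ (h2 j)]
    rw [mcCond_map _ (Finset.nodup_toList _) _ _ _ _ h5 h6 _ hx'a, hx'1]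
    by_cases hy : x ∘ inp = y
    · have hnot : x ∘ inp ∉ L := hy ▸ hL.1
      have hxx : x' = x := by
        rw [hx']; simp [hnot, toggle_zero]
      have hall : ((Finset.univ : Finset A).toList.all fun j => x' (inp j) == y j) = true := by
        rw [List.all_eq_true]
        intro j _
        rw [hx'i, ← hy]; simp
      rw [hall, hxx]
      simp [hy]
    · have hall : ((Finset.univ : Finset A).toList.all fun j => x' (inp j) == y j) = false := by
        rw [Bool.eq_false_iff]
        intro hall
        rw [List.all_eq_true] at hall
        refine hy (funext fun j => ?_)
        have := hall j (by simp)
        rw [hx'i] at this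
        simpa using this
      rw [hall, hx']
      simp [hy]

theorem length_lookup_le (inp anc : A → V) (one : V) (out : O ↪ V) (tbl : Bits A → Bits O)
    (L : List (Bits A)) : (lookup inp anc one out tbl L : Circ V ι).length ≤
      L.length * (14 * Fintype.card A + Fintype.card O) := by
  rw [lookup, List.length_flatMap]
  refine (List.sum_le_card_nsmul _ (14 * Fintype.card A + Fintype.card O) ?_).trans ?_
  · simp only [List.mem_map, forall_exists_index, and_imp]
    rintro _ y _ rfl
    refine (length_mc_le _ (Fintype.card O) (fun v => ?_) _ _).trans ?_
    · refine (length_writeOut_le ..).trans ?_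
      simp
    · simp
  · simp

theorem queries_lookup (inp anc : A → V) (one : V) (out : O ↪ V) (tbl : Bits A → Bits O)
    (L : List (Bits A)) : queries (lookup inp anc one out tbl L : Circ V ι) = 0 := by
  induction L with
  | nil => rfl
  | cons y L ih =>
    have hd : (lookup inp anc one out tbl (y :: L) : Circ V ι) =
        mc one (Finset.univ.toList.map fun j => (inp j, y j, anc j))
          (writeOut out (tbl y) Finset.univ.toList) ++ lookup inp anc one out tbl L := rfl
    rw [hd, queries_append, ih, queries_mc]
    exact fun v => queries_writeOut ..

end Lookup

/-! ### The complete algorithm -/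

section Digits

/-- The number with the given sign bit and binary digits. -/
def outVal {q : ℕ} (g : Bits (Fin (q + 1))) : ℝ :=
  (if g 0 then -1 else 1) * ∑ j : Fin q, (if g j.succ then 1 else 0) / (2 : ℝ) ^ (j : ℕ)

/-- Removing the last binary digit is integer division by `2`. For `|v| < 2` the units digit is the
whole integer part. -/
theorem sum_digit {v : ℝ} (hv : |v| < 2) (n : ℕ) :
    ∑ j ∈ Finset.range (n + 1), (if digit v (j + 1) then 1 else 0) / (2 : ℝ) ^ j =
      ⌊|v| * 2 ^ n⌋₊ / (2 : ℝ) ^ n := by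
  induction n with
  | zero =>
    have h : ⌊|v| * 2 ^ 0⌋₊ < 2 := by
      rw [pow_zero, mul_one, Nat.floor_lt (abs_nonneg v)]; exact_mod_cast hv
    simp only [zero_add, Finset.sum_range_one, digit, decide_eq_true_eq]
    interval_cases ⌊|v| * 2 ^ 0⌋₊ <;> norm_num
  | succ n ih =>
    rw [Finset.sum_range_succ, ih]
    have h1 : ⌊|v| * 2 ^ n⌋₊ = ⌊|v| * 2 ^ (n + 1)⌋₊ / 2 := by
      rw [← Nat.floor_div_natCast]
      congr 1
      push_cast
      rw [pow_succ]
      ring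
    have h2 := Nat.mod_add_div ⌊|v| * 2 ^ (n + 1)⌋₊ 2
    rw [← h1] at h2
    have h3 : ((if digit v (n + 1 + 1) then 1 else 0 : ℝ)) =
        ((⌊|v| * 2 ^ (n + 1)⌋₊ % 2 : ℕ) : ℝ) := by
      simp only [digit, decide_eq_true_eq]
      rcases Nat.mod_two_eq_zero_or_one ⌊|v| * 2 ^ (n + 1)⌋₊ with h | h <;> simp [h]
    rw [h3]
    conv_rhs => rw [← h2]
    push_cast
    rw [pow_succ]
    field_simp
    ring

theorem abs_sum_digit_sub_le {v : ℝ} (hv : |v| < 2) (n : ℕ) :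
    |(∑ j ∈ Finset.range n, (if digit v (j + 1) then 1 else 0) / (2 : ℝ) ^ j) - abs v| ≤ 2 / 2 ^ n := by
  rcases n with _ | n
  · simpa using hv.le
  · rw [sum_digit hv, abs_le]
    have hp : (0 : ℝ) < 2 ^ n := by positivity
    have h1 := Nat.floor_le (a := |v| * 2 ^ n) (by positivity)
    have h2 := Nat.lt_floor_add_one (|v| * 2 ^ n)
    have e : (2 : ℝ) / 2 ^ (n + 1) = 1 / 2 ^ n := by rw [pow_succ]; field_simp
    rw [e]
    constructor
    · rw [neg_le_sub_iff_le_add, ← add_div, le_div_iff₀ hp]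
      exact h2.le
    · rw [sub_le_iff_le_add]
      have : (⌊|v| * 2 ^ n⌋₊ : ℝ) / 2 ^ n ≤ |v| := by rwa [div_le_iff₀ hp]
      have h0 : (0 : ℝ) ≤ 1 / 2 ^ n := by positivity
      linarith

theorem sign_mul_abs (v : ℝ) : (if digit v 0 then (-1 : ℝ) else 1) * |v| = v := by
  by_cases h : v < 0
  · simp [digit, h, abs_of_neg h]
  · simp [digit, h, abs_of_nonneg (not_lt.1 h)]

theorem abs_sign_mul (b : Bool) (x : ℝ) : |(if b then (-1 : ℝ) else 1) * x| = |x| := by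
  cases b <;> simp

theorem abs_outVal_sub_le {q : ℕ} {v : ℝ} (hv : |v| < 2) :
    |outVal (fun j : Fin (q + 1) => digit v j) - v| ≤ 2 / 2 ^ q := by
  have h := abs_sum_digit_sub_le hv q
  have e : outVal (fun j : Fin (q + 1) => digit v j) = (if digit v 0 then (-1 : ℝ) else 1) *
      ∑ j : Fin q, (if digit v ((j : ℕ) + 1) then 1 else 0) / (2 : ℝ) ^ (j : ℕ) := rfl
  have e' : outVal (fun j : Fin (q + 1) => digit v j) - v = (if digit v 0 then (-1 : ℝ) else 1) *
      ((∑ j : Fin q, (if digit v ((j : ℕ) + 1) then 1 else 0) / (2 : ℝ) ^ (j : ℕ)) - |v|) := by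
    rw [e, mul_sub, sign_mul_abs]
  rw [e', abs_sign_mul, Fin.sum_univ_eq_sum_range (fun j => (if digit v (j + 1) then 1 else 0) / (2 : ℝ) ^ j) q]
  exact h

end Digits

/-! ### Numbering the wires -/

section Transport

variable {V ι : Type} [DecidableEq V] [Fintype V] [Fintype ι] [DecidableEq ι]

/-- A step on numbered wires. -/
def toStep {m : ℕ} (e : V ≃ Fin m) : WStep V ι → Step m ι
  | .gate r hr w U => .gate r hr (w.trans e.toEmbedding) U
  | .query w => .query (w.trans e.toEmbedding)

theorem applyOn_trans {κ : Type} [Fintype κ] [DecidableEq κ] {m : ℕ} (e : V ≃ Fin m) (w : κ ↪ V)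
    (U : Matrix (Bits κ) (Bits κ) ℂ) (ψ : State m) (a : Bits (Fin m)) :
    applyOn (w.trans e.toEmbedding) U ψ a = act w U (fun x => ψ (x ∘ e.symm)) (a ∘ e) := by
  unfold applyOn act
  refine Finset.sum_congr rfl fun c _ => ?_
  congr 2
  funext i
  by_cases h : ∃ k, w k = e.symm i
  · obtain ⟨k, hk⟩ := h
    have hi : i = (w.trans e.toEmbedding) k := by simp [hk]
    rw [Function.comp_apply, ← hk, w.injective.extend_apply, hi,
      (w.trans e.toEmbedding).injective.extend_apply]
  · rw [Function.comp_apply, Function.extend_apply' _ _ _ h, Function.extend_apply']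
    · simp
    · rintro ⟨k, rfl⟩
      exact h ⟨k, by simp⟩

theorem apply_toStep (Q : Matrix (Bits ι) (Bits ι) ℂ) {m : ℕ} (e : V ≃ Fin m) (s : WStep V ι)
    (ψ : State m) (a : Bits (Fin m)) :
    (toStep e s).apply Q ψ a = s.apply Q (fun x => ψ (x ∘ e.symm)) (a ∘ e) := by
  cases s <;> exact applyOn_trans ..

theorem foldl_toStep (Q : Matrix (Bits ι) (Bits ι) ℂ) {m : ℕ} (e : V ≃ Fin m) (c : Circ V ι)
    (ψ : State m) (a : Bits (Fin m)) :
    (c.map (toStep e)).foldl (fun ψ s => s.apply Q ψ) ψ a =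
      run Q c (fun x => ψ (x ∘ e.symm)) (a ∘ e) := by
  induction c generalizing ψ with
  | nil => simp [Function.comp_assoc]
  | cons s c ih =>
    rw [List.map_cons, List.foldl_cons, ih]
    change _ = run Q c (s.apply Q _) _
    congr 1
    funext x
    rw [apply_toStep]
    simp [Function.comp_assoc]

/-- The quantum algorithm given by a circuit on the wires `V`. -/
def toAlgorithm {q : ℕ} (c : Circ V ι) (init : Bits V) (out : Fin (q + 1) ↪ V) :
    QuantumAlgorithm ι where
  qubits := Fintype.card V
  init := init ∘ (Fintype.equivFin V).symm
  steps := c.map (toStep (Fintype.equivFin V))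
  precision := q
  signWire := Fintype.equivFin V (out 0)
  digitWire j := Fintype.equivFin V (out j.succ)

theorem cost_toAlgorithm {q : ℕ} (c : Circ V ι) (init : Bits V) (out : Fin (q + 1) ↪ V) :
    (toAlgorithm c init out).cost = c.length := by
  simp [QuantumAlgorithm.cost, toAlgorithm]

theorem queryCost_toAlgorithm {q : ℕ} (c : Circ V ι) (init : Bits V) (out : Fin (q + 1) ↪ V) :
    (toAlgorithm c init out).queryCost = queries c := by
  simp only [QuantumAlgorithm.queryCost, toAlgorithm, queries, List.countP_map]
  congr 1
  funext s
  cases s <;> rfl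

theorem finalState_toAlgorithm (Q : Matrix (Bits ι) (Bits ι) ℂ) {q : ℕ} (c : Circ V ι)
    (init : Bits V) (out : Fin (q + 1) ↪ V) (a : Bits (Fin (Fintype.card V))) :
    (toAlgorithm c init out).finalState Q a =
      run Q c (delta init) (a ∘ Fintype.equivFin V) := by
  refine (foldl_toStep Q (Fintype.equivFin V) c _ a).trans ?_
  congr 1
  funext x
  by_cases hx : x = init
  · subst hx
    exact (if_pos rfl).trans (if_pos rfl).symm
  · refine (if_neg fun h => hx ?_).trans (if_neg hx).symm
    exact (Fintype.equivFin V).symm.surjective.right_cancellable.1 h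

open Classical in
theorem prob_toAlgorithm (Q : Matrix (Bits ι) (Bits ι) ℂ) {q : ℕ} (c : Circ V ι) (init : Bits V)
    (out : Fin (q + 1) ↪ V) (P : ℝ → Prop) :
    (toAlgorithm c init out).prob Q P =
      ENNReal.ofReal (∑ x : Bits V,
        if P (outVal (x ∘ out)) then ‖run Q c (delta init) x‖ ^ 2 else 0) := by
  set e := Fintype.equivFin V
  rw [ENNReal.ofReal_sum_of_nonneg fun x _ => by split_ifs <;> positivity]
  refine Fintype.sum_equiv (Equiv.arrowCongr e.symm (Equiv.refl Bool)) _ _ fun a => ?_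
  have ha : (Equiv.arrowCongr e.symm (Equiv.refl Bool)) a = a ∘ e := by
    funext v; simp
  rw [ha]
  have h1 : (toAlgorithm c init out).output a = outVal ((a ∘ e) ∘ out) := rfl
  have h2 : _ = run Q c (delta init) (a ∘ e) := finalState_toAlgorithm Q c init out a
  rw [h1, h2]
  split_ifs <;> simp

end Transport

/-! ### Preparation, phase estimation and readout combined -/

section Full

set_option synthInstance.maxSize 1000

variable {q : ℕ} {S Z ι : Type} [DecidableEq S] [Fintype S] [DecidableEq Z] [Fintype Z]
  [Fintype ι] [DecidableEq ι]

/-- The wires besides those of the phase register and the system: auxiliary wires for controlled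
operations, a wire that is `true`, the output, and wires that are `false`. -/
abbrev Blank (q : ℕ) (S Z : Type) : Type := S ⊕ (Fin q ⊕ (Unit ⊕ (Fin (q + 1) ⊕ Z)))

/-- All wires. -/
abbrev Wires (q : ℕ) (S Z : Type) : Type := Fin q ⊕ (S ⊕ Blank q S Z)

/-- The initial values of the wires in `Blank`. -/
def blank (q : ℕ) (S Z : Type) : Bits (Blank q S Z) :=
  Sum.elim (fun _ => false) (Sum.elim (fun _ => false) (Sum.elim (fun _ => true) fun _ => false))

/-- The output wires. -/
def outWire (q : ℕ) (S Z : Type) : Fin (q + 1) ↪ Wires q S Z :=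
  ⟨fun o => .inr (.inr (.inr (.inr (.inr (.inl o))))), fun a b h => by simpa using h⟩

theorem outWire_apply (o : Fin (q + 1)) :
    outWire q S Z o = .inr (.inr (.inr (.inr (.inr (.inl o))))) := rfl

/-- Preparation, phase estimation, and table lookup. -/
def fullCirc (t : S → unitInterval) (cU : Fin q → Circ (Wires q S Z) ι)
    (tbl : Bits (Fin q) → Bits (Fin (q + 1))) : Circ (Wires q S Z) ι :=
  prep t Finset.univ.toList ++ phaseEst (cW t Sum.inl cU) q ++
    lookup Sum.inl (fun j => .inr (.inr (.inr (.inl j)))) (.inr (.inr (.inr (.inr (.inl ())))))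
      (outWire q S Z) tbl Finset.univ.toList

theorem length_fullCirc_le (t : S → unitInterval) (cU : Fin q → Circ (Wires q S Z) ι)
    (tbl : Bits (Fin q) → Bits (Fin (q + 1))) (w : ℕ) (hw : ∀ p, (cU p).length ≤ w) :
    (fullCirc t cU tbl).length ≤ Fintype.card S + (2 ^ q * (w + (16 * Fintype.card S + 2)) +
      q * (q + 2)) + 2 ^ q * (15 * q + 1) := by
  have h1 := length_phaseEst_le (cW t Sum.inl cU) (w + (16 * Fintype.card S + 2)) (fun p => by
    rw [cW, List.length_append]
    exact Nat.add_le_add (hw p) (length_cR_le t Sum.inl p)) q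
  have h2 := length_lookup_le (ι := ι) (Sum.inl : Fin q → Wires q S Z)
    (fun j => .inr (.inr (.inr (.inl j)))) (.inr (.inr (.inr (.inr (.inl ())))))
      (outWire q S Z) tbl Finset.univ.toList
  simp only [Finset.length_toList, Finset.card_univ, Fintype.card_fun, Fintype.card_bool,
    Fintype.card_fin] at h2
  simp only [fullCirc, List.length_append, length_prep, Finset.length_toList, Finset.card_univ]
  have : 14 * q + (q + 1) = 15 * q + 1 := by ring
  rw [this] at h2
  omega

theorem queries_fullCirc_le (t : S → unitInterval) (cU : Fin q → Circ (Wires q S Z) ι)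
    (tbl : Bits (Fin q) → Bits (Fin (q + 1))) (w : ℕ) (hw : ∀ p, queries (cU p) ≤ w) :
    queries (fullCirc t cU tbl) ≤ 2 ^ q * w := by
  have h1 := queries_phaseEst_le (cW t Sum.inl cU) w (fun p => by
    rw [cW, queries_append, queries_cR]; exact hw p) q
  simpa [fullCirc, queries_append, queries_prep, queries_lookup] using h1

theorem sum_norm_sq_of_orthogonal {R : Type} [Fintype R] [DecidableEq R] (e f : Amp R)
    (h : ∑ x, (starRingEnd ℂ) (e x) * f x = 0) (a b : ℂ) :
    ∑ x, ‖a * e x + b * f x‖ ^ 2 =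
      ‖a‖ ^ 2 * ∑ x, ‖e x‖ ^ 2 + ‖b‖ ^ 2 * ∑ x, ‖f x‖ ^ 2 := by
  have h' : ∑ x, (starRingEnd ℂ) (f x) * e x = 0 := by
    have := congrArg (starRingEnd ℂ) h
    rw [map_sum, map_zero] at this
    rw [← this]
    exact Finset.sum_congr rfl fun x _ => by rw [map_mul, Complex.conj_conj, mul_comm]
  apply Complex.ofReal_injective
  push_cast
  simp only [← Complex.conj_mul', map_add, map_mul]
  have : ∀ x, ((starRingEnd ℂ) a * (starRingEnd ℂ) (e x) + (starRingEnd ℂ) b * (starRingEnd ℂ) (f x)) *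
      (a * e x + b * f x) = (starRingEnd ℂ) a * a * ((starRingEnd ℂ) (e x) * e x) +
      (starRingEnd ℂ) b * b * ((starRingEnd ℂ) (f x) * f x) +
      ((starRingEnd ℂ) a * b * ((starRingEnd ℂ) (e x) * f x) +
      (starRingEnd ℂ) b * a * ((starRingEnd ℂ) (f x) * e x)) := fun x => by ring
  simp only [this, Finset.sum_add_distrib, ← Finset.mul_sum, h, h']
  ring

-- Orthogonality of the two eigenvectors removes the cross terms, so the phase register is
-- distributed as a mixture of the laws for `θ` and `-θ`. Both angles have cosine `lam`, and
-- `phase_tail` applies to each.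
open Classical in
theorem fullCirc_prob {Q : Matrix (Bits ι) (Bits ι) ℂ} {t : S → unitInterval}
    {cU : Fin q → Circ (Wires q S Z) ι} {φ : Amp (S ⊕ Blank q S Z)} {lam : ℝ}
    (h : IsReflection Q t (blank q S Z) cU φ lam) (tbl : Bits (Fin q) → Bits (Fin (q + 1)))
    (P : Bits (Fin (q + 1)) → Prop)
    (hP : ∀ y, |Real.cos (2 * Real.pi * zhat y) - lam| ≤ 44 / 2 ^ q → P (tbl y)) :
    9 / 10 ≤ ∑ x : Bits (Wires q S Z), if P (x ∘ outWire q S Z) then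
      ‖run Q (fullCirc t cU tbl)
        (delta (Sum.elim (fun _ => false) (startBits S (blank q S Z)))) x‖ ^ 2 else 0 := by
  obtain ⟨θ, hθ, e, f, hψ, horth, hce, hcf, he, hf⟩ :=
    h.exists_eigen (anc := Sum.inl) Sum.inl_injective (fun _ => rfl)
  set A : Amp (Fin q) := phaseAmp θ 0
  set B : Amp (Fin q) := phaseAmp (-θ) 0
  set Ψ : Amp (Wires q S Z) := tens A e + tens B f with hΨ
  have hinit : ∀ θ', (delta (Sum.elim (fun _ => false) (startBits S (blank q S Z))) :
      Amp (Wires q S Z)) = tens (phaseAmp θ' q) (delta (startBits S (blank q S Z))) := by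
    intro θ'
    funext x
    have hx : x = Sum.elim (fun _ => false) (startBits S (blank q S Z)) ↔
        (∀ p : Fin q, (p : ℕ) < q → (x ∘ Sum.inl) p = false) ∧
          x ∘ Sum.inr = startBits S (blank q S Z) := by
      constructor
      · rintro rfl; exact ⟨fun _ _ => rfl, rfl⟩
      · rintro ⟨h1, h2⟩
        funext w
        rcases w with p | r
        · exact h1 p p.2
        · exact congrFun h2 r
    have hprod : ∏ p ∈ Finset.univ.filter (fun p : Fin q => q ≤ p), fac θ' p (x ∘ Sum.inl) = 1 :=
      Finset.prod_eq_one fun p hp => by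
        have := p.2
        simp at hp
        omega
    simp only [delta, tens, phaseAmp, hprod, hx, ite_and]
    split_ifs <;> simp
  have hpre : run Q (prep t Finset.univ.toList ++ phaseEst (cW t Sum.inl cU) q)
      (delta (Sum.elim (fun _ => false) (startBits S (blank q S Z)))) = Ψ := by
    -- No factor remains at `j = q`, so the zero state can be read as the start for `θ` in one
    -- summand and for `-θ` in the other.
    have hphase : ∀ θ', (phaseAmp θ' q : Amp (Fin q)) = phaseAmp (0 : ℝ) q := by
      intro θ'
      funext y
      have hprod : ∀ θ'', ∏ p ∈ Finset.univ.filter (fun p : Fin q => q ≤ p), fac θ'' p y = 1 :=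
        fun θ'' => Finset.prod_eq_one fun p hp => by
          have := p.2
          simp at hp
          omega
      simp only [phaseAmp, hprod]
    rw [run_append, hinit 0, run_prep]
    change run Q _ (tens _ (psi t (blank q S Z))) = _
    rw [hψ, tens_add, run_add]
    conv_lhs => enter [1]; rw [← hphase θ]
    conv_lhs => enter [2]; rw [← hphase (-θ)]
    rw [run_phaseEst Q he q le_rfl, run_phaseEst Q hf q le_rfl]
  have hΨ0 : ∀ x, (x ∘ Sum.inr) ∘ Sum.inr ≠ blank q S Z → Ψ x = 0 := fun x hx => by
    simp [hΨ, tens, hce _ hx, hcf _ hx]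
  let G : Bits (Fin q) → Prop := fun y =>
    |Real.cos (2 * Real.pi * zhat y) - lam| ≤ 44 / 2 ^ q
  let T : Bits (Wires q S Z) → Bits (Wires q S Z) := fun x =>
    toggle (outWire q S Z) (tbl (x ∘ Sum.inl)) x
  have hTinl : ∀ x, T x ∘ Sum.inl = x ∘ Sum.inl := fun x => by
    funext p
    exact toggle_of_ne _ _ _ (by simp [outWire_apply])
  have hTT : Function.Involutive T := fun x => by
    change toggle _ (tbl (T x ∘ Sum.inl)) (T x) = x
    rw [hTinl]
    exact toggle_toggle _ _ _
  set fin := run Q (fullCirc t cU tbl)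
    (delta (Sum.elim (fun _ => false) (startBits S (blank q S Z)))) with hfin
  have hfinT : ∀ x, (x ∘ Sum.inr) ∘ Sum.inr = blank q S Z → fin (T x) = Ψ x := by
    intro x hx
    have hx' : ∀ b, x (Sum.inr (Sum.inr b)) = blank q S Z b := fun b => congrFun hx b
    rw [hfin, fullCirc, run_append, hpre, run_lookup Q _ _ _ (outWire q S Z) _ (by simp [outWire_apply])
      (by simp [outWire_apply]) (by simp [outWire_apply]) (by simp) (by simp) (by intro a b h; simpa using h)
      _ (Finset.nodup_toList _)]
    · have : T x ∘ Sum.inl ∈ (Finset.univ : Finset (Bits (Fin q))).toList := by simp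
      simp only [this, decide_true, Bool.true_and]
      change Ψ (T (T x)) = _
      rw [hTT x]
    · change toggle _ _ _ _ = _
      rw [toggle_of_ne _ _ _ (by simp [outWire_apply]), hx']
      rfl
    · intro j
      change toggle _ _ _ _ = _
      rw [toggle_of_ne _ _ _ (by simp [outWire_apply]), hx']
      rfl
  -- The lookup permutes the clean classical states by the involution `T`, which fixes the phase
  -- register. Elsewhere `Ψ` vanishes, so an inequality suffices.
  have hstep : ∑ x, (if G (x ∘ Sum.inl) then ‖Ψ x‖ ^ 2 else 0) ≤
      ∑ x : Bits (Wires q S Z), if P (x ∘ outWire q S Z) then ‖fin x‖ ^ 2 else 0 := by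
    rw [← Equiv.sum_comp (hTT.toPerm T) fun x => if P (x ∘ outWire q S Z) then ‖fin x‖ ^ 2 else 0]
    refine Finset.sum_le_sum fun x _ => ?_
    simp only [Function.Involutive.coe_toPerm]
    by_cases hx : (x ∘ Sum.inr) ∘ Sum.inr = blank q S Z
    · by_cases hG : G (x ∘ Sum.inl)
      · have hout : T x ∘ outWire q S Z = tbl (x ∘ Sum.inl) := by
          funext o
          have hx0 : x (outWire q S Z o) = false :=
            congrFun hx (.inr (.inr (.inr (.inl o))))
          change toggle _ _ _ _ = _
          rw [toggle_out, hx0, Bool.xor_false]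
        have hPT : P (T x ∘ outWire q S Z) := hout ▸ hP _ hG
        rw [if_pos hG, ← hfinT x hx]
        exact (if_pos hPT).ge
      · rw [if_neg hG]
        split_ifs <;> positivity
    · rw [hΨ0 x hx]
      simp only [norm_zero, ne_eq, OfNat.ofNat_ne_zero, not_false_eq_true, zero_pow, ite_self]
      split_ifs <;> positivity
  refine le_trans ?_ hstep
  have hsplit : ∑ x, (if G (x ∘ Sum.inl) then ‖Ψ x‖ ^ 2 else 0) =
      ∑ y : Bits (Fin q), (if G y then
        ‖A y‖ ^ 2 * ∑ s, ‖e s‖ ^ 2 + ‖B y‖ ^ 2 * ∑ s, ‖f s‖ ^ 2 else 0) := by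
    rw [← (Equiv.sumArrowEquivProdArrow (Fin q) (S ⊕ Blank q S Z) Bool).symm.sum_comp,
      Fintype.sum_prod_type]
    refine Finset.sum_congr rfl fun y _ => ?_
    have e1 : ∀ s, ((Equiv.sumArrowEquivProdArrow (Fin q) (S ⊕ Blank q S Z) Bool).symm (y, s)) ∘
      Sum.inl = y := fun s => rfl
    have e2 : ∀ s, ((Equiv.sumArrowEquivProdArrow (Fin q) (S ⊕ Blank q S Z) Bool).symm (y, s)) ∘
      Sum.inr = s := fun s => rfl
    simp only [e1]
    split_ifs
    · rw [← sum_norm_sq_of_orthogonal e f horth]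
      refine Finset.sum_congr rfl fun s _ => ?_
      simp only [hΨ, Pi.add_apply, tens, e1, e2]
    · simp
  have hEF : ∑ s, ‖e s‖ ^ 2 + ∑ s, ‖f s‖ ^ 2 = 1 := by
    have h1 := sum_norm_sq_of_orthogonal e f horth 1 1
    simp only [one_mul, norm_one, one_pow] at h1
    rw [← h1]
    have h2 := psi_dot_psi t (blank q S Z)
    apply Complex.ofReal_injective
    push_cast
    rw [← h2]
    refine Finset.sum_congr rfl fun x _ => ?_
    rw [← Complex.conj_mul', ← Pi.add_apply, ← hψ, star_psi]
  have tail : ∀ θ', Real.cos θ' = lam →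
      9 / 10 ≤ ∑ y : Bits (Fin q), if G y then ‖phaseAmp θ' 0 y‖ ^ 2 else 0 := by
    intro θ' hθ'
    have h1 := phase_tail (q := q) θ'
    have h2 := phaseAmp_norm (q := q) θ' 0 (Nat.zero_le _)
    rw [hθ'] at h1
    have h3 : ∑ y : Bits (Fin q), (if G y then ‖phaseAmp θ' 0 y‖ ^ 2 else 0) +
        ∑ y : Bits (Fin q), (if G y then 0 else ‖phaseAmp θ' 0 y‖ ^ 2) = 1 := by
      rw [← Finset.sum_add_distrib, ← h2]
      exact Finset.sum_congr rfl fun y _ => by split_ifs <;> simp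
    have h4 : ∑ y : Bits (Fin q), (if G y then 0 else ‖phaseAmp θ' 0 y‖ ^ 2) ≤ 1 / 10 := h1
    linarith
  rw [hsplit]
  have hA := tail θ hθ
  have hB := tail (-θ) (by rw [Real.cos_neg, hθ])
  have hsum : ∑ y : Bits (Fin q), (if G y then
        ‖A y‖ ^ 2 * ∑ s, ‖e s‖ ^ 2 + ‖B y‖ ^ 2 * ∑ s, ‖f s‖ ^ 2 else 0) =
      (∑ y : Bits (Fin q), if G y then ‖A y‖ ^ 2 else 0) * ∑ s, ‖e s‖ ^ 2 +
      (∑ y : Bits (Fin q), if G y then ‖B y‖ ^ 2 else 0) * ∑ s, ‖f s‖ ^ 2 := by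
    rw [Finset.sum_mul, Finset.sum_mul, ← Finset.sum_add_distrib]
    exact Finset.sum_congr rfl fun y _ => by split_ifs <;> simp
  rw [hsum]
  have hE : 0 ≤ ∑ s, ‖e s‖ ^ 2 := Finset.sum_nonneg fun _ _ => by positivity
  have hF : 0 ≤ ∑ s, ‖f s‖ ^ 2 := Finset.sum_nonneg fun _ _ => by positivity
  nlinarith [mul_le_mul_of_nonneg_right hA hE, mul_le_mul_of_nonneg_right hB hF]

end Full

/-! ### The query model -/

section Expectation

variable {S B : Type} [DecidableEq S] [DecidableEq B] [Fintype S] [Fintype B]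

/-- The probability that a bit has the value `b`, if it is `true` with probability `t`. -/
def bern (t : ℝ) (b : Bool) : ℝ := if b then t else 1 - t

theorem amplitudeMatrix_true_mul_self {t : ℝ} (h0 : 0 ≤ t) (h1 : t ≤ 1) (b : Bool) :
    amplitudeMatrix t b true * amplitudeMatrix t b true = (bern t b : ℂ) := by
  cases b
  · simp only [amplitudeMatrix, bern, Bool.false_eq_true, if_false]
    rw [← Complex.ofReal_mul, Real.mul_self_sqrt (by linarith)]
  · simp only [amplitudeMatrix, bern, if_true]
    rw [neg_mul_neg, ← Complex.ofReal_mul, Real.mul_self_sqrt h0]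

/-- Squared amplitudes are Bernoulli weights, so diagonal matrix elements in the state `psi` become
expectations over independent bits. -/
theorem sum_psi_mul_psi (t : S → unitInterval) (β : Bits B) (F : Bits (S ⊕ B) → ℝ) :
    ∑ x, psi t β x * psi t β x * (F x : ℂ) =
      ((∑ c : Bits S, (∏ s, bern (t s) (c s)) * F (Sum.elim c β) : ℝ) : ℂ) := by
  rw [← (Equiv.sumArrowEquivProdArrow S B Bool).symm.sum_comp, Fintype.sum_prod_type]
  push_cast
  refine Finset.sum_congr rfl fun c _ => ?_
  rw [Finset.sum_eq_single β]
  · have hx : (Equiv.sumArrowEquivProdArrow S B Bool).symm (c, β) = Sum.elim c β := rfl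
    rw [hx, psi_apply, if_pos (by rfl), ← Finset.prod_mul_distrib]
    congr 1
    exact Finset.prod_congr rfl fun s _ => amplitudeMatrix_true_mul_self (t s).2.1 (t s).2.2 _
  · intro b _ hb
    rw [psi_apply, if_neg]
    · simp
    · exact hb
  · simp

theorem sum_prod_bern {A : Type} [Fintype A] [DecidableEq A] (t : A → ℝ) :
    ∑ c : Bits A, ∏ s, bern (t s) (c s) = 1 := by
  have h := (Finset.prod_univ_sum (fun _ : A => (Finset.univ : Finset Bool))
    fun s b => bern (t s) b).symm
  rw [Fintype.piFinset_univ] at h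
  rw [h]
  exact Finset.prod_eq_one fun s _ => by simp [bern]

theorem sum_bits_sum {A A' : Type} [Fintype A] [DecidableEq A] [Fintype A'] [DecidableEq A']
    (t : A ⊕ A' → ℝ) (F : Bits A → Bits A' → ℝ) :
    ∑ c : Bits (A ⊕ A'), (∏ s, bern (t s) (c s)) * F (c ∘ Sum.inl) (c ∘ Sum.inr) =
      ∑ a : Bits A, (∏ s, bern (t (.inl s)) (a s)) *
        ∑ b : Bits A', (∏ s, bern (t (.inr s)) (b s)) * F a b := by
  rw [← (Equiv.sumArrowEquivProdArrow A A' Bool).symm.sum_comp, Fintype.sum_prod_type]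
  refine Finset.sum_congr rfl fun a _ => ?_
  rw [Finset.mul_sum]
  refine Finset.sum_congr rfl fun b _ => ?_
  have hx : (Equiv.sumArrowEquivProdArrow A A' Bool).symm (a, b) = Sum.elim a b := rfl
  rw [hx, Fintype.prod_sum_type, ← mul_assoc]
  rfl

theorem sum_bits_unit (t : Unit → ℝ) (F : Bits Unit → ℝ) :
    ∑ b : Bits Unit, (∏ s, bern (t s) (b s)) * F b =
      t () * F (fun _ => true) + (1 - t ()) * F fun _ => false := by
  rw [← (Equiv.funUnique Unit Bool).symm.sum_comp]
  simp only [Finset.univ_unique, Finset.prod_singleton, Fintype.sum_bool]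
  simp only [PUnit.default_eq_unit, Equiv.funUnique_symm_apply]
  have h : ∀ b : Bool, (uniqueElim b : Unit → Bool) = fun _ => b := fun b => by
    funext u; cases u; rfl
  simp [h, bern]

theorem sum_bits_half {k : ℕ} (F : Fin (2 ^ k) → ℝ) :
    ∑ c : Bits (Fin k), (∏ s, bern (1 / 2) (c s)) * F ⟨bitsToNat c, bitsToNat_lt c⟩ =
      (∑ i, F i) / 2 ^ k := by
  have h : ∀ c : Bits (Fin k), ∏ s, bern (1 / 2) (c s) = 1 / 2 ^ k := by
    intro c
    have : ∀ b, bern (1 / 2) b = 1 / 2 := fun b => by cases b <;> norm_num [bern]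
    rw [Finset.prod_congr rfl fun s _ => this (c s)]
    simp
  simp only [h, ← Finset.mul_sum]
  rw [div_mul_eq_mul_div, one_mul, ← (bitsEquiv k).sum_comp F]
  congr 1
  refine Finset.sum_congr rfl fun c _ => ?_
  congr 1
  exact Fin.ext (bitsEquiv_val c).symm

end Expectation

/-! ### The walk operator from the real valued oracle -/

section QueryModel

set_option synthInstance.maxSize 1000

variable {k : ℕ} {V : Type} [DecidableEq V]

/-- The parameter of the rotation by the real valued oracle. -/
def oracleParam (v : Fin (2 ^ k) → ℝ) (w : RealPort k → V) (x : Bits V) : ℝ :=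
  (1 + v ⟨bitsToNat fun p => x (w (.inl p)), bitsToNat_lt _⟩) / 2

theorem oracleParam_update (v : Fin (2 ^ k) → ℝ) (w : RealPort k ↪ V) (x : Bits V) (b : Bool) :
    oracleParam v w (Function.update x (w (.inr ())) b) = oracleParam v w x := by
  have : ∀ p, Function.update x (w (.inr ())) b (w (.inl p)) = x (w (.inl p)) := fun p =>
    Function.update_of_ne (by simp) _ _
  simp only [oracleParam, this]

theorem run_query_realOracle (v : Fin (2 ^ k) → ℝ) (w : RealPort k ↪ V) (ψ : Amp V) :
    run (realOracle k v) [.query w] ψ = rotateBy (w (.inr ())) (oracleParam v w) ψ := by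
  funext x
  change act w _ ψ x = _
  unfold act rotateBy rotate
  rw [← (Equiv.sumArrowEquivProdArrow (Fin k) Unit Bool).symm.sum_comp, Fintype.sum_prod_type,
    Finset.sum_eq_single fun p => x (w (.inl p))]
  · rw [← (Equiv.funUnique Unit Bool).symm.sum_comp]
    refine Finset.sum_congr rfl fun b _ => ?_
    have h1 : (fun p => (x ∘ w) (Sum.inl p)) = fun p : Fin k =>
        (Equiv.sumArrowEquivProdArrow (Fin k) Unit Bool).symm
          ((fun p => x (w (.inl p))), (Equiv.funUnique Unit Bool).symm b) (.inl p) := rfl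
    have h2 : bitsToNat (fun p : Fin k =>
        (Equiv.sumArrowEquivProdArrow (Fin k) Unit Bool).symm
          ((fun p => x (w (.inl p))), (Equiv.funUnique Unit Bool).symm b) (.inl p)) < 2 ^ k :=
      bitsToNat_lt _
    rw [realOracle, if_pos h1, dif_pos h2]
    congr 2
    funext u
    by_cases hu : ∃ i, w i = u
    · obtain ⟨i, rfl⟩ := hu
      rw [w.injective.extend_apply]
      rcases i with p | u
      · rw [Function.update_of_ne (by simp)]; rfl
      · cases u; rw [Function.update_self]; rfl
    · rw [Function.extend_apply' _ _ _ hu, Function.update_of_ne]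
      rintro rfl
      exact hu ⟨_, rfl⟩
  · intro a _ ha
    refine Finset.sum_eq_zero fun b _ => ?_
    have h1 : ¬ ((fun p => (x ∘ w) (Sum.inl p)) = fun p : Fin k =>
        (Equiv.sumArrowEquivProdArrow (Fin k) Unit Bool).symm (a, b) (.inl p)) := fun h =>
      ha h.symm
    rw [realOracle, if_neg h1, zero_mul]
  · simp

/-- The sign flip on the states where the wire `u` is `true`. -/
def flip (u : V) (ψ : Amp V) : Amp V := fun x => if x u then -ψ x else ψ x

theorem flip_flip (u : V) (ψ : Amp V) : flip u (flip u ψ) = ψ := by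
  funext x; by_cases h : x u = true <;> simp [flip, h]

theorem flip_dot [Fintype V] (u : V) (ψ φ : Amp V) : flip u ψ ⬝ᵥ φ = ψ ⬝ᵥ flip u φ := by
  refine Finset.sum_congr rfl fun x _ => ?_
  by_cases h : x u = true <;> simp [flip, h]

theorem rotateBy_inr_tens {P R : Type} [DecidableEq P] [DecidableEq R] (r : R)
    (τ : Bits (P ⊕ R) → ℝ) (τ' : Bits R → ℝ) (hτ : ∀ x, τ x = τ' (x ∘ Sum.inr)) (α : Amp P)
    (e : Amp R) : rotateBy (Sum.inr r) τ (tens α e) = tens α (rotateBy r τ' e) := by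
  funext x
  rw [rotateBy, rotate_inr_tens, hτ]
  rfl

theorem run_ph_tens {P R ι : Type} [DecidableEq P] [DecidableEq R] [Fintype ι] [DecidableEq ι]
    (Q : Matrix (Bits ι) (Bits ι) ℂ) (p : P) (r : R) (α : Amp P) (e : Amp R) :
    run Q (ph (.inl p) (.inr r) true circleNeg) (tens α e) =
      tens (sel p true α) (flip r e) + tens (sel p false α) e := by
  funext x
  rw [run_ph Q (by simp)]
  have hc : ((circleNeg : Circle) : ℂ) = -1 := rfl
  cases hp : x (.inl p) <;> cases hr : x (.inr r) <;> simp [tens, sel, flip, hp, hr, hc]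

variable {q : ℕ}

/-- The system wires at which the oracle is applied. -/
def queryPort (q k : ℕ) : RealPort k ↪ Wires q (RealPort k) Empty :=
  ⟨fun s => .inr (.inl s), fun a b h => by simpa using h⟩

/-- The walk operator of the query model, controlled by the wire `p`. -/
def queryU (q k : ℕ) (p : Fin q) : Circ (Wires q (RealPort k) Empty) (RealPort k) :=
  [.query (queryPort q k)] ++ ph (.inl p) (.inr (.inl (.inr ()))) true circleNeg ++
    [.query (queryPort q k)]

/-- The index wires are uniformly distributed, and the target is `false`. -/
def queryParam (k : ℕ) : RealPort k → unitInterval := Sum.elim (fun _ => halfI) fun _ => 0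

theorem queries_queryU (p : Fin q) : queries (queryU q k p) = 2 := by
  simp only [queryU, queries_append, queries_ph]
  rfl

/-- The action of the real valued oracle on the wires besides the phase register. -/
def queryO (v : Fin (2 ^ k) → ℝ) (e : Amp (RealPort k ⊕ Blank q (RealPort k) Empty)) :
    Amp (RealPort k ⊕ Blank q (RealPort k) Empty) :=
  rotateBy (.inl (.inr ())) (oracleParam v Sum.inl) e

theorem queryO_queryO (v : Fin (2 ^ k) → ℝ) (hv : ∀ i, |v i| ≤ 1)
    (e : Amp (RealPort k ⊕ Blank q (RealPort k) Empty)) : queryO v (queryO v e) = e := by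
  refine rotateBy_rotateBy _ (fun x b => ?_) (fun x => ?_) (fun x => ?_) e
  · exact oracleParam_update v ⟨Sum.inl, Sum.inl_injective⟩ x b
  · have := (abs_le.1 (hv ⟨_, bitsToNat_lt fun p => x (.inl (.inl p))⟩)).1
    simp only [oracleParam]; linarith
  · have := (abs_le.1 (hv ⟨_, bitsToNat_lt fun p => x (.inl (.inl p))⟩)).2
    simp only [oracleParam]; linarith

/-- Only the sign flip is controlled; with the control off, the two oracle calls cancel. So a
controlled oracle is not needed. -/
theorem run_queryU (v : Fin (2 ^ k) → ℝ) (hv : ∀ i, |v i| ≤ 1) (p : Fin q) (α : Amp (Fin q))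
    (e : Amp (RealPort k ⊕ Blank q (RealPort k) Empty)) :
    run (realOracle k v) (queryU q k p) (tens α e) =
      tens (sel p true α) (queryO v (flip (.inl (.inr ())) (queryO v e))) +
        tens (sel p false α) e := by
  have hO : ∀ (α' : Amp (Fin q)) e', run (realOracle k v) [.query (queryPort q k)] (tens α' e') =
      tens α' (queryO v e') := fun α' e' => by
    rw [run_query_realOracle]
    exact rotateBy_inr_tens _ _ (oracleParam v Sum.inl) (fun x => rfl) α' e'
  rw [queryU, run_append, run_append, hO, run_ph_tens, run_add, hO, hO,
    queryO_queryO v hv]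

theorem queryO_dot (v : Fin (2 ^ k) → ℝ) (e f : Amp (RealPort k ⊕ Blank q (RealPort k) Empty)) :
    queryO v e ⬝ᵥ f = e ⬝ᵥ queryO v f :=
  rotateBy_dot _ (fun x b => oracleParam_update v ⟨Sum.inl, Sum.inl_injective⟩ x b) e f

theorem star_rotateBy {v : V} {τ : Bits V → ℝ} {e : Amp V}
    (he : ∀ x, (starRingEnd ℂ) (e x) = e x) (x : Bits V) :
    (starRingEnd ℂ) (rotateBy v τ e x) = rotateBy v τ e x := by
  simp [rotateBy, rotate, star_amplitudeMatrix, he]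

theorem star_flip {u : V} {e : Amp V} (he : ∀ x, (starRingEnd ℂ) (e x) = e x) (x : Bits V) :
    (starRingEnd ℂ) (flip u e x) = flip u e x := by
  unfold flip; split <;> simp [he]

theorem Clean.rotateBy {S B : Type} [DecidableEq S] [DecidableEq B] {β : Bits B} {s : S}
    {τ : Bits (S ⊕ B) → ℝ} {e : Amp (S ⊕ B)} (he : Clean β e) :
    Clean β (rotateBy (.inl s) τ e) := by
  intro x hx
  simp only [QuantumIntegration.rotateBy, rotate]
  refine Finset.sum_eq_zero fun b _ => ?_
  rw [he _ (by rwa [update_inl_comp_inr]), mul_zero]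

theorem Clean.flip {S B : Type} {β : Bits B} {u : S ⊕ B}
    {e : Amp (S ⊕ B)} (he : Clean β e) : Clean β (flip u e) := by
  intro x hx
  simp [QuantumIntegration.flip, he x hx]

/-- On target `false`, the matrix element of `OZO` at index `i` is `t - (1 - t) = 2t - 1 = v i`, and
the index is uniform. -/
theorem isReflection_query (v : Fin (2 ^ k) → ℝ) (hv : ∀ i, |v i| ≤ 1) :
    ∃ φ, IsReflection (realOracle k v) (queryParam k) (blank q (RealPort k) Empty) (queryU q k) φ
      ((∑ i, v i) / 2 ^ k) := by
  set ψ := psi (queryParam k) (blank q (RealPort k) Empty) with hψ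
  refine ⟨queryO v (flip (.inl (.inr ())) (queryO v ψ)), ?_, ?_, ?_, ?_, ?_, ?_⟩
  · exact (clean_psi _ _).rotateBy.flip.rotateBy
  · exact star_rotateBy (star_flip (star_rotateBy (star_psi _ _)))
  · rw [queryO_dot, queryO_queryO v hv, flip_dot, flip_flip, queryO_dot, queryO_queryO v hv,
      psi_dot_psi]
  · have h0 : ∀ x, x (.inl (.inr ())) = true → ψ x = 0 := by
      intro x hx
      rw [hψ, psi_apply]
      split_ifs
      · refine Finset.prod_eq_zero (Finset.mem_univ (.inr ())) ?_
        simp [queryParam, hx, amplitudeMatrix]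
      · rfl
    have key : ∀ x, ψ x * queryO v (flip (.inl (.inr ())) (queryO v ψ)) x = ψ x * ψ x *
        ((v ⟨bitsToNat fun p => x (.inl (.inl p)), bitsToNat_lt _⟩ : ℝ) : ℂ) := by
      intro x
      cases hx : x (.inl (.inr ())) with
      | true => simp [h0 x hx]
      | false =>
        have hup : Function.update x (.inl (.inr ())) false = x := by
          rw [← hx, Function.update_eq_self]
        set τ := oracleParam v Sum.inl x with hτ
        have hτu : ∀ b, oracleParam v Sum.inl (Function.update x (.inl (.inr ())) b) = τ :=
          fun b => oracleParam_update v ⟨Sum.inl, Sum.inl_injective⟩ x b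
        have hb := abs_le.1 (hv ⟨_, bitsToNat_lt fun p => x (.inl (.inl p))⟩)
        have hτ0 : 0 ≤ τ := by simp only [hτ, oracleParam]; linarith [hb.1]
        have hτ1 : 0 ≤ 1 - τ := by simp only [hτ, oracleParam]; linarith [hb.2]
        have e0 : (Real.sqrt τ : ℂ) * Real.sqrt τ = τ := by
          rw [← Complex.ofReal_mul, Real.mul_self_sqrt hτ0]
        have e1 : (Real.sqrt (1 - τ) : ℂ) * Real.sqrt (1 - τ) = 1 - τ := by
          rw [← Complex.ofReal_mul, Real.mul_self_sqrt hτ1]; push_cast; rfl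
        have hvτ : ((v ⟨bitsToNat fun p => x (.inl (.inl p)), bitsToNat_lt _⟩ : ℝ) : ℂ) =
            2 * (τ : ℂ) - 1 := by
          simp only [hτ, oracleParam]; push_cast; ring
        have htrue := h0 (Function.update x (.inl (.inr ())) true) (Function.update_self ..)
        rw [hvτ, queryO, rotateBy, rotate]
        simp only [Fintype.sum_bool, flip, Function.update_self, queryO, rotateBy, rotate, hτu,
          Function.update_idem, hx, htrue, hup, amplitudeMatrix, if_true, Bool.false_eq_true,
          if_false]
        rw [← hτ]
        linear_combination (ψ x * ψ x) * (e0 - e1)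
    have hdot : ψ ⬝ᵥ queryO v (flip (.inl (.inr ())) (queryO v ψ)) = ∑ x, ψ x * ψ x *
        ((v ⟨bitsToNat fun p => x (.inl (.inl p)), bitsToNat_lt _⟩ : ℝ) : ℂ) :=
      Finset.sum_congr rfl fun x _ => key x
    rw [hdot, hψ, sum_psi_mul_psi (queryParam k) (blank q (RealPort k) Empty) fun x =>
      v ⟨bitsToNat fun p => x (.inl (.inl p)), bitsToNat_lt _⟩]
    congr 1
    have h1 := sum_bits_sum (fun s => (queryParam k s : ℝ)) fun a (_ : Bits Unit) =>
      v ⟨bitsToNat a, bitsToNat_lt a⟩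
    refine Eq.trans (Finset.sum_congr rfl fun c _ => rfl) (h1.trans ?_)
    simp only [sum_bits_unit]
    rw [← sum_bits_half]
    refine Finset.sum_congr rfl fun c _ => ?_
    simp only [queryParam, Sum.elim_inl, Sum.elim_inr, halfI]
    simp
  · intro p α
    exact run_queryU v hv p α ψ
  · intro p α
    rw [run_queryU v hv, queryO_queryO v hv, flip_flip, queryO_queryO v hv]

end QueryModel

/-! ### The bit number model -/

section BitModel

set_option synthInstance.maxSize 2000

section Oracle

variable {k l n : ℕ} {V : Type} [DecidableEq V]

/-- The classical map of the Boolean oracle. -/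
def oracleMap (v : Fin n → ℝ) (w : BitPort k l → V) (x : Bits V) : Bits V :=
  Function.update x (w (.inr ())) (xor (x (w (.inr ()))) (requestedBit v (x ∘ w)))

theorem requestedBit_update (v : Fin n → ℝ) (w : BitPort k l ↪ V) (x : Bits V) (b : Bool) :
    requestedBit v (Function.update x (w (.inr ())) b ∘ w) = requestedBit v (x ∘ w) := by
  have : ∀ s, (Function.update x (w (.inr ())) b ∘ w) (Sum.inl s) = (x ∘ w) (Sum.inl s) :=
    fun s => Function.update_of_ne (by simp) _ _
  simp only [requestedBit, this]

theorem oracleMap_oracleMap (v : Fin n → ℝ) (w : BitPort k l ↪ V) (x : Bits V) :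
    oracleMap v w (oracleMap v w x) = x := by
  simp only [oracleMap, requestedBit_update, Function.update_self, Function.update_idem]
  rw [Bool.xor_assoc, Bool.xor_self, Bool.xor_false, Function.update_eq_self]

theorem run_query_bitOracle (v : Fin n → ℝ) (w : BitPort k l ↪ V) (ψ : Amp V) (x : Bits V) :
    run (bitOracle k l v) [.query w] ψ x = ψ (oracleMap v w x) := by
  -- The oracle is defined by its columns; because its classical map is an involution, the same map
  -- describes the rows.
  have hM : bitOracle k l v = Matrix.of fun a b : Bits (BitPort k l) =>
      if b = oracleMap v id a then (1 : ℂ) else 0 := by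
    ext a b
    have hinv := oracleMap_oracleMap v (Function.Embedding.refl (BitPort k l))
    refine if_congr ⟨?_, ?_⟩ rfl rfl
    · intro h
      have h' : a = oracleMap v id b := h
      rw [h']
      exact (hinv b).symm
    · intro h
      rw [h]
      exact (hinv a).symm
  change act w (bitOracle k l v) ψ x = _
  rw [hM, act_ite]
  congr 1
  funext u
  by_cases hu : ∃ i, w i = u
  · obtain ⟨i, rfl⟩ := hu
    rw [w.injective.extend_apply]
    by_cases hi : i = .inr ()
    · subst hi
      simp [oracleMap]
    · simp [oracleMap, hi]
  · rw [Function.extend_apply' _ _ _ hu, oracleMap, Function.update_of_ne]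
    rintro rfl
    exact hu ⟨_, rfl⟩

end Oracle

variable {q k l : ℕ}

/-- The system wires of the bit number model: those of the oracle and one more. -/
abbrev BitSys (k l : ℕ) : Type := BitPort k l ⊕ Unit

/-- The wires for asking for the digits of a number. -/
def digitPort (q k l : ℕ) : BitPort k l ↪ Wires q (BitSys k l) (Fin l) :=
  ⟨fun s => .inr (.inl (.inl s)), fun a b h => by simpa using h⟩

/-- The wires for asking for the sign of a number. -/
def signPortFun (q k l : ℕ) : BitPort k l → Wires q (BitSys k l) (Fin l)
  | .inl (.inl p) => .inr (.inl (.inl (.inl (.inl p))))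
  | .inl (.inr p) => .inr (.inr (.inr (.inr (.inr (.inr p)))))
  | .inr u => .inr (.inl (.inl (.inr u)))

/-- The wires for asking for the sign of a number, as an embedding. -/
def signPort (q k l : ℕ) : BitPort k l ↪ Wires q (BitSys k l) (Fin l) :=
  ⟨signPortFun q k l, by
    rintro ((a | a) | a) ((b | b) | b) h <;> simp [signPortFun] at h ⊢ <;> exact h⟩

theorem signPort_apply (s : BitPort k l) : signPort q k l s = signPortFun q k l s := rfl

/-- The target of the oracle. -/
abbrev targetWire (q k l : ℕ) : BitSys k l ⊕ Blank q (BitSys k l) (Fin l) := .inl (.inl (.inr ()))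

/-- The additional system wire. -/
abbrev mixWire (q k l : ℕ) : BitSys k l ⊕ Blank q (BitSys k l) (Fin l) := .inl (.inr ())

/-- The auxiliary wires for the doubly controlled phase flip. -/
def mixControls (q k l : ℕ) : List (Wires q (BitSys k l) (Fin l) × Bool ×
    Wires q (BitSys k l) (Fin l)) :=
  [.inr (), .inl (.inr ())].map fun s : BitSys k l =>
    (.inr (.inl s), true, .inr (.inr (.inl s)))

/-- The walk operator of the bit number model, controlled by the wire `p`. -/
def bitU (q k l : ℕ) (p : Fin q) : Circ (Wires q (BitSys k l) (Fin l)) (BitPort k l) :=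
  [.query (digitPort q k l)] ++ mc (.inl p) (mixControls q k l) (fun v => rot v 1) ++
    [.query (digitPort q k l)] ++ ([.query (signPort q k l)] ++
    ph (.inl p) (.inr (targetWire q k l)) true circleNeg ++ [.query (signPort q k l)]) ++
    ph (.inl p) (.inr (mixWire q k l)) true circleNeg

/-- At most `14 * 2 + 1` steps for the multiply controlled flip, four queries and two phase gates.
-/
theorem length_bitU_le (p : Fin q) : (bitU q k l p).length ≤ 35 := by
  have h1 := length_mc_le (ι := BitPort k l) (fun v => rot v 1) 1 (fun v => le_rfl)
    (mixControls q k l) (.inl p)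
  have h2 := length_ph_le (V := Wires q (BitSys k l) (Fin l)) (ι := BitPort k l)
    (Sum.inl p) (Sum.inr (targetWire q k l)) true circleNeg
  have h3 := length_ph_le (V := Wires q (BitSys k l) (Fin l)) (ι := BitPort k l)
    (Sum.inl p) (Sum.inr (mixWire q k l)) true circleNeg
  have h4 : (mixControls q k l).length = 2 := rfl
  rw [h4] at h1
  simp only [bitU, List.length_append, List.length_singleton]
  omega

/-- The digit of `v i` asked for, in terms of the wires besides the phase register. -/
def askDigit (v : Fin (2 ^ k) → ℝ) (x : Bits (BitSys k l ⊕ Blank q (BitSys k l) (Fin l))) : Bool :=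
  digit (v ⟨bitsToNat fun p => x (.inl (.inl (.inl (.inl p)))), bitsToNat_lt _⟩)
    (bitsToNat fun p => x (.inl (.inl (.inl (.inr p)))))

/-- The sign of `v i`, in terms of the wires besides the phase register. -/
def askSign (v : Fin (2 ^ k) → ℝ) (x : Bits (BitSys k l ⊕ Blank q (BitSys k l) (Fin l))) : Bool :=
  digit (v ⟨bitsToNat fun p => x (.inl (.inl (.inl (.inl p)))), bitsToNat_lt _⟩) 0

/-- The sign by which the walk operator acts. -/
def bitSign (v : Fin (2 ^ k) → ℝ) (x : Bits (BitSys k l ⊕ Blank q (BitSys k l) (Fin l))) : ℝ :=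
  (if x (mixWire q k l) && askDigit v x then -1 else 1) * (if askSign v x then -1 else 1) *
    (if x (mixWire q k l) then -1 else 1)

theorem requestedBit_digitPort (v : Fin (2 ^ k) → ℝ) (x : Bits (Wires q (BitSys k l) (Fin l))) :
    requestedBit v (x ∘ digitPort q k l) = askDigit v (x ∘ Sum.inr) := by
  rw [requestedBit, dif_pos (bitsToNat_lt _)]
  rfl

theorem bitsToNat_false (l : ℕ) : bitsToNat (fun _ : Fin l => false) = 0 := by
  simp [bitsToNat]

theorem requestedBit_signPort (v : Fin (2 ^ k) → ℝ) (x : Bits (Wires q (BitSys k l) (Fin l)))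
    (hx : (x ∘ Sum.inr) ∘ Sum.inr = blank q (BitSys k l) (Fin l)) :
    requestedBit v (x ∘ signPort q k l) = askSign v (x ∘ Sum.inr) := by
  rw [requestedBit, dif_pos (bitsToNat_lt _)]
  have h0 : (fun p : Fin l => (x ∘ signPort q k l) (.inl (.inr p))) = fun _ => false := by
    funext p
    exact congrFun hx (.inr (.inr (.inr (.inr p))))
  rw [h0, bitsToNat_false]
  rfl

/-- Each pair of oracle calls writes a bit to the `false` target and erases it again, and only the
flip in between is controlled. What remains is a diagonal sign. The sign bit is obtained by reading
the digit index `0` from wires that are always `false`. -/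
theorem run_bitU (v : Fin (2 ^ k) → ℝ) (p : Fin q) (α : Amp (Fin q))
    (e : Amp (BitSys k l ⊕ Blank q (BitSys k l) (Fin l)))
    (he : Clean (blank q (BitSys k l) (Fin l)) e)
    (heT : ∀ x, x (targetWire q k l) = true → e x = 0) :
    run (bitOracle k l v) (bitU q k l p) (tens α e) =
      tens (sel p true α) (fun x => (bitSign v x : ℂ) * e x) + tens (sel p false α) e := by
  funext x
  have hchain : ChainOK (.inl p) (mixControls q k l) :=
    chainOK_map _ (by simp) _ _ _ _ (by simp) (by simp) (by intro a b h; simpa using h)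
  simp only [bitU, run_append]
  rw [run_ph _ (by simp), run_query_bitOracle, run_ph _ (by simp), run_query_bitOracle,
    run_query_bitOracle, oracleMap_oracleMap, run_mc_rot_one _ _ _ hchain, run_query_bitOracle,
    oracleMap_oracleMap]
  by_cases hx : (x ∘ Sum.inr) ∘ Sum.inr = blank q (BitSys k l) (Fin l)
  · cases hT : x (.inr (targetWire q k l)) with
    | true =>
      have h0 : e (x ∘ Sum.inr) = 0 := heT _ hT
      simp [tens, h0]
    | false =>
      have hp1 : ∀ w : BitPort k l ↪ Wires q (BitSys k l) (Fin l), (∀ s, w s ≠ .inl p) →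
          oracleMap v w x (.inl p) = x (.inl p) := fun w hw =>
        Function.update_of_ne (hw _).symm _ _
      have hsT : oracleMap v (signPort q k l) x (.inr (targetWire q k l)) =
          askSign v (x ∘ Sum.inr) := by
        rw [oracleMap]
        have : signPort q k l (.inr ()) = .inr (targetWire q k l) := rfl
        rw [this, Function.update_self, hT, Bool.false_xor, requestedBit_signPort v x hx]
      have hdT : oracleMap v (digitPort q k l) x (.inr (targetWire q k l)) =
          askDigit v (x ∘ Sum.inr) := by
        rw [oracleMap]
        have : digitPort q k l (.inr ()) = .inr (targetWire q k l) := rfl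
        rw [this, Function.update_self, hT, Bool.false_xor, requestedBit_digitPort]
      have hdne : ∀ u, u ≠ .inr (targetWire q k l) →
          oracleMap v (digitPort q k l) x u = x u := fun u hu => Function.update_of_ne hu _ _
      have hcond : mcCond (.inl p) (mixControls q k l) (oracleMap v (digitPort q k l) x) =
          (x (.inl p) && (x (.inr (mixWire q k l)) && askDigit v (x ∘ Sum.inr))) := by
        rw [mixControls, mcCond_map _ (by simp) _ _ _ _ (by simp)
          (by intro a b h; simpa using h)]
        · simp only [List.all_cons, List.all_nil, Bool.and_true]
          rw [hdne _ (by simp), hdne _ (by simp), hdT]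
          simp
        · intro s
          rw [hdne _ (by simp)]
          exact congrFun hx (.inl s)
      have hsp : oracleMap v (signPort q k l) x (.inl p) = x (.inl p) := by
        apply hp1
        rintro ((a | a) | a) <;> simp [signPort_apply, signPortFun]
      have hc : ((circleNeg : Circle) : ℂ) = -1 := rfl
      rw [hcond, hsT, hsp]
      simp only [tens, sel, bitSign, hc, Pi.add_apply, Function.comp_apply]
      rcases Bool.eq_false_or_eq_true (x (.inl p)) with h1 | h1 <;>
        rcases Bool.eq_false_or_eq_true (x (.inr (mixWire q k l))) with h2 | h2 <;>
        rcases Bool.eq_false_or_eq_true (askDigit v (x ∘ Sum.inr)) with h3 | h3 <;>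
        rcases Bool.eq_false_or_eq_true (askSign v (x ∘ Sum.inr)) with h4 | h4 <;>
        simp [h1, h2, h3, h4]
  · have h0 : e (x ∘ Sum.inr) = 0 := he _ hx
    simp [tens, h0]

/-- The probability that a digit wire is `true`. -/
def digitProb {l : ℕ} (p : Fin l) : ℝ := 1 / (1 + 2 ^ 2 ^ (p.rev : ℕ))

theorem digitProb_mem {l : ℕ} (p : Fin l) : 0 ≤ digitProb p ∧ digitProb p ≤ 1 := by
  have : (0 : ℝ) < 2 ^ 2 ^ (p.rev : ℕ) := by positivity
  constructor
  · unfold digitProb; positivity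
  · rw [digitProb, div_le_one (by positivity)]; linarith

/-- The probability that all digit wires are `false`. -/
def zeroProb (l : ℕ) : ℝ := ∏ p : Fin l, (1 - digitProb p)

/-- The odds for `true` at `p` are `2 ^ (-2 ^ p.rev)`. Hence the geometric law of the digit index is
a product law of its bits, and `l` one-qubit rotations prepare it. -/
theorem prod_bern_digitProb (c : Bits (Fin l)) :
    ∏ p, bern (digitProb p) (c p) = zeroProb l * (1 / 2) ^ bitsToNat c := by
  rw [zeroProb, bitsToNat, ← Finset.prod_pow_eq_pow_sum, ← Finset.prod_mul_distrib]
  refine Finset.prod_congr rfl fun p _ => ?_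
  cases c p
  · simp [bern]
  · have : (0 : ℝ) < 2 ^ 2 ^ (p.rev : ℕ) := by positivity
    simp only [bern, if_true, Bool.toNat_true, one_mul, digitProb, one_div, inv_pow]
    field_simp
    ring

theorem sum_digitProb (F : ℕ → ℝ) :
    ∑ c : Bits (Fin l), (∏ p, bern (digitProb p) (c p)) * F (bitsToNat c) =
      zeroProb l * ∑ j ∈ Finset.range (2 ^ l), (1 / 2) ^ j * F j := by
  simp only [prod_bern_digitProb]
  rw [← Fin.sum_univ_eq_sum_range (fun j => (1 / 2 : ℝ) ^ j * F j), ← (bitsEquiv l).sum_comp,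
    Finset.mul_sum]
  refine Finset.sum_congr rfl fun c _ => ?_
  rw [bitsEquiv_val]
  ring

theorem zeroProb_mul_sum (l : ℕ) :
    zeroProb l * ∑ j ∈ Finset.range (2 ^ l), (1 / 2 : ℝ) ^ j = 1 := by
  have h := sum_digitProb (l := l) fun _ => 1
  simp only [mul_one] at h
  rw [← h, sum_prod_bern]

/-- `zeroProb l` is the reciprocal of a geometric sum lying between `1` and `2`. -/
theorem zeroProb_bounds (l : ℕ) : 1 / 2 ≤ zeroProb l ∧ zeroProb l ≤ 1 := by
  have h := zeroProb_mul_sum l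
  have h1 : (∑ j ∈ Finset.range (2 ^ l), (1 / 2 : ℝ) ^ j) ≤ 2 := sum_geometric_two_le _
  have h2 : 1 ≤ ∑ j ∈ Finset.range (2 ^ l), (1 / 2 : ℝ) ^ j := by
    have := Finset.single_le_sum (f := fun j => (1 / 2 : ℝ) ^ j) (fun _ _ => by positivity)
      (Finset.mem_range.2 (by positivity : 0 < 2 ^ l))
    simpa using this
  constructor <;> nlinarith

/-- The probability that the additional system wire is `true`. -/
def mixProb (l : ℕ) : unitInterval :=
  ⟨1 / (2 - zeroProb l), by
    have := zeroProb_bounds l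
    constructor
    · exact div_nonneg zero_le_one (by linarith)
    · rw [div_le_one (by linarith)]; linarith⟩

/-- The parameters of the rotations of the system wires. -/
def bitParam (k l : ℕ) : BitSys k l → unitInterval :=
  Sum.elim (Sum.elim (Sum.elim (fun _ => halfI) fun p => ⟨digitProb p, digitProb_mem p⟩)
    fun _ => 0) fun _ => mixProb l

/-- The number given by the sign and the first digits of `y`. -/
def truncate (l : ℕ) (y : ℝ) : ℝ :=
  (if digit y 0 then -1 else 1) *
    ∑ j ∈ Finset.range (2 ^ l - 1), (if digit y (j + 1) then 1 else 0) / (2 : ℝ) ^ j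

theorem abs_truncate_sub_le {y : ℝ} (hy : |y| < 2) : |truncate l y - y| ≤ 2 / 2 ^ (2 ^ l - 1) := by
  have e : truncate l y - y = (if digit y 0 then (-1 : ℝ) else 1) *
      ((∑ j ∈ Finset.range (2 ^ l - 1), (if digit y (j + 1) then 1 else 0) / (2 : ℝ) ^ j) -
        |y|) := by
    rw [mul_sub, sign_mul_abs]; rfl
  rw [e, abs_sign_mul]
  exact abs_sum_digit_sub_le hy _

/-- The scaling factor of the bit number model. -/
def scale (l : ℕ) : ℝ := zeroProb l / (2 - zeroProb l)

/-- Undoing the scaling magnifies the phase estimation error, and this bounds the magnification by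
`3`. -/
theorem scale_ge (l : ℕ) : 1 / 3 ≤ scale l := by
  have := zeroProb_bounds l
  rw [scale, div_le_div_iff₀ (by norm_num) (by linarith)]
  linarith

/-- Write `Z = zeroProb l`, `m = mixProb l`, `s` for the sign and `W` for the sum of the digits. As
digit `0` is the sign bit, the average of `(-1) ^ digit` is `1 - Z(1 - s) - ZW`. The total is `s(1 -
m(2 - Z)) + mZ(sW - 1)`, and `m = 1 / (2 - Z)` is chosen to cancel the first term. -/
theorem sum_bit_value (y : ℝ) :
    zeroProb l * ∑ j ∈ Finset.range (2 ^ l), (1 / 2) ^ j *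
      ((mixProb l : ℝ) * ((if digit y j then -1 else 1) * (if digit y 0 then -1 else 1) * -1) +
        (1 - mixProb l) * (if digit y 0 then -1 else 1)) = scale l * (truncate l y - 1) := by
  have hZ := zeroProb_bounds l
  have hsum := zeroProb_mul_sum l
  set s : ℝ := if digit y 0 then -1 else 1 with hs
  have hd : ∀ j, (if digit y j then (-1 : ℝ) else 1) = 1 - 2 * if digit y j then 1 else 0 :=
    fun j => by split_ifs <;> norm_num
  have hsplit : ∑ j ∈ Finset.range (2 ^ l), (1 / 2 : ℝ) ^ j * (if digit y j then 1 else 0) =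
      (1 - s) / 2 + (∑ j ∈ Finset.range (2 ^ l - 1),
        (if digit y (j + 1) then 1 else 0) / (2 : ℝ) ^ j) / 2 := by
    have hl : 2 ^ l = (2 ^ l - 1) + 1 := (Nat.sub_add_cancel Nat.one_le_two_pow).symm
    conv_lhs => rw [hl]
    rw [Finset.sum_range_succ', Finset.sum_div, add_comm]
    congr 1
    · rw [hs]; split_ifs <;> norm_num
    · refine Finset.sum_congr rfl fun j _ => ?_
      rw [pow_succ, one_div, inv_pow]
      ring
  have hss : s * s = 1 := by rw [hs]; split_ifs <;> norm_num
  have htr : truncate l y = s * ∑ j ∈ Finset.range (2 ^ l - 1),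
      (if digit y (j + 1) then 1 else 0) / (2 : ℝ) ^ j := rfl
  have hterm : ∀ j, (1 / 2 : ℝ) ^ j * ((mixProb l : ℝ) * ((if digit y j then -1 else 1) * s * -1) +
      (1 - mixProb l) * s) = (s * (1 - 2 * mixProb l)) * (1 / 2) ^ j +
        (2 * mixProb l * s) * ((1 / 2) ^ j * if digit y j then 1 else 0) := fun j => by
    rw [hd]; ring
  simp only [hterm, Finset.sum_add_distrib, ← Finset.mul_sum]
  rw [hsplit, htr]
  set W := ∑ j ∈ Finset.range (2 ^ l - 1), (if digit y (j + 1) then 1 else 0) / (2 : ℝ) ^ j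
  have hm : (mixProb l : ℝ) * (2 - zeroProb l) = 1 := by
    rw [mixProb]; field_simp
    exact div_self (by linarith)
  have hsc : scale l = mixProb l * zeroProb l := by rw [scale, mixProb]; ring
  rw [hsc]
  linear_combination (s * (1 - 2 * mixProb l)) * hsum - s * hm -
    (mixProb l * zeroProb l) * hss

theorem isReflection_bit (v : Fin (2 ^ k) → ℝ) :
    ∃ φ, IsReflection (bitOracle k l v) (bitParam k l) (blank q (BitSys k l) (Fin l))
      (bitU q k l) φ (scale l * ((∑ i, truncate l (v i)) / 2 ^ k - 1)) := by
  set ψ := psi (bitParam k l) (blank q (BitSys k l) (Fin l)) with hψ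
  have hsq : ∀ x : Bits (BitSys k l ⊕ Blank q (BitSys k l) (Fin l)),
      (bitSign v x : ℂ) * bitSign v x = 1 := by
    intro x
    have : bitSign v x * bitSign v x = 1 := by
      unfold bitSign; split_ifs <;> norm_num
    exact_mod_cast this
  have hc : Clean (blank q (BitSys k l) (Fin l)) ψ := clean_psi _ _
  have hT : ∀ x, x (targetWire q k l) = true → ψ x = 0 := by
    intro x hx
    rw [hψ, psi_apply]
    split_ifs
    · refine Finset.prod_eq_zero (Finset.mem_univ (.inl (.inr ()))) ?_
      simp [bitParam, hx, amplitudeMatrix]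
    · rfl
  refine ⟨fun x => (bitSign v x : ℂ) * ψ x, ?_, ?_, ?_, ?_, ?_, ?_⟩
  · intro x hx
    simp [hc x hx]
  · intro x
    rw [map_mul, Complex.conj_ofReal, hψ, star_psi]
  · rw [← psi_dot_psi (bitParam k l) (blank q (BitSys k l) (Fin l)), ← hψ]
    refine Finset.sum_congr rfl fun x _ => ?_
    linear_combination (ψ x * ψ x) * hsq x
  · have h1 : psi (bitParam k l) (blank q (BitSys k l) (Fin l)) ⬝ᵥ
        (fun x => (bitSign v x : ℂ) * ψ x) = ∑ x, ψ x * ψ x * (bitSign v x : ℂ) :=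
      Finset.sum_congr rfl fun x _ => by rw [← hψ]; ring
    rw [h1, hψ, sum_psi_mul_psi]
    congr 1
    let F : Bits (Fin k) → Bits (Fin l) → Bits Unit → ℝ := fun a d r =>
      (if r () && digit (v ⟨bitsToNat a, bitsToNat_lt a⟩) (bitsToNat d) then -1 else 1) *
        (if digit (v ⟨bitsToNat a, bitsToNat_lt a⟩) 0 then -1 else 1) * (if r () then -1 else 1)
    have e1 := sum_bits_sum (fun s => (bitParam k l s : ℝ)) fun a r =>
      F (fun p => a (.inl (.inl p))) (fun p => a (.inl (.inr p))) r
    refine Eq.trans (Finset.sum_congr rfl fun c _ => rfl) (e1.trans ?_)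
    let G : Bits (Fin k) → Bits (Fin l) → ℝ := fun a d =>
      ∑ b : Bits Unit, (∏ s, bern (bitParam k l (.inr s)) (b s)) * F a d b
    have e2 := sum_bits_sum (fun s => (bitParam k l (.inl s) : ℝ)) fun a (_ : Bits Unit) =>
      G (fun p => a (.inl p)) (fun p => a (.inr p))
    refine e2.trans ?_
    have e3 := sum_bits_sum (fun s => (bitParam k l (.inl (.inl s)) : ℝ)) G
    simp only [sum_bits_unit]
    -- The integrand does not depend on the target, so averaging over it has no effect.
    have e4 : ∀ z w : ℝ, ((bitParam k l (.inl (.inr ())) : ℝ) * z + (1 -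
        (bitParam k l (.inl (.inr ())) : ℝ)) * z) = z := fun z _ => by ring
    simp only [e4 _ 0]
    refine e3.trans ?_
    have e5 : ∀ a : Bits (Fin k), ∑ b : Bits (Fin l),
        (∏ s, bern (bitParam k l (.inl (.inl (.inr s)))) (b s)) * G a b =
        scale l * (truncate l (v ⟨bitsToNat a, bitsToNat_lt a⟩) - 1) := by
      intro a
      rw [← sum_bit_value, ← sum_digitProb]
      refine Finset.sum_congr rfl fun d _ => ?_
      congr 1
      simp only [G, F, sum_bits_unit]
      simp [bitParam]
    simp only [e5]
    refine (sum_bits_half fun i => scale l * (truncate l (v i) - 1)).trans ?_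
    rw [← Finset.mul_sum, Finset.sum_sub_distrib, Finset.sum_const, Finset.card_univ,
      Fintype.card_fin, nsmul_one, Nat.cast_pow, Nat.cast_ofNat, mul_div_assoc, sub_div,
      div_self (by positivity)]
  · intro p α
    exact run_bitU v p α ψ hc hT
  · intro p α
    rw [run_bitU v p α _ (fun x hx => by simp [hc x hx]) (fun x hx => by simp [hT x hx])]
    congr 2
    funext x
    rw [← mul_assoc, hsq, one_mul]

end BitModel

/-! ### Sampling -/

section Sampling

variable {X : Type u} [MeasurableSpace X]

/-- Chebyshev's inequality: by independence the variance of the sum is at most `n`, each summand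
having variance at most `∫ f² ≤ 1`. -/
theorem measure_sample_mean_le (μ : Measure X) [IsProbabilityMeasure μ] {f : X → ℝ}
    (hf : Measurable f) (hf1 : ∀ x, |f x| ≤ 1) {n : ℕ} (hn : 0 < n) {δ : ℝ} (hδ : 0 < δ) :
    (Measure.pi fun _ : Fin n => μ) {x | δ ≤ |(∑ i, f (x i)) / n - ∫ z, f z ∂μ|} ≤
      ENNReal.ofReal (1 / (n * δ ^ 2)) := by
  set P := Measure.pi fun _ : Fin n => μ
  have hn' : (0 : ℝ) < n := by exact_mod_cast hn
  have hL : MemLp f 2 μ := MemLp.of_bound hf.aestronglyMeasurable 1 (ae_of_all _ hf1)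
  have hmp : ∀ i, MeasurePreserving (Function.eval i) P μ := fun i =>
    measurePreserving_eval (fun _ : Fin n => μ) i
  have hLi : ∀ i, MemLp (fun x : Fin n → X => f (x i)) 2 P := fun i =>
    hL.comp_measurePreserving (hmp i)
  have hint : ∀ i, ∫ x, f (x i) ∂P = ∫ z, f z ∂μ := fun i => by
    rw [← (hmp i).map_eq, integral_map (measurable_pi_apply i).aemeasurable
      hf.aestronglyMeasurable]
  have hind : ProbabilityTheory.iIndepFun (fun i (x : Fin n → X) => f (x i)) P :=
    ProbabilityTheory.iIndepFun_pi (X := fun _ : Fin n => f) fun _ => hf.aemeasurable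
  set S : (Fin n → X) → ℝ := ∑ i, fun x => f (x i) with hS
  have hSx : ∀ x, S x = ∑ i, f (x i) := fun x => by simp [hS]
  have hSL : MemLp S 2 P := memLp_finsetSum' _ fun i _ => hLi i
  have hES : ∫ x, S x ∂P = n * ∫ z, f z ∂μ := by
    simp only [hSx]
    rw [integral_finsetSum _ fun i _ => (hLi i).integrable (by norm_num)]
    simp [hint]
  have hvi : ∀ i, ProbabilityTheory.variance (fun x : Fin n → X => f (x i)) P ≤ 1 := by
    intro i
    refine (ProbabilityTheory.variance_le_expectation_sq (hLi i).aestronglyMeasurable).trans ?_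
    calc _ ≤ ∫ _, (1 : ℝ) ∂P := by
          refine integral_mono (hLi i).integrable_sq (integrable_const _) fun x => ?_
          have := hf1 (x i)
          simpa [sq_le_one_iff_abs_le_one] using this
      _ = 1 := by simp
  have hvS : ProbabilityTheory.variance S P ≤ n := by
    rw [hS, ProbabilityTheory.IndepFun.variance_sum (fun i _ => hLi i)
      fun i _ j _ hij => hind.indepFun hij]
    calc _ ≤ ∑ _i : Fin n, (1 : ℝ) := Finset.sum_le_sum fun i _ => hvi i
      _ = n := by simp
  have hset : {x : Fin n → X | δ ≤ |(∑ i, f (x i)) / n - ∫ z, f z ∂μ|} =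
      {x | n * δ ≤ |S x - ∫ x, S x ∂P|} := by
    ext x
    simp only [Set.mem_ofPred_eq]
    rw [hES, hSx]
    have : (∑ i, f (x i)) / n - ∫ z, f z ∂μ =
        ((∑ i, f (x i)) - n * ∫ z, f z ∂μ) / n := by field_simp
    rw [this, abs_div, abs_of_pos hn', le_div_iff₀ hn', mul_comm]
  rw [hset]
  refine (ProbabilityTheory.meas_ge_le_variance_div_sq hSL (by positivity)).trans
    (ENNReal.ofReal_le_ofReal ?_)
  rw [div_le_div_iff₀ (by positivity) (by positivity)]
  have := mul_le_mul_of_nonneg_right hvS (by positivity : 0 ≤ n * δ ^ 2)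
  nlinarith

/-- A good sample has probability at least `1 - 36/1024 ≥ 9/10`, and `(9/10)² ≥ 3/4`. Comparing `g`
with an indicator avoids any measurability of `g`. -/
theorem three_quarters_le_lintegral (μ : Measure X) [IsProbabilityMeasure μ] {f : X → ℝ}
    (hf : Measurable f) (hf1 : ∀ x, |f x| ≤ 1) {n : ℕ} {ε : ℝ} (hε : 0 < ε)
    (hn : 1024 ≤ ε ^ 2 * n) (g : (Fin n → X) → ℝ≥0∞)
    (hg : ∀ x, |(∑ i, f (x i)) / n - ∫ z, f z ∂μ| < ε / 6 → ENNReal.ofReal (9 / 10) ≤ g x) :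
    3 / 4 ≤ ∫⁻ x, g x ∂(Measure.pi fun _ : Fin n => μ) := by
  have hn0 : 0 < n := by
    rcases Nat.eq_zero_or_pos n with rfl | h
    · norm_num at hn
    · exact h
  set P := Measure.pi fun _ : Fin n => μ
  set E := {x : Fin n → X | ε / 6 ≤ |(∑ i, f (x i)) / n - ∫ z, f z ∂μ|} with hE
  have hEm : MeasurableSet E := by
    refine measurableSet_le measurable_const ?_
    have : Measurable fun x : Fin n → X => (∑ i, f (x i)) / n - ∫ z, f z ∂μ :=
      ((Finset.measurable_sum _ fun i _ => hf.comp (measurable_pi_apply i)).div_const _).sub_const _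
    exact this.abs
  have hPE : P E ≤ ENNReal.ofReal (1 / 10) := by
    refine (measure_sample_mean_le μ hf hf1 hn0 (by positivity)).trans
      (ENNReal.ofReal_le_ofReal ?_)
    rw [div_le_div_iff₀ (by positivity) (by norm_num)]
    nlinarith
  have hPc : ENNReal.ofReal (9 / 10) ≤ P Eᶜ := by
    rw [prob_compl_eq_one_sub hEm, ← ENNReal.ofReal_one]
    calc ENNReal.ofReal (9 / 10) = ENNReal.ofReal 1 - ENNReal.ofReal (1 / 10) := by
          rw [← ENNReal.ofReal_sub _ (by norm_num)]; norm_num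
      _ ≤ _ := tsub_le_tsub_left hPE _
  calc (3 / 4 : ℝ≥0∞) = ENNReal.ofReal (3 / 4) := by
        rw [ENNReal.ofReal_div_of_pos (by norm_num)]; norm_num
    _ ≤ ENNReal.ofReal (9 / 10 * (9 / 10)) := ENNReal.ofReal_le_ofReal (by norm_num)
    _ = ENNReal.ofReal (9 / 10) * ENNReal.ofReal (9 / 10) := ENNReal.ofReal_mul (by norm_num)
    _ ≤ ENNReal.ofReal (9 / 10) * P Eᶜ := by gcongr
    _ = ∫⁻ x, Eᶜ.indicator (fun _ => ENNReal.ofReal (9 / 10)) x ∂P := by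
        rw [lintegral_indicator_const hEm.compl]
    _ ≤ ∫⁻ x, g x ∂P := by
        refine lintegral_mono fun x => ?_
        by_cases hx : x ∈ Eᶜ
        · rw [Set.indicator_of_mem hx]
          exact hg x (not_le.1 hx)
        · rw [Set.indicator_of_notMem hx]
          exact zero_le

end Sampling

/-! ### The algorithms -/

theorem abs_mean_sub_mean_le {n : ℕ} (hn : 0 < n) {a b : Fin n → ℝ} {δ : ℝ}
    (h : ∀ i, |a i - b i| ≤ δ) : |(∑ i, a i) / n - (∑ i, b i) / n| ≤ δ := by
  have hn' : (0 : ℝ) < n := by exact_mod_cast hn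
  rw [← sub_div, ← Finset.sum_sub_distrib, abs_div, abs_of_pos hn', div_le_iff₀ hn', mul_comm]
  refine (Finset.abs_sum_le_sum_abs _ _).trans ((Finset.sum_le_sum fun i _ => h i).trans ?_)
  simp

section Estimation

set_option synthInstance.maxSize 2000

/-- The algorithm that prepares the system, estimates the phase of the walk operator `cU` and
writes out the digits of the value of `F` at the estimated eigenvalue. -/
def estimation {ι S Z : Type} [Fintype ι] [DecidableEq ι] [Fintype S] [DecidableEq S] [Fintype Z]
    [DecidableEq Z] {q : ℕ} (t : S → unitInterval) (cU : Fin q → Circ (Wires q S Z) ι)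
    (F : ℝ → ℝ) : QuantumAlgorithm ι :=
  toAlgorithm
    (fullCirc t cU fun y o => digit (F (Real.cos (2 * Real.pi * zhat y))) o)
    (Sum.elim (fun _ => false) (startBits S (blank q S Z))) (outWire q S Z)

theorem estimation_prob {ι S Z : Type} [Fintype ι] [DecidableEq ι] [Fintype S] [DecidableEq S]
    [Fintype Z] [DecidableEq Z] {q : ℕ} {Q : Matrix (Bits ι) (Bits ι) ℂ} {t : S → unitInterval}
    {cU : Fin q → Circ (Wires q S Z) ι} {φ : Amp (S ⊕ Blank q S Z)} {lam : ℝ}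
    (h : IsReflection Q t (blank q S Z) cU φ lam) (F : ℝ → ℝ) (P : ℝ → Prop)
    (hP : ∀ c w, |c - lam| ≤ 44 / 2 ^ q → (|F c| < 2 → |w - F c| ≤ 2 / 2 ^ q) → P w) :
    ENNReal.ofReal (9 / 10) ≤ (estimation t cU F).prob Q P := by
  rw [estimation, prob_toAlgorithm]
  refine ENNReal.ofReal_le_ofReal (fullCirc_prob h _ (fun g => P (outVal g)) fun y hy => ?_)
  exact hP _ _ hy fun hF => abs_outVal_sub_le hF

theorem querySolves_estimation {X : Type u} [MeasurableSpace X] (μ : Measure X)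
    [IsProbabilityMeasure μ] {ε : ℝ} (hε : 0 < ε) (hε2 : ε ≤ 1 / 2) {q : ℕ}
    (hq : 1024 ≤ ε * 2 ^ q) :
    QuerySolves μ ε (2 ^ (2 * q)) (estimation (queryParam (2 * q)) (queryU q (2 * q)) id) := by
  intro f hf hf1 f' hff' hf'1
  have hN : (0 : ℝ) < 2 ^ q := by positivity
  -- `44` from phase estimation and `2` from the finite output; sampling adds `ε / 6` and the oracle
  -- `ε / 3`.
  have hc : 46 / 2 ^ q ≤ ε / 6 := by
    rw [div_le_div_iff₀ hN (by norm_num)]; linarith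
  refine three_quarters_le_lintegral μ hf hf1 hε ?_ _ fun x hx => ?_
  · have : ((2 ^ (2 * q) : ℕ) : ℝ) = (2 ^ q) ^ 2 := by push_cast; rw [← pow_mul, mul_comm]
    rw [this]
    nlinarith
  · obtain ⟨φ, hφ⟩ := isReflection_query (q := q) (fun i => f' (x i)) fun i => hf'1 _
    refine estimation_prob hφ _ _ fun c w h1 h2 => ?_
    have hm := abs_mean_sub_mean_le (by positivity) fun i => hff' (x i)
    have hm1 : |(∑ i : Fin (2 ^ (2 * q)), f' (x i)) / (2 ^ (2 * q) : ℕ) -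
        (∑ _i : Fin (2 ^ (2 * q)), (0 : ℝ)) / (2 ^ (2 * q) : ℕ)| ≤ 1 :=
      abs_mean_sub_mean_le (by positivity) fun i => by simpa using hf'1 (x i)
    push_cast at hm hm1 hx
    rw [Finset.sum_const_zero, zero_div, sub_zero] at hm1
    have e : (44 : ℝ) / 2 ^ q + 2 / 2 ^ q = 46 / 2 ^ q := by ring
    have hp : 0 < (2 : ℝ) / 2 ^ q := by positivity
    -- The output format holds only numbers of absolute value below `2`; here `|c| ≤ 1 + 44 / 2 ^
    -- q`.
    have h2' := h2 (by
      simp only [id]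
      rw [abs_le] at h1 hm1
      rw [abs_lt]
      constructor <;> linarith)
    simp only [id] at h2'
    rw [abs_le] at *
    rw [abs_lt] at hx
    constructor <;> linarith

theorem bitSolves_estimation {X : Type u} [MeasurableSpace X] (μ : Measure X)
    [IsProbabilityMeasure μ] {ε : ℝ} (hε : 0 < ε) (hε2 : ε ≤ 1 / 2) {q : ℕ}
    (hq : 1024 ≤ ε * 2 ^ q) :
    BitSolves μ ε (2 ^ (2 * q)) (estimation (bitParam (2 * q) q) (bitU q (2 * q) q)
      fun c => 1 + c / scale q) := by
  intro f hf hf1 f' hff'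
  have hN : (0 : ℝ) < 2 ^ q := by positivity
  -- `136 = 3 * 44 + 2 + 2`: the phase error magnified by `1 / scale ≤ 3`, the truncated expansions,
  -- and the finite output.
  have hc : 136 / 2 ^ q ≤ ε / 6 := by
    rw [div_le_div_iff₀ hN (by norm_num)]; linarith
  refine three_quarters_le_lintegral μ hf hf1 hε ?_ _ fun x hx => ?_
  · have : ((2 ^ (2 * q) : ℕ) : ℝ) = (2 ^ q) ^ 2 := by push_cast; rw [← pow_mul, mul_comm]
    rw [this]
    nlinarith
  · obtain ⟨φ, hφ⟩ := isReflection_bit (q := q) (k := 2 * q) (l := q) (fun i => f' (x i))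
    refine estimation_prob hφ _ _ fun c w h1 h2 => ?_
    -- From `1 + ε / 3` with `ε ≤ 1/2`; the binary digits require only a bound below `2`.
    have hb : ∀ z, |f' z| ≤ 7 / 6 := fun z => by
      have h3 := hff' z
      have h4 := hf1 z
      rw [abs_le] at *
      constructor <;> linarith
    have hm := abs_mean_sub_mean_le (by positivity) fun i => hff' (x i)
    have hm1 : |(∑ i : Fin (2 ^ (2 * q)), f' (x i)) / (2 ^ (2 * q) : ℕ) -
        (∑ _i : Fin (2 ^ (2 * q)), (0 : ℝ)) / (2 ^ (2 * q) : ℕ)| ≤ 7 / 6 :=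
      abs_mean_sub_mean_le (by positivity) fun i => by simpa using hb (x i)
    have hm2 : |(∑ i : Fin (2 ^ (2 * q)), truncate q (f' (x i))) / (2 ^ (2 * q) : ℕ) -
        (∑ i : Fin (2 ^ (2 * q)), f' (x i)) / (2 ^ (2 * q) : ℕ)| ≤ 2 / 2 ^ q := by
      refine abs_mean_sub_mean_le (by positivity) fun i =>
        (abs_truncate_sub_le ((hb _).trans_lt (by norm_num))).trans ?_
      -- The `q` digit wires address `2 ^ q - 1` binary digits besides the sign, which is more than
      -- enough.
      have : q ≤ 2 ^ q - 1 := Nat.le_sub_one_of_lt q.lt_two_pow_self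
      gcongr
      norm_num
    push_cast at hm hm1 hm2 hx
    rw [Finset.sum_const_zero, zero_div, sub_zero] at hm1
    set T := (∑ i : Fin (2 ^ (2 * q)), truncate q (f' (x i))) / 2 ^ (2 * q)
    have hs := scale_ge q
    have hs0 : 0 < scale q := by linarith
    have h3 : |1 + c / scale q - T| ≤ 132 / 2 ^ q := by
      have e : 1 + c / scale q - T = (c - scale q * (T - 1)) / scale q := by field_simp; ring
      rw [e, abs_div, abs_of_pos hs0, div_le_iff₀ hs0]
      refine h1.trans ?_
      have : (132 : ℝ) / 2 ^ q = 3 * (44 / 2 ^ q) := by ring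
      rw [this]
      have hp : (0 : ℝ) < 44 / 2 ^ q := by positivity
      nlinarith
    have e : (132 : ℝ) / 2 ^ q + 2 / 2 ^ q + 2 / 2 ^ q = 136 / 2 ^ q := by ring
    have hp : 0 < (2 : ℝ) / 2 ^ q := by positivity
    have h2' := h2 (by
      rw [abs_le] at h3 hm1 hm2
      rw [abs_lt]
      constructor <;> linarith)
    rw [abs_le] at *
    rw [abs_lt] at hx
    constructor <;> linarith

theorem queryCost_estimation_le (q k : ℕ) :
    (estimation (queryParam k) (queryU q k) id).queryCost ≤ 2 ^ q * 2 := by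
  rw [estimation, queryCost_toAlgorithm]
  exact queries_fullCirc_le _ _ _ _ fun p => (queries_queryU p).le

theorem cost_estimation_le (q : ℕ) (F : ℝ → ℝ) :
    (estimation (bitParam (2 * q) q) (bitU q (2 * q) q) F).cost ≤ 74 * (2 ^ q * (q + 1)) := by
  rw [estimation, cost_toAlgorithm]
  refine (length_fullCirc_le _ _ _ 35 fun p => length_bitU_le p).trans ?_
  -- `2q` index wires, `q` digit wires, the target and the mixing wire.
  have hS : Fintype.card (BitSys (2 * q) q) = 3 * q + 2 := by
    simp [Fintype.card_sum]; ring
  have h1 : q ≤ 2 ^ q := q.lt_two_pow_self.le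
  have h2 : 1 ≤ 2 ^ q := Nat.one_le_two_pow
  rw [hS]
  nlinarith

end Estimation

theorem exists_precision {ε : ℝ} (hε : 0 < ε) (hε2 : ε ≤ 1 / 2) :
    ∃ q : ℕ, 1024 ≤ ε * 2 ^ q ∧ (2 : ℝ) ^ q ≤ 2048 * ε⁻¹ ∧ (q : ℝ) + 1 ≤ 20 * Real.log ε⁻¹ := by
  have h2 : (2 : ℝ) ≤ ε⁻¹ := by
    rw [le_inv_comm₀ (by norm_num) hε]; linarith
  obtain ⟨m, hm1, hm2⟩ := exists_nat_pow_near (by linarith : (1 : ℝ) ≤ ε⁻¹) (by norm_num : (1 : ℝ) < 2)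
  have hm : 1 ≤ m := by
    by_contra h
    have : m = 0 := by omega
    subst this
    norm_num at hm2
    linarith
  have hm' : (1 : ℝ) ≤ m := by exact_mod_cast hm
  -- `2 ^ (m + 1)` exceeds `ε⁻¹`, and ten further doublings give the factor `1024`.
  refine ⟨m + 11, ?_, ?_, ?_⟩
  · have h1 : ε * ε⁻¹ = 1 := mul_inv_cancel₀ hε.ne'
    have h3 := mul_lt_mul_of_pos_left hm2 hε
    rw [pow_succ] at h3
    rw [pow_add]
    linarith
  · rw [pow_add]
    linarith
  -- As `m ≥ 1`, one has `m + 12 ≤ 13 m`, and `13 ≤ 20 * log 2`.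
  · have h4 : m * Real.log 2 ≤ Real.log ε⁻¹ := by
      rw [← Real.log_pow]
      exact Real.log_le_log (by positivity) hm1
    have := Real.log_two_gt_d9
    push_cast
    nlinarith

theorem cast_le_ofReal_of_le {a : ℕ∞} {b : ℕ} {r : ℝ} (h : a ≤ b) (hb : (b : ℝ) ≤ r) :
    (a : ℝ≥0∞) ≤ ENNReal.ofReal r := by
  calc (a : ℝ≥0∞) ≤ ((b : ℕ∞) : ℝ≥0∞) := by exact_mod_cast h
    _ = ENNReal.ofReal b := by simp
    _ ≤ _ := ENNReal.ofReal_le_ofReal hb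

theorem compRandomQuant_le {X : Type u} [MeasurableSpace X] {μ : Measure X} {ε : ℝ} {n k l : ℕ}
    {A : QuantumAlgorithm (BitPort k l)} (h : BitSolves μ ε n A) {b : ℕ} (hb : A.cost ≤ b) :
    compRandomQuant μ ε ≤ b := by
  refine le_trans ?_ (Nat.cast_le.2 hb)
  exact iInf_le_of_le n (iInf_le_of_le k (iInf_le_of_le l (iInf_le_of_le A (iInf_le _ h))))

theorem compRandomQuantQuery_le {X : Type u} [MeasurableSpace X] {μ : Measure X} {ε : ℝ}
    {n k : ℕ} {A : QuantumAlgorithm (RealPort k)} (h : QuerySolves μ ε n A) {b : ℕ}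
    (hb : A.queryCost ≤ b) : compRandomQuantQuery μ ε ≤ b := by
  refine le_trans ?_ (Nat.cast_le.2 hb)
  exact iInf_le_of_le n (iInf_le_of_le k (iInf_le_of_le A (iInf_le _ h)))

end QuantumIntegration

end

theorem mainTheorem2 :
    ∃ C : ℝ, 0 < C ∧
      ∀ (X : Type u) [MeasurableSpace X] (μ : Measure X) [IsProbabilityMeasure μ] (ε : ℝ),
        0 < ε → ε ≤ 1 / 2 →
          (QuantumIntegration.compRandomQuant μ ε : ℝ≥0∞) ≤
              ENNReal.ofReal (C * ε⁻¹ * Real.log ε⁻¹) ∧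
            (QuantumIntegration.compRandomQuantQuery μ ε : ℝ≥0∞) ≤ ENNReal.ofReal (C * ε⁻¹) := by
  -- The factors are from `cost_estimation_le` and the two bounds of `exists_precision`. The query
  -- bound needs only `2 * 2048`.
  refine ⟨74 * 2048 * 20, by norm_num, fun X _ μ _ ε hε hε2 => ?_⟩
  obtain ⟨q, hq1, hq2, hq3⟩ := QuantumIntegration.exists_precision hε hε2
  have hε' : 0 < ε⁻¹ := inv_pos.2 hε
  constructor
  · refine QuantumIntegration.cast_le_ofReal_of_le
      (QuantumIntegration.compRandomQuant_le (QuantumIntegration.bitSolves_estimation μ hε hε2 hq1)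
        (QuantumIntegration.cost_estimation_le q _)) ?_
    push_cast
    have := mul_le_mul hq2 hq3 (by positivity) (by positivity)
    linarith
  · refine QuantumIntegration.cast_le_ofReal_of_le
      (QuantumIntegration.compRandomQuantQuery_le
        (QuantumIntegration.querySolves_estimation μ hε hε2 hq1)
        (QuantumIntegration.queryCost_estimation_le q _)) ?_
    push_cast
    linarith
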